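/- Let $\mathcal A$ be a compact set of real $2\times 2$ matrices whose members have no common invariant subspace other than $\{0\}$ and $\mathbb R^2$. A switching law for $\mathcal A$ is a measurable function $A:[0,\infty)\to\mathcal A$; a trajectory of the system with control set $\mathcal A$ is a (Carathéodory) solution $x:[0,\infty)\to\mathbb R^2$ of $\dot x(t)=A(t)x(t)$ for some switching law $A$. Let $\sigma$ be the Lyapunov exponent of $\mathcal A$, i.e. the infimum of the numbers $s$ such that for every trajectory $x$ there is a constant $C=C(x)$ with $\|x(t)\|\le Ce^{st}$ for all $t\ge 0$, and assume that $\sigma I\notin\mathcal A$. A Barabanov norm of $\mathcal A$ is a norm $f$ on $\mathbb R^2$ such that $f(x(t))\le e^{\sigma t}f(x(0))$, $t\ge0$, for every trajectory $x$ of $\mathcal A$, and such that through every initial point there is an extremal trajectory, i.e. a trajectory $\bar x$ of the system with control set $\mathrm{co}(\mathcal A)$ with $f(\bar x(t))=e^{\sigma t}f(\bar x(0))$ for all $t\ge 0$. A matrix $A\in\mathrm{co}(\mathcal A)$, $A\ne\sigma I$, is dominant if the largest real part of its eigenvalues equals $\sigma$; $\mathcal A$ has real (complex) dominance if there is a dominant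 matrix with real (non-real) eigenvalues. Suppose that $\mathcal A$ does not have real dominance. Then $\mathcal A$ has a Barabanov norm, this norm is unique up to multiplication by a positive constant, and its unit sphere $S$ is a $C^1$ closed curve (it has a regular periodic $C^1$ parametrization that is injective on a period). Suppose in addition that $\mathcal A$ does not have complex dominance, and let $f$ be a Barabanov norm with unit sphere $S$. Then there is an extremal trajectory $\bar x$ which is generated by a periodic switching law $A:[0,\infty)\to\mathcal A$ and such that, with $T>0$ the minimal period of $A$, the map $t\mapsto e^{-\sigma t}\bar x(t)$ is a bijection of $[0,2T)$ onto $S$. This extremal trajectory is unique in the following sense: for every extremal trajectory $y$ with $y(0)\ne0$ there are $c>0$ and a continuous strictly increasing function $\tau:[0,\infty)\to[0,\infty)$ with $\tau(t)\to\infty$ as $t\to\infty$ such that $e^{-\sigma t}y(t)=c\,e^{-\sigma\tau(t)}\bar x(\tau(t))$ for all $t\ge0$. -/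

import Mathlib

open Set Filter Topology MeasureTheory

namespace PlanarSwitching

/-- The plane `ℝ²`. All notions below are independent of the choice of a reference norm on it. -/
abbrev Plane : Type := Fin 2 → ℝ

/-- Real `2 × 2` matrices. -/
abbrev Mat : Type := Matrix (Fin 2) (Fin 2) ℝ

/-- The matrices of the family have no common invariant subspace except `0` and the plane. -/
def IsIrreducible (𝒜 : Set Mat) : Prop :=
  ∀ W : Submodule ℝ Plane, (∀ A ∈ 𝒜, ∀ v ∈ W, A.mulVec v ∈ W) → W = ⊥ ∨ W = ⊤

/-- A switching law for the control set `𝒜`: a measurable `𝒜`-valued function of the time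
`t ≥ 0` (the values at negative times play no role). -/
def IsSwitchingLaw (𝒜 : Set Mat) (A : ℝ → Mat) : Prop :=
  (∀ i j, Measurable fun t => A t i j) ∧ ∀ t, 0 ≤ t → A t ∈ 𝒜

/-- `x` solves `ẋ(t) = A(t) x(t)`, `t ≥ 0`, in the sense of Carathéodory. -/
def IsSolution (A : ℝ → Mat) (x : ℝ → Plane) : Prop :=
  ContinuousOn x (Ici 0) ∧ ∀ t, 0 ≤ t → x t = x 0 + ∫ s in (0 : ℝ)..t, (A s).mulVec (x s)

/-- `x` is a trajectory of the linear switching system with control set `𝒜`. -/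
def IsTrajectory (𝒜 : Set Mat) (x : ℝ → Plane) : Prop :=
  ∃ A : ℝ → Mat, IsSwitchingLaw 𝒜 A ∧ IsSolution A x

/-- The Lyapunov exponent: the infimum of the `s` such that every trajectory satisfies
`‖x(t)‖ ≤ C e^{s t}`, with a constant `C` that may depend on the trajectory. -/
noncomputable def lyapunovExponent (𝒜 : Set Mat) : ℝ :=
  sInf {s : ℝ | ∀ x, IsTrajectory 𝒜 x → ∃ C : ℝ, ∀ t, 0 ≤ t → ‖x t‖ ≤ C * Real.exp (s * t)}

/-- `x` is an extremal trajectory with respect to `f`: a trajectory of the system with control set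
`co(𝒜)` along which `f` grows exactly as `e^{σ t}`. -/
def IsExtremalTrajectory (𝒜 : Set Mat) (f : Seminorm ℝ Plane) (x : ℝ → Plane) : Prop :=
  IsTrajectory (convexHull ℝ 𝒜) x ∧
    ∀ t, 0 ≤ t → f (x t) = Real.exp (lyapunovExponent 𝒜 * t) * f (x 0)

/-- `f` is a Barabanov (invariant) norm of the system with control set `𝒜`. -/
structure IsBarabanovNorm (𝒜 : Set Mat) (f : Seminorm ℝ Plane) : Prop where
  /-- `f` is a norm. -/
  definite : ∀ v, f v = 0 → v = 0
  growth_le : ∀ x, IsTrajectory 𝒜 x →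
    ∀ t, 0 ≤ t → f (x t) ≤ Real.exp (lyapunovExponent 𝒜 * t) * f (x 0)
  exists_extremal : ∀ v : Plane, ∃ x, IsExtremalTrajectory 𝒜 f x ∧ x 0 = v

/-- The complex eigenvalues of a real matrix. -/
def eigenvalues (A : Mat) : Set ℂ :=
  spectrum ℂ (A.map (fun a : ℝ => (a : ℂ)))

/-- `A` is dominant for `𝒜`: it lies in `co(𝒜)`, differs from `σI`, and the largest real part of
its eigenvalues is equal to `σ`. -/
def IsDominant (𝒜 : Set Mat) (A : Mat) : Prop :=
  A ∈ convexHull ℝ 𝒜 ∧ A ≠ lyapunovExponent 𝒜 • (1 : Mat) ∧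
    IsGreatest (Complex.re '' eigenvalues A) (lyapunovExponent 𝒜)

/-- Some dominant matrix has only real eigenvalues. -/
def HasRealDominance (𝒜 : Set Mat) : Prop :=
  ∃ A, IsDominant 𝒜 A ∧ ∀ z ∈ eigenvalues A, z.im = 0

/-- Some dominant matrix has non-real eigenvalues. -/
def HasComplexDominance (𝒜 : Set Mat) : Prop :=
  ∃ A, IsDominant 𝒜 A ∧ ∃ z ∈ eigenvalues A, z.im ≠ 0

/-- The unit sphere of `f`. -/
def unitSphere (f : Seminorm ℝ Plane) : Set Plane := {v | f v = 1}

/-- `S` is a simple closed curve of class `C¹`: it has a regular periodic `C¹` parametrization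
that is injective on a period. -/
def IsC1ClosedCurve (S : Set Plane) : Prop :=
  ∃ (L : ℝ) (γ : ℝ → Plane), 0 < L ∧ ContDiff ℝ 1 γ ∧ Function.Periodic γ L ∧
    (∀ t, deriv γ t ≠ 0) ∧ BijOn γ (Ico 0 L) S

/-- `T` is the (minimal positive) period of the switching law `A` on `[0, ∞)`. -/
def IsMinimalPeriod (A : ℝ → Mat) (T : ℝ) : Prop :=
  IsLeast {P : ℝ | 0 < P ∧ ∀ t, 0 ≤ t → A (t + P) = A t} T

/-- After removing the factor `e^{s t}`, the function `y` runs along the same curve as `x`: they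
agree up to a positive factor, the choice of the starting point on the curve, and an
orientation-preserving change of the speed. -/
def SameTrajectory (s : ℝ) (y x : ℝ → Plane) : Prop :=
  ∃ (c : ℝ) (τ : ℝ → ℝ), 0 < c ∧ 0 ≤ τ 0 ∧ ContinuousOn τ (Ici 0) ∧ StrictMonoOn τ (Ici 0) ∧
    Tendsto τ atTop atTop ∧
    ∀ t, 0 ≤ t → Real.exp (-s * t) • y t = c • (Real.exp (-s * τ t) • x (τ t))

end PlanarSwitching

/-!
Subtracting `σI` from the matrices reduces everything to the exponent `0`. The least rate `s` for
which a norm grows at most like `e^{st}` along all constant laws exists by compactness, and the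
limit of the suprema of such a norm over the transitions of long piecewise constant laws is a norm
with a tangent velocity at every point of its sphere. Following these velocities on a fine grid
shows that the least rate is the Lyapunov exponent.

If there is a dominant matrix with non-real eigenvalues, it becomes a rotation in suitable
coordinates, and the sphere is an ellipse. Otherwise every matrix of the hull is invertible after
the shift and has negative trace. Two tangent velocities of opposite orientations at one point with
the same support line would have a singular convex combination. By monotonicity of the
subdifferential, a point with a counterclockwise tangent velocity therefore has only
counterclockwise ones just after it, and going once around the origin shows that all tangent
velocities have the same orientation. Comparing a point with its predecessors on the sphere then
leaves only one support line, so the sphere is `C¹`.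

A measurable choice of matrices with tangent velocities gives a motion around the sphere whose law
is invariant under half a turn. Every Barabanov norm decreases weakly along this periodic motion,
hence is constant on it, which gives uniqueness. An extremal trajectory also has tangent velocities,
so its polar angle increases with a speed bounded away from `0` and it runs through the same curve.
A period of the law shorter than half a turn would give two independent solutions that both change
sign after half a turn, although negative traces contract the area between them.
-/

open scoped Matrix NNReal

namespace PlanarSwitching

/-! ### Seminorms on `ℝⁿ` and their subgradients -/

section Seminorm

variable {n : Type*} [Fintype n]

open scoped Classical in
/-- The sum of the values of a seminorm at the standard basis vectors: a constant that dominates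
the seminorm by the sup norm. -/
noncomputable def basisSum (f : Seminorm ℝ (n → ℝ)) : ℝ := ∑ i, f (Pi.single i 1)

lemma basisSum_nonneg (f : Seminorm ℝ (n → ℝ)) : 0 ≤ basisSum f :=
  Finset.sum_nonneg fun _ _ => apply_nonneg f _

open scoped Classical in
lemma apply_single_le_basisSum (f : Seminorm ℝ (n → ℝ)) (i : n) :
    f (Pi.single i 1) ≤ basisSum f :=
  Finset.single_le_sum (f := fun i => f (Pi.single i 1)) (fun _ _ => apply_nonneg f _)
    (Finset.mem_univ i)

lemma seminorm_le_norm (f : Seminorm ℝ (n → ℝ)) (v : n → ℝ) : f v ≤ basisSum f * ‖v‖ := by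
  classical
  calc f v = f (∑ i, v i • Pi.single i 1) := by rw [← pi_eq_sum_univ']
    _ ≤ ∑ i, f (v i • Pi.single i 1) :=
        Finset.le_sum_of_subadditive f (map_zero f).le (map_add_le_add f) _ _
    _ ≤ ∑ i, ‖v‖ * f (Pi.single i 1) := Finset.sum_le_sum fun i _ => by
        rw [map_smul_eq_mul]
        exact mul_le_mul_of_nonneg_right (norm_le_pi_norm v i) (apply_nonneg f _)
    _ = basisSum f * ‖v‖ := by rw [← Finset.mul_sum, mul_comm, basisSum]

lemma abs_seminorm_sub_le (f : Seminorm ℝ (n → ℝ)) (v w : n → ℝ) :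
    |f v - f w| ≤ basisSum f * ‖v - w‖ :=
  (abs_sub_map_le_sub f v w).trans (seminorm_le_norm f _)

lemma lipschitzWith_seminorm (f : Seminorm ℝ (n → ℝ)) :
    LipschitzWith (basisSum f).toNNReal f :=
  LipschitzWith.of_dist_le_mul fun v w => by
    rw [Real.coe_toNNReal _ (basisSum_nonneg f), Real.dist_eq, dist_eq_norm]
    exact abs_seminorm_sub_le f v w

omit [Fintype n] in
lemma continuous_seminorm [Finite n] (f : Seminorm ℝ (n → ℝ)) : Continuous f := by
  cases nonempty_fintype n
  exact (lipschitzWith_seminorm f).continuous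

lemma exists_mul_norm_le_seminorm {f : Seminorm ℝ (n → ℝ)} (hf : ∀ v, f v = 0 → v = 0) :
    ∃ c > 0, ∀ v, c * ‖v‖ ≤ f v := by
  rcases (Metric.sphere (0 : n → ℝ) 1).eq_empty_or_nonempty with hempty | hne
  · refine ⟨1, one_pos, fun v => ?_⟩
    by_cases hv : v = 0
    · simp [hv]
    · have hmem : ‖v‖⁻¹ • v ∈ Metric.sphere (0 : n → ℝ) 1 := by
        simp [norm_smul, norm_ne_zero_iff.2 hv]
      simp [hempty] at hmem
  obtain ⟨u, hu, hmin⟩ := (isCompact_sphere (0 : n → ℝ) 1).exists_isMinOn hne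
    (continuous_seminorm f).continuousOn
  have hu0 : u ≠ 0 := ne_zero_of_mem_unit_sphere ⟨u, hu⟩
  refine ⟨f u, (apply_nonneg f u).lt_of_ne' (mt (hf u) hu0), fun v => ?_⟩
  rcases eq_or_ne v 0 with rfl | hv
  · simp
  have hv' : 0 < ‖v‖ := norm_pos_iff.2 hv
  have hle : f u ≤ f (‖v‖⁻¹ • v) := hmin (by simp [norm_smul, hv'.ne'])
  rwa [map_smul_eq_mul, norm_inv, norm_norm, inv_mul_eq_div, le_div_iff₀ hv'] at hle

/-- The subdifferential of a seminorm, functionals being represented by dot products. -/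
def Subgrad (f : Seminorm ℝ (n → ℝ)) (x : n → ℝ) : Set (n → ℝ) :=
  {p | p ⬝ᵥ x = f x ∧ ∀ v, p ⬝ᵥ v ≤ f v}

lemma subgrad_nonempty (f : Seminorm ℝ (n → ℝ)) (x : n → ℝ) : (Subgrad f x).Nonempty := by
  classical
  rcases eq_or_ne x 0 with rfl | hx
  · exact ⟨0, by simp, fun v => by simp⟩
  obtain ⟨g, hg, hgf⟩ := exists_extension_of_le_sublinear
    (LinearPMap.mkSpanSingleton (K := ℝ) x (f x) hx) f
    (fun c hc v => by rw [map_smul_eq_mul, Real.norm_of_nonneg hc.le])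
    (fun v w => map_add_le_add f v w) (by
      rintro ⟨v, hv⟩
      obtain ⟨c, rfl⟩ := Submodule.mem_span_singleton.1 hv
      rw [LinearPMap.mkSpanSingleton'_apply, map_smul_eq_mul, smul_eq_mul]
      exact mul_le_mul_of_nonneg_right (le_abs_self c) (apply_nonneg f x))
  have hrep : ∀ v, (dotProductEquiv ℝ n).symm g ⬝ᵥ v = g v :=
    DFunLike.congr_fun ((dotProductEquiv ℝ n).apply_symm_apply g)
  refine ⟨_, ?_, fun v => (hrep v).trans_le (hgf v)⟩
  rw [hrep]
  exact (hg ⟨x, Submodule.mem_span_singleton_self x⟩).trans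
    (LinearPMap.mkSpanSingleton_apply ℝ ℝ (σ := RingHom.id ℝ) hx (f x))

lemma isClosed_subgrad (f : Seminorm ℝ (n → ℝ)) :
    IsClosed {q : (n → ℝ) × (n → ℝ) | q.2 ∈ Subgrad f q.1} := by
  have hclosedEq : IsClosed {q : (n → ℝ) × (n → ℝ) | q.2 ⬝ᵥ q.1 = f q.1} :=
    isClosed_eq (by simp only [dotProduct]; fun_prop) ((continuous_seminorm f).comp continuous_fst)
  have hclosedLe : IsClosed {q : (n → ℝ) × (n → ℝ) | ∀ v, q.2 ⬝ᵥ v ≤ f v} := by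
    simp only [ofPred_forall]
    refine isClosed_iInter fun v => isClosed_le ?_ continuous_const
    simp only [dotProduct]
    fun_prop
  exact hclosedEq.inter hclosedLe

lemma subgrad_subset_closedBall (f : Seminorm ℝ (n → ℝ)) (x : n → ℝ) :
    Subgrad f x ⊆ Metric.closedBall 0 (basisSum f) := by
  classical
  intro p hp
  rw [mem_closedBall_zero_iff, pi_norm_le_iff_of_nonneg (basisSum_nonneg f)]
  intro i
  have hpos := hp.2 (Pi.single i 1)
  have hneg := hp.2 (-Pi.single i 1)
  rw [dotProduct_neg, map_neg_eq_map] at hneg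
  rw [dotProduct_single, mul_one] at hpos hneg
  exact (abs_le'.2 ⟨hpos, hneg⟩).trans (apply_single_le_basisSum f i)

lemma smul_mem_subgrad {f : Seminorm ℝ (n → ℝ)} {x p : n → ℝ} {c : ℝ} (hc : 0 ≤ c)
    (hp : p ∈ Subgrad f x) : p ∈ Subgrad f (c • x) :=
  ⟨by rw [dotProduct_smul, hp.1, map_smul_eq_mul, Real.norm_of_nonneg hc, smul_eq_mul], hp.2⟩

lemma neg_mem_subgrad {f : Seminorm ℝ (n → ℝ)} {x p : n → ℝ} (hp : p ∈ Subgrad f x) :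
    -p ∈ Subgrad f (-x) :=
  ⟨by rw [neg_dotProduct_neg, hp.1, map_neg_eq_map],
    fun v => by
      rw [neg_dotProduct, ← dotProduct_neg, ← map_neg_eq_map f v]
      exact hp.2 (-v)⟩

lemma isCompact_subgrad_graph (f : Seminorm ℝ (n → ℝ)) {𝓑 : Set (Matrix n n ℝ)}
    (h𝓑 : IsCompact 𝓑) {K : Set (n → ℝ)} (hK : IsCompact K) :
    IsCompact {q : (n → ℝ) × (n → ℝ) × Matrix n n ℝ |
      q.1 ∈ K ∧ q.2.1 ∈ Subgrad f q.1 ∧ q.2.2 ∈ 𝓑} := by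
  have hcomp := hK.prod ((isCompact_closedBall (0 : n → ℝ) (basisSum f)).prod h𝓑)
  have hclosed : IsClosed {q : (n → ℝ) × (n → ℝ) × Matrix n n ℝ | q.2.1 ∈ Subgrad f q.1} :=
    (isClosed_subgrad f).preimage
      (show Continuous fun q : (n → ℝ) × (n → ℝ) × Matrix n n ℝ => (q.1, q.2.1) by fun_prop)
  convert hcomp.inter_right hclosed using 1
  ext ⟨x, p, B⟩
  simp only [mem_ofPred_eq, mem_inter_iff, mem_prod]
  exact ⟨fun ⟨hx, hp, hB⟩ => ⟨⟨hx, subgrad_subset_closedBall f x hp, hB⟩, hp⟩,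
    fun ⟨⟨hx, _, hB⟩, hp⟩ => ⟨hx, hp, hB⟩⟩

lemma continuous_pairing :
    Continuous fun q : (n → ℝ) × (n → ℝ) × Matrix n n ℝ => q.2.1 ⬝ᵥ (q.2.2 *ᵥ q.1) := by
  simp only [dotProduct, Matrix.mulVec]
  fun_prop

lemma hasDerivAt_dotProduct {z : ℝ → n → ℝ} {v : n → ℝ} {t : ℝ} (hz : HasDerivAt z v t)
    (p : n → ℝ) : HasDerivAt (fun s => p ⬝ᵥ z s) (p ⬝ᵥ v) t :=
  HasDerivAt.fun_sum fun i _ => (hasDerivAt_pi.1 hz i).const_mul _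

lemma deriv_seminorm_comp {f : Seminorm ℝ (n → ℝ)} {z : ℝ → n → ℝ} {v : n → ℝ} {t : ℝ}
    (hz : HasDerivAt z v t) (hf : DifferentiableAt ℝ (fun s => f (z s)) t) {p : n → ℝ}
    (hp : p ∈ Subgrad f (z t)) : deriv (fun s => f (z s)) t = p ⬝ᵥ v := by
  have hmin : IsLocalMin (fun s => f (z s) - p ⬝ᵥ z s) t :=
    Eventually.of_forall fun s => by simpa only [hp.1, sub_self, sub_nonneg] using hp.2 (z s)
  exact sub_eq_zero.1 (hmin.hasDerivAt_eq_zero (hf.hasDerivAt.sub (hasDerivAt_dotProduct hz p)))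

lemma dotProduct_eq_zero_of_const {f : Seminorm ℝ (n → ℝ)} {z : ℝ → n → ℝ} {v : n → ℝ} {t : ℝ}
    (hz : HasDerivAt z v t) (hf : ∀ᶠ s in 𝓝 t, f (z s) = f (z t)) {p : n → ℝ}
    (hp : p ∈ Subgrad f (z t)) : p ⬝ᵥ v = 0 := by
  have hmax : IsLocalMax (fun s => p ⬝ᵥ z s) t := by
    filter_upwards [hf] with s hs
    rw [hp.1, ← hs]
    exact hp.2 _
  exact hmax.hasDerivAt_eq_zero (hasDerivAt_dotProduct hz p)

end Seminorm

/-! ### Measurable laws and Carathéodory solutions -/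

section Flow

variable {n : Type*} [Fintype n]

/-- A matrix as a continuous linear map of `ℝⁿ` with the sup norm; the operator norm of this map
serves as the norm of a matrix. -/
noncomputable def toCLM : Matrix n n ℝ →ₗ[ℝ] (n → ℝ) →L[ℝ] (n → ℝ) :=
  LinearMap.toContinuousLinearMap.toLinearMap ∘ₗ Matrix.mulVecBilin ℝ ℝ

@[simp] lemma toCLM_apply (A : Matrix n n ℝ) (x : n → ℝ) : toCLM A x = A *ᵥ x := rfl

lemma norm_mulVec_le {A : Matrix n n ℝ} {M : ℝ} (hA : ‖toCLM A‖ ≤ M) (v : n → ℝ) :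
    ‖A *ᵥ v‖ ≤ M * ‖v‖ :=
  (toCLM A).le_of_opNorm_le hA v

lemma exists_norm_toCLM_le_convexHull {𝒜 : Set (Matrix n n ℝ)} (h : IsCompact 𝒜) :
    ∃ M, 0 ≤ M ∧ ∀ A ∈ convexHull ℝ 𝒜, ‖toCLM A‖ ≤ M := by
  obtain ⟨M, hM⟩ := h.exists_bound_of_continuousOn
    (toCLM (n := n)).continuous_of_finiteDimensional.continuousOn
  refine ⟨max M 0, le_max_right _ _, fun A hA => ?_⟩
  have hball : toCLM A ∈ convexHull ℝ (toCLM '' 𝒜) :=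
    (LinearMap.image_convexHull toCLM 𝒜).subset (mem_image_of_mem _ hA)
  refine mem_closedBall_zero_iff.1 (convexHull_min ?_ (convex_closedBall 0 _) hball)
  rintro _ ⟨B, hB, rfl⟩
  exact mem_closedBall_zero_iff.2 ((hM B hB).trans (le_max_left _ _))

/-- Measurable matrix functions which are bounded on `[0, ∞)`. -/
def IsBddLaw (A : ℝ → Matrix n n ℝ) : Prop :=
  (∀ i j, Measurable fun t => A t i j) ∧ ∃ M : ℝ, ∀ t, 0 ≤ t → ‖toCLM (A t)‖ ≤ M

/-- `z` is locally Lipschitz on `[0, ∞)` and solves `ż = B z` almost everywhere there. For bounded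
measurable `B` this is the same as being a Carathéodory solution, see `IsSolution.isFlow` and
`IsFlow.isSolution`. -/
def IsFlow (B : ℝ → Matrix n n ℝ) (z : ℝ → n → ℝ) : Prop :=
  (∀ T : ℝ, ∃ K : ℝ≥0, LipschitzOnWith K z (Icc 0 T)) ∧
    ∀ᵐ t : ℝ, 0 < t → HasDerivAt z (B t *ᵥ z t) t

lemma IsBddLaw.intervalIntegrable {A : ℝ → Matrix n n ℝ} (hA : IsBddLaw A) {x : ℝ → n → ℝ}
    (hx : ContinuousOn x (Ici 0)) {T : ℝ} (hT : 0 ≤ T) :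
    IntervalIntegrable (fun s => A s *ᵥ x s) volume 0 T := by
  obtain ⟨hm, M, hM⟩ := hA
  have hxT : ContinuousOn x (Icc 0 T) := hx.mono Icc_subset_Ici_self
  obtain ⟨R, hR⟩ := isCompact_Icc.exists_bound_of_continuousOn hxT
  rw [intervalIntegrable_iff_integrableOn_Icc_of_le hT]
  refine Integrable.of_bound (μ := volume.restrict (Icc 0 T)) ?_ (M * R) ?_
  · have hxm : AEMeasurable x (volume.restrict (Icc 0 T)) := hxT.aemeasurable measurableSet_Icc
    rw [aemeasurable_pi_iff] at hxm
    exact (aemeasurable_pi_iff.2 fun i => Finset.aemeasurable_fun_sum _ fun j _ =>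
      (hm i j).aemeasurable.mul (hxm j)).aestronglyMeasurable
  · refine (ae_restrict_iff' measurableSet_Icc).2 (Eventually.of_forall fun t ht => ?_)
    exact (norm_mulVec_le (hM t ht.1) _).trans
      (mul_le_mul_of_nonneg_left (hR t ht) ((norm_nonneg _).trans (hM t ht.1)))

lemma continuousOn_Ici_of_Icc {E : Type*} [TopologicalSpace E] {z : ℝ → E}
    (h : ∀ T, ContinuousOn z (Icc 0 T)) : ContinuousOn z (Ici 0) := by
  intro t ht
  refine (h (t + 1) t ⟨ht, by linarith⟩).mono_of_mem_nhdsWithin ?_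
  rw [← Ici_inter_Iic]
  exact inter_mem_nhdsWithin _ (Iic_mem_nhds (by linarith))

lemma IsFlow.continuousOn {B : ℝ → Matrix n n ℝ} {z : ℝ → n → ℝ} (h : IsFlow B z) :
    ContinuousOn z (Ici 0) :=
  continuousOn_Ici_of_Icc fun T => (h.1 T).choose_spec.continuousOn

lemma lipschitzOnWith_coord {K : ℝ≥0} {z : ℝ → n → ℝ} {s : Set ℝ} (h : LipschitzOnWith K z s)
    (i : n) : LipschitzOnWith K (fun t => z t i) s :=
  LipschitzOnWith.of_dist_le_mul fun a ha b hb =>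
    (dist_le_pi_dist (z a) (z b) i).trans (h.dist_le_mul a ha b hb)

lemma IsFlow.integral_eq {B : ℝ → Matrix n n ℝ} (hB : IsBddLaw B) {z : ℝ → n → ℝ}
    (h : IsFlow B z) {t : ℝ} (ht : 0 ≤ t) : z t = z 0 + ∫ s in (0 : ℝ)..t, B s *ᵥ z s := by
  have hI := hB.intervalIntegrable h.continuousOn ht
  obtain ⟨K, hK⟩ := h.1 t
  rw [← uIcc_of_le ht] at hK
  ext i
  have hderiv : ∫ s in (0 : ℝ)..t, deriv (fun s => z s i) s
      = ∫ s in (0 : ℝ)..t, (B s *ᵥ z s) i := by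
    apply intervalIntegral.integral_congr_ae
    filter_upwards [h.2] with s hs hs'
    rw [uIoc_of_le ht] at hs'
    exact (hasDerivAt_pi.1 (hs hs'.1) i).deriv
  have hcoord : ∫ s in (0 : ℝ)..t, (B s *ᵥ z s) i = (∫ s in (0 : ℝ)..t, B s *ᵥ z s) i :=
    (ContinuousLinearMap.proj (R := ℝ) (φ := fun _ : n => ℝ) i).intervalIntegral_comp_comm hI
  rw [Pi.add_apply, ← hcoord, ← hderiv,
    (lipschitzOnWith_coord hK i).absolutelyContinuousOnInterval.integral_deriv_eq_sub,
    add_sub_cancel]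

lemma lipschitzOnWith_smul {φ : ℝ → ℝ} {x : ℝ → n → ℝ} {s : Set ℝ} (hs : IsCompact s) {K K' : ℝ≥0}
    (hφ : LipschitzOnWith K φ s) (hx : LipschitzOnWith K' x s) :
    ∃ L : ℝ≥0, LipschitzOnWith L (fun t => φ t • x t) s := by
  obtain ⟨R, hR⟩ := hs.exists_bound_of_continuousOn hφ.continuousOn
  obtain ⟨R', hR'⟩ := hs.exists_bound_of_continuousOn hx.continuousOn
  refine ⟨Real.toNNReal (R * K' + K * R'), LipschitzOnWith.of_dist_le_mul fun a ha b hb => ?_⟩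
  have hR0 : 0 ≤ R := (norm_nonneg _).trans (hR a ha)
  have hR0' : 0 ≤ R' := (norm_nonneg _).trans (hR' a ha)
  rw [Real.coe_toNNReal _ (by positivity)]
  calc dist (φ a • x a) (φ b • x b) = ‖φ a • (x a - x b) + (φ a - φ b) • x b‖ := by
        rw [dist_eq_norm]; congr 1; module
    _ ≤ ‖φ a‖ * dist (x a) (x b) + dist (φ a) (φ b) * ‖x b‖ := by
        rw [dist_eq_norm, dist_eq_norm, ← norm_smul, ← norm_smul]
        exact norm_add_le _ _
    _ ≤ R * (K' * dist a b) + K * dist a b * R' := by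
        gcongr
        exacts [hR a ha, hx.dist_le_mul a ha b hb, hφ.dist_le_mul a ha b hb, hR' b hb]
    _ = (R * K' + K * R') * dist a b := by ring

lemma hasDerivAt_exp_mul (s t : ℝ) :
    HasDerivAt (fun t : ℝ => Real.exp (s * t)) (s * Real.exp (s * t)) t := by
  simpa [mul_comm] using ((hasDerivAt_id t).const_mul s).exp

lemma IsFlow.exp_smul [DecidableEq n] {A : ℝ → Matrix n n ℝ} {x : ℝ → n → ℝ} (h : IsFlow A x)
    (s : ℝ) :
    IsFlow (fun t => A t - s • (1 : Matrix n n ℝ)) (fun t => Real.exp (-s * t) • x t) := by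
  constructor
  · intro T
    obtain ⟨K, hK⟩ := h.1 T
    have hexp : ContDiffOn ℝ 1 (fun t : ℝ => Real.exp (-s * t)) (Icc 0 T) := by fun_prop
    obtain ⟨K', hK'⟩ := hexp.exists_lipschitzOnWith one_ne_zero (convex_Icc _ _) isCompact_Icc
    exact lipschitzOnWith_smul isCompact_Icc hK' hK
  · filter_upwards [h.2] with t ht htp
    refine ((hasDerivAt_exp_mul (-s) t).smul (ht htp)).congr_deriv ?_
    rw [Matrix.sub_mulVec, Matrix.smul_mulVec, Matrix.one_mulVec, Matrix.mulVec_smul]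
    module

lemma IsFlow.seminorm_le_sub {f : Seminorm ℝ (n → ℝ)} {B : ℝ → Matrix n n ℝ} {z : ℝ → n → ℝ}
    (h : IsFlow B z) {a b ε : ℝ} (ha : 0 ≤ a) (hab : a ≤ b)
    (hd : ∀ᵐ t : ℝ, t ∈ Ioc a b → ∃ p ∈ Subgrad f (z t), p ⬝ᵥ (B t *ᵥ z t) ≤ -ε) :
    f (z b) ≤ f (z a) - ε * (b - a) := by
  obtain ⟨K, hK⟩ := h.1 b
  have hac : AbsolutelyContinuousOnInterval (fun s => f (z s)) a b := by
    refine LipschitzOnWith.absolutelyContinuousOnInterval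
      (K := (basisSum f).toNNReal * K) ?_
    rw [uIcc_of_le hab]
    exact (lipschitzWith_seminorm f).comp_lipschitzOnWith (hK.mono (Icc_subset_Icc_left ha))
  have hderiv : ∫ s in a..b, deriv (fun s => f (z s)) s ≤ ∫ _ in a..b, -ε := by
    apply intervalIntegral.integral_mono_ae_restrict hab hac.intervalIntegrable_deriv (by simp)
    rw [EventuallyLE, ae_restrict_iff' measurableSet_Icc]
    filter_upwards [h.2, hac.ae_differentiableAt, hd, compl_mem_ae_iff.2 (measure_singleton a)]
      with t hflow hdiff hsub hta ht
    have hat : a < t := lt_of_le_of_ne ht.1 (Ne.symm hta)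
    obtain ⟨p, hp, hpB⟩ := hsub ⟨hat, ht.2⟩
    rwa [deriv_seminorm_comp (hflow (ha.trans_lt hat)) (hdiff (by rwa [uIcc_of_le hab])) hp]
  rw [hac.integral_deriv_eq_sub, intervalIntegral.integral_const, smul_eq_mul] at hderiv
  linarith

lemma isFlow_of_hasDerivAt {B : ℝ → Matrix n n ℝ} {z : ℝ → n → ℝ} (hz : ContDiff ℝ 1 z)
    (h : ∀ t, HasDerivAt z (B t *ᵥ z t) t) : IsFlow B z :=
  ⟨fun _ => hz.contDiffOn.exists_lipschitzOnWith one_ne_zero (convex_Icc _ _) isCompact_Icc,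
    Eventually.of_forall fun t _ => h t⟩

lemma IsSwitchingLaw.isBddLaw {𝒜 : Set Mat} (h : IsCompact 𝒜) {A : ℝ → Mat}
    (hA : IsSwitchingLaw (convexHull ℝ 𝒜) A) : IsBddLaw A := by
  obtain ⟨M, -, hM⟩ := exists_norm_toCLM_le_convexHull h
  exact ⟨hA.1, M, fun t ht => hM _ (hA.2 t ht)⟩

lemma IsSolution.exists_lipschitzOnWith {A : ℝ → Mat} (hA : IsBddLaw A) {x : ℝ → Plane}
    (h : IsSolution A x) (T : ℝ) : ∃ K : ℝ≥0, LipschitzOnWith K x (Icc 0 T) := by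
  obtain ⟨R, hR⟩ := isCompact_Icc.exists_bound_of_continuousOn
    (h.1.mono (Icc_subset_Ici_self : Icc 0 T ⊆ Ici 0))
  obtain ⟨M, hM⟩ := hA.2
  refine ⟨Real.toNNReal (M * R), LipschitzOnWith.of_dist_le_mul fun s hs t ht => ?_⟩
  have hM0 : 0 ≤ M := (norm_nonneg _).trans (hM s hs.1)
  have hR0 : 0 ≤ R := (norm_nonneg _).trans (hR s hs)
  rw [Real.coe_toNNReal _ (by positivity), dist_eq_norm, h.2 s hs.1, h.2 t ht.1,
    add_sub_add_left_eq_sub, intervalIntegral.integral_interval_sub_left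
      (hA.intervalIntegrable h.1 hs.1) (hA.intervalIntegrable h.1 ht.1), Real.dist_eq]
  refine intervalIntegral.norm_integral_le_of_norm_le_const fun u hu => ?_
  have hu' : u ∈ Icc 0 T := uIcc_subset_Icc ht hs (uIoc_subset_uIcc hu)
  exact (norm_mulVec_le (hM u hu'.1) _).trans (mul_le_mul_of_nonneg_left (hR u hu') hM0)

lemma IsSolution.isFlow {A : ℝ → Mat} (hA : IsBddLaw A) {x : ℝ → Plane} (h : IsSolution A x) :
    IsFlow A x := by
  refine ⟨h.exists_lipschitzOnWith hA, ?_⟩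
  have hleb : ∀ᵐ t : ℝ, ∀ n : ℕ, t ∈ uIcc (0 : ℝ) n → ∀ c ∈ uIcc (0 : ℝ) n,
      HasDerivAt (fun y => ∫ s in c..y, A s *ᵥ x s) (A t *ᵥ x t) t :=
    ae_all_iff.2 fun n => (hA.intervalIntegrable h.1 n.cast_nonneg).ae_hasDerivAt_integral
  filter_upwards [hleb] with t ht htp
  obtain ⟨n, hn⟩ := exists_nat_gt t
  have hmem : t ∈ uIcc (0 : ℝ) n := by
    rw [uIcc_of_le n.cast_nonneg]
    exact ⟨htp.le, hn.le⟩
  refine ((ht n hmem 0 left_mem_uIcc).const_add (x 0)).congr_of_eventuallyEq ?_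
  filter_upwards [Ioi_mem_nhds htp] with s hs
  exact h.2 s (le_of_lt hs)

lemma IsFlow.isSolution {B : ℝ → Mat} (hB : IsBddLaw B) {z : ℝ → Plane} (h : IsFlow B z) :
    IsSolution B z :=
  ⟨h.continuousOn, fun _ ht => h.integral_eq hB ht⟩

end Flow

/-! ### Constant laws -/

section ExpFlow

variable {n : Type*} [Fintype n]

/-- The flow `e^{tA}` of the constant law `A`. -/
noncomputable def expFlow (A : Matrix n n ℝ) (t : ℝ) : (n → ℝ) →L[ℝ] (n → ℝ) :=
  NormedSpace.exp (t • toCLM A)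

@[simp] lemma expFlow_zero (A : Matrix n n ℝ) : expFlow A 0 = 1 := by
  rw [expFlow, zero_smul, NormedSpace.exp_zero]

lemma expFlow_zero_apply (A : Matrix n n ℝ) (x : n → ℝ) : expFlow A 0 x = x := by
  rw [expFlow_zero, one_apply_eq_self]

lemma expFlow_add (A : Matrix n n ℝ) (s t : ℝ) :
    expFlow A (s + t) = expFlow A s * expFlow A t := by
  let +nondep : NormedAlgebra ℚ ((n → ℝ) →L[ℝ] (n → ℝ)) := .restrictScalars ℚ ℝ _
  rw [expFlow, add_smul, NormedSpace.exp_add_of_commute, expFlow, expFlow]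
  exact ((Commute.refl (toCLM A)).smul_left s).smul_right t

lemma hasDerivAt_expFlow (A : Matrix n n ℝ) (x : n → ℝ) (t : ℝ) :
    HasDerivAt (fun t => expFlow A t x) (A *ᵥ expFlow A t x) t := by
  have h := hasDerivAt_exp_smul_const' (𝕂 := ℝ) (toCLM A) t
  exact (h.clm_apply (hasDerivAt_const t x)).congr_deriv (by simp [expFlow])

lemma continuous_expFlow (A : Matrix n n ℝ) (x : n → ℝ) : Continuous fun t => expFlow A t x :=
  continuous_iff_continuousAt.2 fun t => (hasDerivAt_expFlow A x t).continuousAt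

lemma isFlow_expFlow (A : Matrix n n ℝ) (x : n → ℝ) :
    IsFlow (fun _ => A) (fun t => expFlow A t x) := by
  refine isFlow_of_hasDerivAt ?_ fun t => hasDerivAt_expFlow A x t
  have hderiv : deriv (fun t => expFlow A t x) = fun t => toCLM A (expFlow A t x) :=
    funext fun t => (hasDerivAt_expFlow A x t).deriv
  rw [contDiff_one_iff_deriv, hderiv]
  exact ⟨fun t => (hasDerivAt_expFlow A x t).differentiableAt,
    (toCLM A).continuous.comp (continuous_expFlow A x)⟩

lemma expFlow_sub_smul_one [DecidableEq n] (A : Matrix n n ℝ) (s t : ℝ) :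
    expFlow (A - s • (1 : Matrix n n ℝ)) t = Real.exp (-s * t) • expFlow A t := by
  have hsplit : t • toCLM (A - s • (1 : Matrix n n ℝ))
      = algebraMap ℝ ((n → ℝ) →L[ℝ] (n → ℝ)) (-s * t) + t • toCLM A := by
    ext1 x
    simp only [smul_apply, add_apply, toCLM_apply, Algebra.algebraMap_eq_smul_one,
      one_apply_eq_self, Matrix.sub_mulVec, Matrix.smul_mulVec, Matrix.one_mulVec]
    module
  let +nondep : NormedAlgebra ℚ ((n → ℝ) →L[ℝ] (n → ℝ)) := .restrictScalars ℚ ℝ _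
  rw [expFlow, hsplit, NormedSpace.exp_add_of_commute (Algebra.commute_algebraMap_left _ _),
    ← NormedSpace.algebraMap_exp_comm, ← Real.exp_eq_exp_ℝ, ← Algebra.smul_def, expFlow]

lemma norm_expFlow_le {A : Matrix n n ℝ} {M : ℝ} (hA : ‖toCLM A‖ ≤ M) (t : ℝ) (x : n → ℝ) :
    ‖expFlow A t x‖ ≤ Real.exp (M * |t|) * ‖x‖ := by
  have hone : expFlow A t x = expFlow (t • A) 1 x := by rw [expFlow, expFlow, map_smul, one_smul]
  have hgron := norm_le_gronwallBound_of_norm_deriv_right_le (f := fun u => expFlow (t • A) u x)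
    (f' := fun u => (t • A) *ᵥ expFlow (t • A) u x) (δ := ‖x‖) (K := M * |t|) (ε := 0)
    (a := 0) (b := 1) (continuous_expFlow _ x).continuousOn
    (fun u _ => (hasDerivAt_expFlow _ x u).hasDerivWithinAt)
    (by rw [expFlow_zero_apply])
    (fun u _ => by
      rw [add_zero]
      refine norm_mulVec_le ?_ _
      rw [map_smul, norm_smul, Real.norm_eq_abs, mul_comm]
      exact mul_le_mul_of_nonneg_right hA (abs_nonneg t)) 1 (right_mem_Icc.2 zero_le_one)
  rwa [gronwallBound_ε0, sub_zero, mul_one, mul_comm ‖x‖, ← hone] at hgron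

end ExpFlow

/-! ### Growth rates of seminorms -/

lemma exp_neg_mul_exp (a : ℝ) : Real.exp (-a) * Real.exp a = 1 := by
  rw [← Real.exp_add, neg_add_cancel, Real.exp_zero]

section SeminormLimit

variable {E : Type*} [AddCommGroup E] [Module ℝ E]

lemma exp_neg_smul_exp_smul (a : ℝ) (x : E) : Real.exp (-a) • (Real.exp a • x) = x := by
  rw [smul_smul, exp_neg_mul_exp, one_smul]

lemma seminorm_exp_smul (f : Seminorm ℝ E) (a : ℝ) (x : E) :
    f (Real.exp a • x) = Real.exp a * f x := by
  rw [map_smul_eq_mul, Real.norm_of_nonneg (Real.exp_pos _).le]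

lemma exists_seminorm_of_tendsto {ι : Type*} {l : Filter ι} [l.NeBot]
    {N : ι → Seminorm ℝ E} {g : E → ℝ}
    (h : ∀ v, Tendsto (fun i => N i v) l (𝓝 (g v))) :
    ∃ f : Seminorm ℝ E, ∀ v, f v = g v := by
  refine ⟨Seminorm.of g (fun x y => ?_) (fun a x => ?_), fun v => rfl⟩
  · exact le_of_tendsto_of_tendsto' (h (x + y)) ((h x).add (h y)) fun i => map_add_le_add _ _ _
  · refine tendsto_nhds_unique (h (a • x)) ?_
    simpa only [map_smul_eq_mul] using (h x).const_mul ‖a‖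

end SeminormLimit

section Rate

variable {n : Type*} [Fintype n] {𝒜 : Set (Matrix n n ℝ)} {N : Seminorm ℝ (n → ℝ)} {s : ℝ}

/-- The seminorm `N` grows at rate at most `s` under all constant laws from `𝒜`. -/
def HasRate (𝒜 : Set (Matrix n n ℝ)) (s : ℝ) (N : Seminorm ℝ (n → ℝ)) : Prop :=
  ∀ A ∈ 𝒜, ∀ t, 0 ≤ t → ∀ x, N (expFlow A t x) ≤ Real.exp (s * t) * N x

lemma HasRate.apply_expFlow_le (h : HasRate 𝒜 0 N) {A : Matrix n n ℝ} (hA : A ∈ 𝒜) {t : ℝ}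
    (ht : 0 ≤ t) (x : n → ℝ) : N (expFlow A t x) ≤ N x := by
  simpa using h A hA t ht x

/-- No nonzero seminorm has a growth rate less than `ρ`. -/
def NoRateBelow (𝒜 : Set (Matrix n n ℝ)) (ρ : ℝ) : Prop :=
  ∀ s < ρ, ∀ N : Seminorm ℝ (n → ℝ), HasRate 𝒜 s N → N = 0

lemma deriv_nonpos_of_le_of_ge {g : ℝ → ℝ} {a d : ℝ} (h : HasDerivAt g d a)
    (hg : ∀ u, a ≤ u → g u ≤ g a) : d ≤ 0 := by
  refine le_of_tendsto (h.tendsto_slope.mono_left (nhdsGT_le_nhdsNE a)) ?_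
  filter_upwards [self_mem_nhdsWithin] with u hu
  rw [slope_def_field]
  exact div_nonpos_of_nonpos_of_nonneg (sub_nonpos.2 (hg u hu.le)) (sub_nonneg.2 hu.le)

lemma HasRate.subgrad_le (h : HasRate 𝒜 s N) {A : Matrix n n ℝ} (hA : A ∈ 𝒜) {x p : n → ℝ}
    (hp : p ∈ Subgrad N x) : p ⬝ᵥ (A *ᵥ x) ≤ s * N x := by
  have hderiv := (hasDerivAt_dotProduct (hasDerivAt_expFlow A x 0) p).sub
    ((hasDerivAt_exp_mul s 0).mul_const (N x))
  have hle := deriv_nonpos_of_le_of_ge hderiv fun u hu => by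
    have hpu := (hp.2 (expFlow A u x)).trans (h A hA u hu x)
    have hpx := hp.1
    simp only [Pi.sub_apply, expFlow_zero_apply, mul_zero, Real.exp_zero, one_mul]
    linarith
  simpa [expFlow_zero_apply] using hle

lemma HasRate.apply_mulVec_eq_zero (h : HasRate 𝒜 s N) {A : Matrix n n ℝ} (hA : A ∈ 𝒜)
    {v : n → ℝ} (hv : N v = 0) : N (A *ᵥ v) = 0 := by
  obtain ⟨p, hpeq, hple⟩ := subgrad_nonempty N (A *ᵥ v)
  have hpv : p ∈ Subgrad N v := by
    refine ⟨le_antisymm (hple v) ?_, hple⟩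
    have hneg := hple (-v)
    rw [dotProduct_neg, map_neg_eq_map] at hneg
    linarith
  have hle := h.subgrad_le hA hpv
  rw [hpeq, hv, mul_zero] at hle
  exact le_antisymm hle (apply_nonneg N _)

lemma HasRate.eq_zero_of_apply_eq_zero {𝒜 : Set Mat} (hirr : IsIrreducible 𝒜)
    {N : Seminorm ℝ Plane} (h : HasRate 𝒜 s N) (hN : N ≠ 0) : ∀ v, N v = 0 → v = 0 := by
  let W : Submodule ℝ Plane :=
    { carrier := {v | N v = 0}
      zero_mem' := map_zero N
      add_mem' := fun {a b} (ha : N a = 0) (hb : N b = 0) =>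
        le_antisymm ((map_add_le_add N a b).trans (by rw [ha, hb, add_zero])) (apply_nonneg N _)
      smul_mem' := fun c v (hv : N v = 0) => by
        rw [mem_ofPred_eq, map_smul_eq_mul, hv, mul_zero] }
  rcases hirr W fun A hA v hv => h.apply_mulVec_eq_zero hA hv with hbot | htop
  · exact fun v hv => (Submodule.mem_bot ℝ).1 (hbot ▸ show v ∈ W from hv)
  · have hall : ∀ v, v ∈ W := fun v => htop ▸ Submodule.mem_top
    exact absurd (Seminorm.ext hall) hN

lemma hasRate_normSeminorm {M : ℝ} (hM : ∀ A ∈ 𝒜, ‖toCLM A‖ ≤ M) :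
    HasRate 𝒜 M (normSeminorm ℝ (n → ℝ)) := fun A hA t ht x => by
  simpa [abs_of_nonneg ht] using norm_expFlow_le (hM A hA) t x

lemma HasRate.neg_le {A : Matrix n n ℝ} (hA : A ∈ 𝒜) {M : ℝ} (hM : ‖toCLM A‖ ≤ M)
    (h : HasRate 𝒜 s N) (hN : N ≠ 0) : -M ≤ s := by
  obtain ⟨v, hv⟩ := DFunLike.ne_iff.1 hN
  by_contra! hlt
  have hbound : ∀ t : ℝ, 0 ≤ t → N v ≤ Real.exp ((s + M) * t) * (basisSum N * ‖v‖) := by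
    intro t ht
    calc N v = N (expFlow A t (expFlow A (-t) v)) := by
          rw [← mul_apply_eq_comp, ← expFlow_add, add_neg_cancel, expFlow_zero_apply]
      _ ≤ Real.exp (s * t) * N (expFlow A (-t) v) := h A hA t ht _
      _ ≤ Real.exp (s * t) * (basisSum N * (Real.exp (M * t) * ‖v‖)) := by
          have hflow := norm_expFlow_le hM (-t) v
          rw [abs_neg, abs_of_nonneg ht] at hflow
          gcongr
          exact (seminorm_le_norm N _).trans
            (mul_le_mul_of_nonneg_left hflow (basisSum_nonneg N))
      _ = Real.exp ((s + M) * t) * (basisSum N * ‖v‖) := by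
          rw [add_mul, Real.exp_add]; ring
  have hlim : Tendsto (fun t : ℝ => Real.exp ((s + M) * t) * (basisSum N * ‖v‖)) atTop
      (𝓝 (0 * (basisSum N * ‖v‖))) :=
    (Real.tendsto_exp_atBot.comp (tendsto_id.const_mul_atTop_of_neg (by linarith))).mul_const _
  have hle := ge_of_tendsto hlim ((eventually_ge_atTop 0).mono hbound)
  rw [zero_mul] at hle
  exact hv (le_antisymm hle (apply_nonneg N v))

lemma HasRate.exists_basisSum_eq_one (h : HasRate 𝒜 s N) (hN : N ≠ 0) :
    ∃ N', HasRate 𝒜 s N' ∧ basisSum N' = 1 := by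
  have hpos : 0 < basisSum N := by
    refine lt_of_le_of_ne (basisSum_nonneg N) fun hzero => hN (Seminorm.ext fun v => ?_)
    have hle := seminorm_le_norm N v
    rw [← hzero, zero_mul] at hle
    exact le_antisymm hle (apply_nonneg N v)
  have happ : ∀ x, ((basisSum N)⁻¹.toNNReal • N) x = (basisSum N)⁻¹ * N x := fun x => by
    rw [smul_apply, NNReal.smul_def, Real.coe_toNNReal _ (inv_nonneg.2 hpos.le),
      smul_eq_mul]
  refine ⟨(basisSum N)⁻¹.toNNReal • N, fun A hA t ht x => ?_, ?_⟩
  · rw [happ, happ, mul_left_comm]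
    exact mul_le_mul_of_nonneg_left (h A hA t ht x) (inv_nonneg.2 hpos.le)
  · rw [basisSum]
    simp only [happ]
    rw [← Finset.mul_sum]
    exact inv_mul_cancel₀ hpos.ne'

lemma exists_tendsto_seminorm {ι : Type*} (l : Ultrafilter ι) {N : ι → Seminorm ℝ (n → ℝ)} {C : ℝ}
    (h : ∀ i, basisSum (N i) ≤ C) :
    ∃ f : Seminorm ℝ (n → ℝ), ∀ v, Tendsto (fun i => N i v) l (𝓝 (f v)) := by
  have hbound : ∀ i v, N i v ∈ Icc 0 (C * ‖v‖) := fun i v =>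
    ⟨apply_nonneg _ _,
      (seminorm_le_norm (N i) v).trans (mul_le_mul_of_nonneg_right (h i) (norm_nonneg v))⟩
  have hlim : ∀ v, ∃ a, Tendsto (fun i => N i v) l (𝓝 a) := fun v => by
    obtain ⟨a, -, ha⟩ := isCompact_Icc.ultrafilter_le_nhds (l.map fun i => N i v)
      (le_principal_iff.2 (Eventually.of_forall (f := (l : Filter ι)) fun i => hbound i v))
    exact ⟨a, ha⟩
  choose g hg using hlim
  obtain ⟨f, hf⟩ := exists_seminorm_of_tendsto hg
  exact ⟨f, fun v => (hf v).symm ▸ hg v⟩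

lemma hasRate_of_tendsto {ι : Type*} {l : Filter ι} [l.NeBot] {N : ι → Seminorm ℝ (n → ℝ)}
    {s : ι → ℝ} {r : ℝ} {f : Seminorm ℝ (n → ℝ)} (h : ∀ i, HasRate 𝒜 (s i) (N i))
    (hs : Tendsto s l (𝓝 r)) (hf : ∀ v, Tendsto (fun i => N i v) l (𝓝 (f v))) :
    HasRate 𝒜 r f := fun A hA t ht x =>
  le_of_tendsto_of_tendsto' (hf _)
    (((Real.continuous_exp.tendsto _).comp (hs.mul_const t)).mul (hf x)) fun i => h i A hA t ht x

lemma exists_minimal_rate [Nonempty n] (hc : IsCompact 𝒜) (hne : 𝒜.Nonempty) :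
    ∃ (ρ : ℝ) (N : Seminorm ℝ (n → ℝ)), N ≠ 0 ∧ HasRate 𝒜 ρ N ∧ NoRateBelow 𝒜 ρ := by
  obtain ⟨M, -, hM⟩ := exists_norm_toCLM_le_convexHull hc
  replace hM : ∀ A ∈ 𝒜, ‖toCLM A‖ ≤ M := fun A hA => hM A (subset_convexHull ℝ 𝒜 hA)
  have hne_zero : ∀ {N : Seminorm ℝ (n → ℝ)}, basisSum N = 1 → N ≠ 0 := by
    rintro N hN rfl
    simp [basisSum] at hN
  set R : Set ℝ := {s | ∃ N : Seminorm ℝ (n → ℝ), HasRate 𝒜 s N ∧ basisSum N = 1}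
  have hRne : R.Nonempty := by
    refine ⟨M, (hasRate_normSeminorm hM).exists_basisSum_eq_one fun hzero => ?_⟩
    simpa using DFunLike.congr_fun hzero 1
  have hRbdd : BddBelow R := by
    refine ⟨-M, ?_⟩
    rintro s ⟨N, hN, hN1⟩
    exact hN.neg_le hne.choose_spec (hM _ hne.choose_spec) (hne_zero hN1)
  obtain ⟨s, -, hs, hsR⟩ := exists_seq_tendsto_sInf hRne hRbdd
  choose N hNrate hN1 using hsR
  obtain ⟨f, hf⟩ := exists_tendsto_seminorm (hyperfilter ℕ) fun i => (hN1 i).le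
  refine ⟨sInf R, f, hne_zero ?_,
    hasRate_of_tendsto hNrate (hs.mono_left Nat.hyperfilter_le_atTop) hf, fun r hr N' hN' => ?_⟩
  · have hsum : Tendsto (fun i => basisSum (N i)) (hyperfilter ℕ : Filter ℕ) (𝓝 (basisSum f)) :=
      tendsto_finsetSum _ fun i _ => hf _
    simp only [hN1] at hsum
    exact tendsto_nhds_unique hsum tendsto_const_nhds
  · by_contra hcon
    exact absurd (csInf_le hRbdd (hN'.exists_basisSum_eq_one hcon)) (not_le.2 hr)

end Rate

/-! ### The semigroup of piecewise constant laws -/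

section Reach

variable {n : Type*} [Fintype n] {𝓑 : Set (Matrix n n ℝ)} {N : Seminorm ℝ (n → ℝ)}

/-- `X` is the transition map over a time interval of length `t` of a piecewise constant law. -/
inductive Reach (𝓑 : Set (Matrix n n ℝ)) : ℝ → ((n → ℝ) →L[ℝ] (n → ℝ)) → Prop
  | one : Reach 𝓑 0 1
  | step {t s : ℝ} {X : (n → ℝ) →L[ℝ] (n → ℝ)} {B : Matrix n n ℝ} :
      Reach 𝓑 t X → B ∈ 𝓑 → 0 ≤ s → Reach 𝓑 (s + t) (expFlow B s * X)

lemma Reach.nonneg {t : ℝ} {X : (n → ℝ) →L[ℝ] (n → ℝ)} (h : Reach 𝓑 t X) : 0 ≤ t := by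
  induction h with
  | one => exact le_rfl
  | step _ _ hs ih => exact add_nonneg hs ih

lemma Reach.single {B : Matrix n n ℝ} (hB : B ∈ 𝓑) {s : ℝ} (hs : 0 ≤ s) :
    Reach 𝓑 s (expFlow B s) := by
  simpa using Reach.step Reach.one hB hs

lemma Reach.comp {s t : ℝ} {X Y : (n → ℝ) →L[ℝ] (n → ℝ)} (hY : Reach 𝓑 s Y) (hX : Reach 𝓑 t X) :
    Reach 𝓑 (s + t) (Y * X) := by
  induction hY with
  | one => simpa using hX
  | step _ hB hs ih => rw [add_assoc, mul_assoc]; exact Reach.step ih hB hs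

lemma Reach.split {s t : ℝ} {Z : (n → ℝ) →L[ℝ] (n → ℝ)} (h : Reach 𝓑 (s + t) Z) (hs : 0 ≤ s)
    (ht : 0 ≤ t) : ∃ Y X, Reach 𝓑 s Y ∧ Reach 𝓑 t X ∧ Z = Y * X := by
  generalize hr : s + t = r at h
  induction h generalizing s t with
  | one =>
    obtain rfl : s = 0 := by linarith
    obtain rfl : t = 0 := by linarith
    exact ⟨1, 1, Reach.one, Reach.one, (one_mul 1).symm⟩
  | @step t' s' X B hX hB hs' ih =>
    rcases le_total t t' with hle | hle
    · obtain ⟨Y₀, X₀, hY₀, hX₀, rfl⟩ := ih (sub_nonneg.2 hle) ht (sub_add_cancel t' t)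
      obtain rfl : s' + (t' - t) = s := by linarith
      exact ⟨expFlow B s' * Y₀, X₀, Reach.step hY₀ hB hs', hX₀, (mul_assoc _ _ _).symm⟩
    · refine ⟨expFlow B s, expFlow B (t - t') * X, Reach.single hB hs, ?_, ?_⟩
      · simpa using Reach.step hX hB (sub_nonneg.2 hle)
      · rw [← mul_assoc, ← expFlow_add, show s + (t - t') = s' by linarith]

lemma Reach.seminorm_le (hN : HasRate 𝓑 0 N) {t : ℝ} {X : (n → ℝ) →L[ℝ] (n → ℝ)}
    (h : Reach 𝓑 t X) (x : n → ℝ) : N (X x) ≤ N x := by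
  induction h with
  | one => exact le_rfl
  | step _ hB hs ih => exact (hN.apply_expFlow_le hB hs _).trans ih

lemma exists_norm_le_of_reach (hN : HasRate 𝓑 0 N) (hdef : ∀ v, N v = 0 → v = 0) :
    ∃ K : ℝ, 0 ≤ K ∧ ∀ t X, Reach 𝓑 t X → ∀ x, ‖X x‖ ≤ K * ‖x‖ := by
  obtain ⟨c, hc, hcN⟩ := exists_mul_norm_le_seminorm hdef
  refine ⟨basisSum N / c, div_nonneg (basisSum_nonneg N) hc.le, fun t X hX x => ?_⟩
  rw [div_mul_eq_mul_div, le_div_iff₀ hc, mul_comm]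
  exact (hcN _).trans ((hX.seminorm_le hN x).trans (seminorm_le_norm N x))

lemma Reach.norm_sub_le {M K : ℝ} (hM0 : 0 ≤ M) (hM : ∀ B ∈ 𝓑, ‖toCLM B‖ ≤ M)
    (hK : ∀ t X, Reach 𝓑 t X → ∀ x, ‖X x‖ ≤ K * ‖x‖) {t : ℝ} {X : (n → ℝ) →L[ℝ] (n → ℝ)}
    (h : Reach 𝓑 t X) (x : n → ℝ) : ‖X x - x‖ ≤ M * (K * ‖x‖) * t := by
  induction h with
  | one => simp
  | @step t' s X B hX hB hs ih =>
    have hpiece : ‖expFlow B s (X x) - expFlow B 0 (X x)‖ ≤ M * (K * ‖x‖) * (s - 0) := by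
      refine norm_image_sub_le_of_norm_deriv_le_segment'
        (f := fun u => expFlow B u (X x)) (f' := fun u => B *ᵥ expFlow B u (X x))
        (fun u _ => (hasDerivAt_expFlow B (X x) u).hasDerivWithinAt)
        (fun u hu => ?_) s ⟨hs, le_rfl⟩
      exact (norm_mulVec_le (hM B hB) _).trans
        (mul_le_mul_of_nonneg_left (hK _ _ (Reach.step hX hB hu.1) x) hM0)
    rw [expFlow_zero_apply, sub_zero] at hpiece
    calc ‖expFlow B s (X x) - x‖ = ‖(expFlow B s (X x) - X x) + (X x - x)‖ := by
          rw [sub_add_sub_cancel]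
      _ ≤ M * (K * ‖x‖) * s + M * (K * ‖x‖) * t' :=
          (norm_add_le _ _).trans (add_le_add hpiece ih)
      _ = M * (K * ‖x‖) * (s + t') := by ring

end Reach

/-! ### An invariant norm with tangent velocities -/

section Contraction

variable {n : Type*} [Fintype n] {𝓑 : Set (Matrix n n ℝ)} {N : Seminorm ℝ (n → ℝ)}

lemma iSup_seminorm_apply_le {E ι : Type*} [AddCommGroup E] [Module ℝ E] [Nonempty ι]
    {p : ι → Seminorm ℝ E} (hp : BddAbove (range p)) {x : E} {a : ℝ} (h : ∀ i, p i x ≤ a) :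
    (⨆ i, p i) x ≤ a := by
  rw [Seminorm.iSup_apply hp]
  exact ciSup_le h

lemma Reach.seminorm_le_half_pow (hN : HasRate 𝓑 0 N) {T : ℝ} (hT : 0 ≤ T)
    (hhalf : ∀ X, Reach 𝓑 T X → ∀ x, N (X x) ≤ 1 / 2 * N x) (k : ℕ) {t : ℝ}
    {X : (n → ℝ) →L[ℝ] (n → ℝ)} (hX : Reach 𝓑 t X) (ht : k * T ≤ t) (x : n → ℝ) :
    N (X x) ≤ (1 / 2) ^ k * N x := by
  induction k generalizing t X with
  | zero => simpa using hX.seminorm_le hN x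
  | succ k ih =>
    push_cast at ht
    have hkT : 0 ≤ k * T := by positivity
    obtain ⟨Y, X', hY, hX', rfl⟩ := Reach.split (s := T) (t := t - T) (by simpa using hX) hT
      (by linarith)
    have htail := ih hX' (by linarith)
    calc N (Y (X' x)) ≤ 1 / 2 * N (X' x) := hhalf Y hY _
      _ ≤ 1 / 2 * ((1 / 2) ^ k * N x) := by gcongr
      _ = (1 / 2) ^ (k + 1) * N x := by ring

lemma Reach.exp_mul_seminorm_le_two_mul (hN : HasRate 𝓑 0 N) {T : ℝ} (hT : 0 < T)
    (hhalf : ∀ X, Reach 𝓑 T X → ∀ x, N (X x) ≤ 1 / 2 * N x) {t : ℝ}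
    {X : (n → ℝ) →L[ℝ] (n → ℝ)} (hX : Reach 𝓑 t X) (x : n → ℝ) :
    Real.exp (Real.log 2 / T * t) * N (X x) ≤ 2 * N x := by
  have hfloor := Nat.floor_le (div_nonneg hX.nonneg hT.le)
  have hlt := Nat.lt_floor_add_one (t / T)
  set k := ⌊t / T⌋₊
  have hdecay := hX.seminorm_le_half_pow hN hT.le hhalf k ((le_div_iff₀ hT).1 hfloor) x
  have hgrowth : Real.exp (Real.log 2 / T * t) ≤ 2 ^ (k + 1) := by
    rw [← Real.exp_log (show (0 : ℝ) < 2 ^ (k + 1) by positivity), Real.exp_le_exp, Real.log_pow,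
      div_mul_eq_mul_div, mul_div_assoc, mul_comm]
    push_cast
    exact mul_le_mul_of_nonneg_right hlt.le (Real.log_nonneg one_le_two)
  calc Real.exp (Real.log 2 / T * t) * N (X x) ≤ 2 ^ (k + 1) * ((1 / 2) ^ k * N x) := by gcongr
    _ = 2 * N x * (2 * (1 / 2)) ^ k := by rw [mul_pow, pow_succ]; ring
    _ = 2 * N x := by norm_num

/-- The weighted supremum `sup e^{εt} N(X x)` over all transitions `X` decays at rate `ε`. -/
lemma eq_zero_of_contraction (hN : HasRate 𝓑 0 N) (hmin : NoRateBelow 𝓑 0) {T : ℝ} (hT : 0 < T)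
    (hhalf : ∀ X, Reach 𝓑 T X → ∀ x, N (X x) ≤ 1 / 2 * N x) : N = 0 := by
  set ε := Real.log 2 / T
  have hεpos : 0 < ε := div_pos (Real.log_pos one_lt_two) hT
  let p : {q : ℝ × ((n → ℝ) →L[ℝ] (n → ℝ)) // Reach 𝓑 q.1 q.2} → Seminorm ℝ (n → ℝ) :=
    fun q => N.comp (Real.exp (ε * q.1.1) • q.1.2).toLinearMap
  have : Nonempty {q : ℝ × ((n → ℝ) →L[ℝ] (n → ℝ)) // Reach 𝓑 q.1 q.2} := ⟨⟨(0, 1), Reach.one⟩⟩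
  have happ : ∀ q x, p q x = Real.exp (ε * q.1.1) * N (q.1.2 x) := fun q x =>
    seminorm_exp_smul N _ _
  have hbdd : BddAbove (range p) := by
    refine Seminorm.bddAbove_range_iff.2 fun x => ⟨2 * N x, ?_⟩
    rintro _ ⟨q, rfl⟩
    dsimp only
    rw [happ]
    exact q.2.exp_mul_seminorm_le_two_mul hN hT hhalf x
  have hrate : HasRate 𝓑 (-ε) (⨆ q, p q) := fun B hB t ht x =>
    iSup_seminorm_apply_le hbdd fun ⟨(τ, X), hX⟩ => by
      calc p ⟨(τ, X), hX⟩ (expFlow B t x)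
          = Real.exp (-ε * t) * p ⟨(τ + t, X * expFlow B t), hX.comp (.single hB ht)⟩ x := by
            rw [happ, happ, ← mul_assoc, ← Real.exp_add, mul_apply_eq_comp]
            ring_nf
        _ ≤ Real.exp (-ε * t) * (⨆ q, p q) x :=
            mul_le_mul_of_nonneg_left (le_ciSup hbdd _ x) (Real.exp_pos _).le
  ext v
  have hle : p ⟨(0, 1), Reach.one⟩ v ≤ (⨆ q, p q) v := le_ciSup hbdd _ v
  rw [hmin (-ε) (by linarith) _ hrate, happ, mul_zero, Real.exp_zero, one_mul] at hle
  exact le_antisymm hle (apply_nonneg N v)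

/-- The supremum of `N (X x)` over the transitions `X` over a time interval of length `t`. -/
noncomputable def transitionSup (𝓑 : Set (Matrix n n ℝ)) (N : Seminorm ℝ (n → ℝ)) (t : ℝ) :
    Seminorm ℝ (n → ℝ) :=
  ⨆ X : {X // Reach 𝓑 t X}, N.comp X.1.toLinearMap

lemma bddAbove_transition (hN : HasRate 𝓑 0 N) (t : ℝ) :
    BddAbove (range fun X : {X // Reach 𝓑 t X} => N.comp X.1.toLinearMap) :=
  ⟨N, by rintro _ ⟨X, rfl⟩; exact X.2.seminorm_le hN⟩

lemma Reach.seminorm_le_transitionSup (hN : HasRate 𝓑 0 N) {t : ℝ}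
    {X : (n → ℝ) →L[ℝ] (n → ℝ)} (hX : Reach 𝓑 t X) (x : n → ℝ) :
    N (X x) ≤ transitionSup 𝓑 N t x :=
  le_ciSup (bddAbove_transition hN t) ⟨X, hX⟩ x

lemma transitionSup_le (hne : 𝓑.Nonempty) (hN : HasRate 𝓑 0 N) {t : ℝ} (ht : 0 ≤ t) {x : n → ℝ}
    {a : ℝ} (h : ∀ X, Reach 𝓑 t X → N (X x) ≤ a) : transitionSup 𝓑 N t x ≤ a := by
  have : Nonempty {X // Reach 𝓑 t X} := ⟨⟨_, Reach.single hne.choose_spec ht⟩⟩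
  exact iSup_seminorm_apply_le (bddAbove_transition hN t) fun X => h X.1 X.2

lemma exists_reach_of_lt_transitionSup (hne : 𝓑.Nonempty) (hN : HasRate 𝓑 0 N) {t : ℝ}
    (ht : 0 ≤ t) {x : n → ℝ} {a : ℝ} (h : a < transitionSup 𝓑 N t x) :
    ∃ X, Reach 𝓑 t X ∧ a < N (X x) := by
  by_contra! hle
  exact absurd (transitionSup_le hne hN ht hle) (not_le.2 h)

lemma transitionSup_anti (hne : 𝓑.Nonempty) (hN : HasRate 𝓑 0 N) {s t : ℝ} (hs : 0 ≤ s)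
    (hst : s ≤ t) (x : n → ℝ) : transitionSup 𝓑 N t x ≤ transitionSup 𝓑 N s x := by
  refine transitionSup_le hne hN (hs.trans hst) fun Z hZ => ?_
  obtain ⟨Y, X, hY, hX, rfl⟩ := Reach.split (s := t - s) (t := s) (by simpa using hZ)
    (sub_nonneg.2 hst) hs
  exact (hY.seminorm_le hN _).trans (hX.seminorm_le_transitionSup hN x)

lemma hasRate_transitionSup (hne : 𝓑.Nonempty) (hN : HasRate 𝓑 0 N) {t : ℝ} (ht : 0 ≤ t) :
    HasRate 𝓑 0 (transitionSup 𝓑 N t) := fun B hB s hs x => by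
  rw [zero_mul, Real.exp_zero, one_mul]
  refine (transitionSup_le hne hN ht fun X hX => ?_).trans
    (transitionSup_anti hne hN ht (le_add_of_nonneg_right hs) x)
  exact (hX.comp (Reach.single hB hs)).seminorm_le_transitionSup hN x

lemma exists_tendsto_transitionSup (hne : 𝓑.Nonempty) (hN : HasRate 𝓑 0 N) :
    ∃ f : Seminorm ℝ (n → ℝ),
      ∀ x, Tendsto (fun k : ℕ => transitionSup 𝓑 N k x) atTop (𝓝 (f x)) := by
  have hlim : ∀ x, Tendsto (fun k : ℕ => transitionSup 𝓑 N k x) atTop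
      (𝓝 (⨅ k : ℕ, transitionSup 𝓑 N k x)) := fun x =>
    tendsto_atTop_ciInf
      (fun i j hij => transitionSup_anti hne hN i.cast_nonneg (Nat.cast_le.2 hij) x)
      ⟨0, by rintro _ ⟨k, rfl⟩; exact apply_nonneg _ _⟩
  obtain ⟨f, hf⟩ := exists_seminorm_of_tendsto hlim
  exact ⟨f, fun x => (hf x).symm ▸ hlim x⟩

lemma ne_zero_of_tendsto_transitionSup (hN : HasRate 𝓑 0 N) (hN0 : N ≠ 0)
    (hdef : ∀ v, N v = 0 → v = 0) (hmin : NoRateBelow 𝓑 0) {f : Seminorm ℝ (n → ℝ)}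
    (hf : ∀ x, Tendsto (fun k : ℕ => transitionSup 𝓑 N k x) atTop (𝓝 (f x))) : f ≠ 0 := by
  rintro rfl
  obtain ⟨c, hc, hcN⟩ := exists_mul_norm_le_seminorm hdef
  have hsum : Tendsto (fun k : ℕ => basisSum (transitionSup 𝓑 N k)) atTop
      (𝓝 (basisSum (0 : Seminorm ℝ (n → ℝ)))) := tendsto_finsetSum _ fun i _ => hf _
  have hsmall : ∀ᶠ k : ℕ in atTop, basisSum (transitionSup 𝓑 N k) < c / 2 :=
    hsum.eventually (gt_mem_nhds (by simpa [basisSum] using hc))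
  obtain ⟨k, hk, hk1⟩ := (hsmall.and (eventually_ge_atTop 1)).exists
  refine hN0 (eq_zero_of_contraction hN hmin (T := k) (by exact_mod_cast hk1) fun X hX x => ?_)
  calc N (X x) ≤ transitionSup 𝓑 N k x := hX.seminorm_le_transitionSup hN x
    _ ≤ basisSum (transitionSup 𝓑 N k) * ‖x‖ := seminorm_le_norm _ x
    _ ≤ c / 2 * ‖x‖ := by gcongr
    _ = 1 / 2 * (c * ‖x‖) := by ring
    _ ≤ 1 / 2 * N x := by gcongr; exact hcN x

lemma exists_reach_le_transitionSup (hne : 𝓑.Nonempty) (hN : HasRate 𝓑 0 N)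
    {f : Seminorm ℝ (n → ℝ)}
    (hf : ∀ x, Tendsto (fun k : ℕ => transitionSup 𝓑 N k x) atTop (𝓝 (f x))) {t : ℝ} (ht : 0 ≤ t)
    (x : n → ℝ) {ε : ℝ} (hε : 0 < ε) (k : ℕ) :
    ∃ X, Reach 𝓑 t X ∧ f x - ε ≤ transitionSup 𝓑 N k (X x) := by
  have hkt : 0 ≤ (k : ℝ) + t := by positivity
  obtain ⟨m, hm⟩ := exists_nat_ge ((k : ℝ) + t)
  have hlim : f x ≤ transitionSup 𝓑 N m x :=
    Antitone.le_of_tendsto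
      (fun i j hij => transitionSup_anti hne hN i.cast_nonneg (Nat.cast_le.2 hij) x) (hf x) m
  obtain ⟨Z, hZ, hlt⟩ := exists_reach_of_lt_transitionSup hne hN hkt
    (((sub_lt_self _ hε).trans_le hlim).trans_le (transitionSup_anti hne hN hkt hm x))
  obtain ⟨Y, X, hY, hX, rfl⟩ := hZ.split k.cast_nonneg ht
  exact ⟨X, hX, hlt.le.trans (hY.seminorm_le_transitionSup hN (X x))⟩

/-- By compactness, the limit of the transition suprema of `N` is preserved along limits of
transitions over any time interval. -/
lemma exists_preserved_vector (hne : 𝓑.Nonempty) (hN : HasRate 𝓑 0 N)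
    (hdef : ∀ v, N v = 0 → v = 0) {f : Seminorm ℝ (n → ℝ)}
    (hf : ∀ x, Tendsto (fun k : ℕ => transitionSup 𝓑 N k x) atTop (𝓝 (f x))) {t : ℝ} (ht : 0 ≤ t)
    (x : n → ℝ) :
    ∃ y ∈ closure ((fun X : (n → ℝ) →L[ℝ] (n → ℝ) => X x) '' {X | Reach 𝓑 t X}), f x ≤ f y := by
  choose X hX hXk using fun k : ℕ =>
    exists_reach_le_transitionSup hne hN hf ht x (ε := 1 / ((k : ℝ) + 1)) (by positivity) k
  obtain ⟨K, -, hK⟩ := exists_norm_le_of_reach hN hdef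
  obtain ⟨y, -, φ, hφ, hy⟩ := (isCompact_closedBall (0 : n → ℝ) (K * ‖x‖)).tendsto_subseq
    fun k => mem_closedBall_zero_iff.2 (hK t (X k) (hX k) x)
  refine ⟨y, mem_closure_of_tendsto hy (Eventually.of_forall fun k => ⟨X (φ k), hX _, rfl⟩), ?_⟩
  refine ge_of_tendsto' (hf y) fun m => ?_
  have hsup : Tendsto (fun k => transitionSup 𝓑 N m (X (φ k) x)) atTop
      (𝓝 (transitionSup 𝓑 N m y)) := ((continuous_seminorm _).tendsto y).comp hy
  have herr : Tendsto (fun k : ℕ => f x - 1 / ((φ k : ℝ) + 1)) atTop (𝓝 (f x - 0)) :=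
    tendsto_const_nhds.sub (tendsto_one_div_add_atTop_nhds_zero_nat.comp hφ.tendsto_atTop)
  rw [sub_zero] at herr
  refine le_of_tendsto_of_tendsto herr hsup ?_
  filter_upwards [eventually_ge_atTop m] with k hk
  exact (hXk (φ k)).trans
    (transitionSup_anti hne hN m.cast_nonneg (Nat.cast_le.2 (hk.trans (hφ.id_le k))) _)

/-- Negativity of the decrease on the compact graph of the subgradients is an open condition on
the point. -/
lemma exists_uniform_decrease (hc : IsCompact 𝓑) {f : Seminorm ℝ (n → ℝ)} {x : n → ℝ}
    (h : ∀ B ∈ 𝓑, ∀ p ∈ Subgrad f x, p ⬝ᵥ (B *ᵥ x) < 0) :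
    ∃ r > 0, ∃ ε > 0, ∀ y, ‖y - x‖ < r → ∀ B ∈ 𝓑, ∀ p ∈ Subgrad f y, p ⬝ᵥ (B *ᵥ y) ≤ -ε := by
  by_contra! hcon
  choose y hy B hB p hp hlt using fun k : ℕ =>
    hcon (1 / ((k : ℝ) + 1)) (by positivity) (1 / ((k : ℝ) + 1)) (by positivity)
  have : FirstCountableTopology (Matrix n n ℝ) :=
    inferInstanceAs (FirstCountableTopology (n → n → ℝ))
  have hgraph := isCompact_subgrad_graph f hc (isCompact_closedBall x 1)
  obtain ⟨⟨z, q, D⟩, ⟨-, hq, hD⟩, φ, hφ, hlim⟩ := hgraph.tendsto_subseq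
    (x := fun k => (y k, p k, B k)) fun k => by
      refine ⟨mem_closedBall_iff_norm.2 ((hy k).le.trans ?_), hp k, hB k⟩
      exact div_le_one_of_le₀ (by simp) (by positivity)
  have hzero : Tendsto (fun k => 1 / ((φ k : ℝ) + 1)) atTop (𝓝 0) :=
    tendsto_one_div_add_atTop_nhds_zero_nat.comp hφ.tendsto_atTop
  obtain rfl : z = x := by
    refine tendsto_nhds_unique ((continuous_fst.tendsto _).comp hlim)
      (tendsto_iff_norm_sub_tendsto_zero.2 ?_)
    exact squeeze_zero (fun _ => norm_nonneg _) (fun k => (hy (φ k)).le) hzero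
  refine absurd (h D hD q hq) (not_lt.2 ?_)
  have hle := le_of_tendsto_of_tendsto' hzero.neg ((continuous_pairing.tendsto _).comp hlim)
    fun k => (hlt (φ k)).le
  rwa [neg_zero] at hle

lemma Reach.seminorm_le_sub {f : Seminorm ℝ (n → ℝ)} {x : n → ℝ} {t₀ ε : ℝ}
    (hdec : ∀ t X, Reach 𝓑 t X → t ≤ t₀ →
      ∀ B ∈ 𝓑, ∀ p ∈ Subgrad f (X x), p ⬝ᵥ (B *ᵥ X x) ≤ -ε)
    {t : ℝ} {X : (n → ℝ) →L[ℝ] (n → ℝ)} (hX : Reach 𝓑 t X) (ht : t ≤ t₀) :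
    f (X x) ≤ f x - ε * t := by
  induction hX with
  | one => simp
  | @step t' s X B hX hB hs ih =>
    have hpiece := (isFlow_expFlow B (X x)).seminorm_le_sub (f := f) (ε := ε) le_rfl hs
      (Eventually.of_forall fun u hu => by
        obtain ⟨p, hp⟩ := subgrad_nonempty f (expFlow B u (X x))
        exact ⟨p, hp, hdec _ _ (hX.step hB hu.1.le) (by linarith [hu.2]) B hB p hp⟩)
    rw [expFlow_zero_apply] at hpiece
    rw [mul_apply_eq_comp]
    linarith [ih (by linarith)]

/-- If all velocities at `x` were strictly decreasing for `f`, then `f` would decrease by a definite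
amount along all transitions over a short time, so that no vector could be preserved. -/
lemma exists_norm_with_tangent_velocity (hc : IsCompact 𝓑) (hne : 𝓑.Nonempty)
    (hN : HasRate 𝓑 0 N) (hN0 : N ≠ 0) (hdef : ∀ v, N v = 0 → v = 0) (hmin : NoRateBelow 𝓑 0) :
    ∃ f : Seminorm ℝ (n → ℝ), f ≠ 0 ∧ HasRate 𝓑 0 f ∧
      ∀ x, ∃ B ∈ 𝓑, ∃ p ∈ Subgrad f x, p ⬝ᵥ (B *ᵥ x) = 0 := by
  obtain ⟨f, hf⟩ := exists_tendsto_transitionSup hne hN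
  have hfrate : HasRate 𝓑 0 f :=
    hasRate_of_tendsto (fun k => hasRate_transitionSup hne hN k.cast_nonneg) tendsto_const_nhds hf
  refine ⟨f, ne_zero_of_tendsto_transitionSup hN hN0 hdef hmin hf, hfrate, fun x => ?_⟩
  by_contra! hcon
  obtain ⟨r, hr, ε, hε, hdec⟩ := exists_uniform_decrease hc fun B hB p hp =>
    lt_of_le_of_ne ((hfrate.subgrad_le hB hp).trans_eq (zero_mul _)) (hcon B hB p hp)
  obtain ⟨M, hM0, hM⟩ := exists_norm_toCLM_le_convexHull hc
  obtain ⟨K, hK0, hK⟩ := exists_norm_le_of_reach hN hdef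
  set t₀ := r / (2 * (M * (K * ‖x‖) + 1)) with ht₀
  have ht₀pos : 0 < t₀ := by positivity
  have hnear : ∀ t X, Reach 𝓑 t X → t ≤ t₀ → ‖X x - x‖ < r := by
    intro t X hX ht
    have hdisp := hX.norm_sub_le hM0 (fun B hB => hM B (subset_convexHull ℝ 𝓑 hB)) hK x
    rw [ht₀, le_div_iff₀ (by positivity)] at ht
    nlinarith [hX.nonneg]
  obtain ⟨y, hy, hfy⟩ := exists_preserved_vector hne hN hdef hf ht₀pos.le x
  have hdrop : f y ≤ f x - ε * t₀ := by
    refine closure_minimal (t := {y | f y ≤ f x - ε * t₀}) ?_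
      (isClosed_le (continuous_seminorm f) continuous_const) hy
    rintro _ ⟨X, hX, rfl⟩
    exact hX.seminorm_le_sub (fun t X hX ht => hdec _ (hnear t X hX ht)) le_rfl
  linarith [mul_pos hε ht₀pos]

end Contraction

/-! ### Translating the control set -/

section Shift

variable {n : Type*} [DecidableEq n]

/-- The control set `𝒜 - s I`, whose trajectories are those of `𝒜` multiplied by `e^{-st}`. -/
def shiftSet (𝒜 : Set (Matrix n n ℝ)) (s : ℝ) : Set (Matrix n n ℝ) :=
  (fun A => A - s • (1 : Matrix n n ℝ)) '' 𝒜

lemma mem_shiftSet {𝒜 : Set (Matrix n n ℝ)} {s : ℝ} {B : Matrix n n ℝ} :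
    B ∈ shiftSet 𝒜 s ↔ B + s • (1 : Matrix n n ℝ) ∈ 𝒜 :=
  ⟨by rintro ⟨A, hA, rfl⟩; rwa [sub_add_cancel], fun h => ⟨_, h, add_sub_cancel_right _ _⟩⟩

lemma isCompact_shiftSet {𝒜 : Set (Matrix n n ℝ)} (h : IsCompact 𝒜) (s : ℝ) :
    IsCompact (shiftSet 𝒜 s) :=
  h.image (by fun_prop)

lemma convexHull_shiftSet (𝒜 : Set (Matrix n n ℝ)) (s : ℝ) :
    convexHull ℝ (shiftSet 𝒜 s) = shiftSet (convexHull ℝ 𝒜) s :=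
  ((AffineMap.id ℝ (Matrix n n ℝ) - AffineMap.const ℝ _ (s • (1 : Matrix n n ℝ))).image_convexHull
    𝒜).symm

lemma mem_convexHull_shiftSet {𝒜 : Set (Matrix n n ℝ)} {s : ℝ} {B : Matrix n n ℝ} :
    B ∈ convexHull ℝ (shiftSet 𝒜 s) ↔ B + s • (1 : Matrix n n ℝ) ∈ convexHull ℝ 𝒜 := by
  rw [convexHull_shiftSet, mem_shiftSet]

lemma HasRate.shiftSet_iff [Fintype n] {𝒜 : Set (Matrix n n ℝ)} {s r : ℝ}
    {N : Seminorm ℝ (n → ℝ)} : HasRate (shiftSet 𝒜 s) r N ↔ HasRate 𝒜 (r + s) N := by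
  refine forall_mem_image.trans (forall₅_congr fun A _ t _ x => ?_)
  rw [expFlow_sub_smul_one, smul_apply, seminorm_exp_smul,
    ← mul_le_mul_iff_right₀ (Real.exp_pos (s * t)), ← mul_assoc, ← mul_assoc, ← Real.exp_add,
    ← Real.exp_add, neg_mul, add_neg_cancel, Real.exp_zero, one_mul, add_mul, add_comm (s * t)]

end Shift

lemma IsIrreducible.nonempty {𝒜 : Set Mat} (h : IsIrreducible 𝒜) : 𝒜.Nonempty := by
  by_contra! hne
  subst hne
  rcases h (Submodule.span ℝ {![1, 0]}) (by simp) with hbot | htop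
  · simpa using congrFun (Submodule.span_singleton_eq_bot.1 hbot) 0
  · have hmem : (![0, 1] : Plane) ∈ Submodule.span ℝ {![1, 0]} := htop ▸ Submodule.mem_top
    obtain ⟨c, hc⟩ := Submodule.mem_span_singleton.1 hmem
    simpa using congrFun hc 1

/-! ### Growth along trajectories -/

section Invariance

variable {n : Type*} [Fintype n]

/-- `f` does not increase in the directions of the velocities from `𝓑`. -/
def IsInvariantFor (𝓑 : Set (Matrix n n ℝ)) (f : Seminorm ℝ (n → ℝ)) : Prop :=
  ∀ x, ∀ B ∈ 𝓑, ∀ p ∈ Subgrad f x, p ⬝ᵥ (B *ᵥ x) ≤ 0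

variable {𝓑 : Set (Matrix n n ℝ)} {f : Seminorm ℝ (n → ℝ)}

lemma dotProduct_mulVec_le_of_mem_convexHull {x p : n → ℝ} {a : ℝ}
    (h : ∀ B ∈ 𝓑, p ⬝ᵥ (B *ᵥ x) ≤ a) : ∀ B ∈ convexHull ℝ 𝓑, p ⬝ᵥ (B *ᵥ x) ≤ a := fun _ hB =>
  convexHull_min h (convex_halfSpace_le
    ⟨fun A B => by rw [Matrix.add_mulVec, dotProduct_add],
      fun c A => by rw [Matrix.smul_mulVec, dotProduct_smul]⟩ a) hB

lemma IsInvariantFor.convexHull (h : IsInvariantFor 𝓑 f) : IsInvariantFor (convexHull ℝ 𝓑) f :=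
  fun x B hB p hp => dotProduct_mulVec_le_of_mem_convexHull (fun B hB => h x B hB p hp) B hB

lemma IsInvariantFor.antitoneOn (h : IsInvariantFor 𝓑 f) {B : ℝ → Matrix n n ℝ} {z : ℝ → n → ℝ}
    (hz : IsFlow B z) (hB : ∀ t, 0 ≤ t → B t ∈ _root_.convexHull ℝ 𝓑) :
    AntitoneOn (fun t => f (z t)) (Ici 0) := fun a ha b _ hab => by
  have hle := hz.seminorm_le_sub (f := f) (ε := 0) ha hab (Eventually.of_forall fun t ht => by
    obtain ⟨p, hp⟩ := subgrad_nonempty f (z t)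
    exact ⟨p, hp, by rw [neg_zero]; exact h.convexHull _ _ (hB t (ha.trans ht.1.le)) p hp⟩)
  simpa using hle

lemma le_exp_mul_of_exp_neg_mul_le {a b c : ℝ} (h : Real.exp (-a) * b ≤ c) :
    b ≤ Real.exp a * c := by
  rwa [Real.exp_neg, inv_mul_le_iff₀ (Real.exp_pos a)] at h

end Invariance

lemma IsTrajectory.exists_isFlow_shiftSet {𝒜 : Set Mat} (hc : IsCompact 𝒜) {x : ℝ → Plane}
    (h : IsTrajectory (convexHull ℝ 𝒜) x) (s : ℝ) :
    ∃ B : ℝ → Mat, (∀ t, 0 ≤ t → B t ∈ convexHull ℝ (shiftSet 𝒜 s)) ∧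
      IsFlow B (fun t => Real.exp (-s * t) • x t) := by
  obtain ⟨A, hA, hx⟩ := h
  refine ⟨fun t => A t - s • (1 : Mat), fun t ht => ?_, (hx.isFlow (hA.isBddLaw hc)).exp_smul s⟩
  rw [mem_convexHull_shiftSet, sub_add_cancel]
  exact hA.2 t ht

lemma IsTrajectory.convexHull {𝒜 : Set Mat} {x : ℝ → Plane} (h : IsTrajectory 𝒜 x) :
    IsTrajectory (convexHull ℝ 𝒜) x := by
  obtain ⟨A, hA, hx⟩ := h
  exact ⟨A, ⟨hA.1, fun t ht => subset_convexHull ℝ 𝒜 (hA.2 t ht)⟩, hx⟩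

lemma IsInvariantFor.apply_le_exp_mul {𝒜 : Set Mat} (hc : IsCompact 𝒜) {s : ℝ}
    {f : Seminorm ℝ Plane} (h : IsInvariantFor (shiftSet 𝒜 s) f) {x : ℝ → Plane}
    (hx : IsTrajectory (_root_.convexHull ℝ 𝒜) x) {t : ℝ} (ht : 0 ≤ t) :
    f (x t) ≤ Real.exp (s * t) * f (x 0) := by
  obtain ⟨B, hB, hz⟩ := hx.exists_isFlow_shiftSet hc s
  have hle := h.antitoneOn hz hB self_mem_Ici ht ht
  simp only [seminorm_exp_smul, mul_zero, Real.exp_zero, one_smul, neg_mul] at hle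
  exact le_exp_mul_of_exp_neg_mul_le hle

/-! ### Feedback laws sampled on a grid -/

section Grid

variable {n : Type*} [Fintype n]

lemma norm_expFlow_sub_le {A : Matrix n n ℝ} {M : ℝ} (hM : 0 ≤ M) (hA : ‖toCLM A‖ ≤ M) {δ : ℝ}
    (hδ : 0 ≤ δ) (x : n → ℝ) : ‖expFlow A δ x - x‖ ≤ M * (Real.exp (M * δ) * ‖x‖) * δ := by
  have hle := norm_image_sub_le_of_norm_deriv_le_segment' (f := fun u => expFlow A u x)
    (fun u _ => (hasDerivAt_expFlow A x u).hasDerivWithinAt)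
    (fun u hu => calc
      ‖A *ᵥ expFlow A u x‖ ≤ M * (Real.exp (M * |u|) * ‖x‖) :=
        (norm_mulVec_le hA _).trans (mul_le_mul_of_nonneg_left (norm_expFlow_le hA u x) hM)
      _ ≤ M * (Real.exp (M * δ) * ‖x‖) := by rw [abs_of_nonneg hu.1]; have := hu.2; gcongr)
    δ ⟨hδ, le_rfl⟩
  rwa [expFlow_zero_apply, sub_zero] at hle

lemma norm_expFlow_sub_sub_le {A : Matrix n n ℝ} {M : ℝ} (hM : 0 ≤ M) (hA : ‖toCLM A‖ ≤ M) {δ : ℝ}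
    (hδ : 0 ≤ δ) (x : n → ℝ) :
    ‖expFlow A δ x - x - δ • (A *ᵥ x)‖ ≤ M ^ 2 * Real.exp (M * δ) * δ ^ 2 * ‖x‖ := by
  have hderiv : ∀ u, HasDerivAt (fun u => expFlow A u x - u • (A *ᵥ x))
      (A *ᵥ expFlow A u x - A *ᵥ x) u := fun u =>
    ((hasDerivAt_expFlow A x u).sub ((hasDerivAt_id u).smul_const (A *ᵥ x))).congr_deriv
      (by rw [one_smul])
  have hle := norm_image_sub_le_of_norm_deriv_le_segment' (fun u _ => (hderiv u).hasDerivWithinAt)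
    (fun u hu => calc
      ‖A *ᵥ expFlow A u x - A *ᵥ x‖ = ‖A *ᵥ (expFlow A u x - x)‖ := by rw [Matrix.mulVec_sub]
      _ ≤ M * (M * (Real.exp (M * u) * ‖x‖) * u) := (norm_mulVec_le hA _).trans
        (mul_le_mul_of_nonneg_left (norm_expFlow_sub_le hM hA hu.1 x) hM)
      _ ≤ M * (M * (Real.exp (M * δ) * ‖x‖) * δ) := by have := hu.1; have := hu.2; gcongr)
    δ ⟨hδ, le_rfl⟩
  rw [expFlow_zero_apply, zero_smul, sub_zero, sub_zero] at hle
  rw [sub_right_comm]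
  linarith

lemma floor_div_eq {δ t : ℝ} (hδ : 0 < δ) {k : ℕ} (ht : t ∈ Ico (k * δ) ((k + 1) * δ)) :
    ⌊t / δ⌋₊ = k := by
  have ht0 : 0 ≤ t := (by positivity : (0 : ℝ) ≤ k * δ).trans ht.1
  rw [Nat.floor_eq_iff (div_nonneg ht0 hδ.le), le_div_iff₀ hδ, div_lt_iff₀ hδ]
  exact ht

variable (sel : (n → ℝ) → Matrix n n ℝ) (δ : ℝ) (v : n → ℝ)

/-- The states at the times `0, δ, 2δ, …` of the system which starts at `v` and at each of these
times switches to the law that the feedback `sel` prescribes for the current state. -/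
noncomputable def gridPoint (k : ℕ) : n → ℝ := (fun x => expFlow (sel x) δ x)^[k] v

/-- The law which the feedback `sel` generates when it is sampled at the multiples of `δ`. -/
noncomputable def gridLaw (t : ℝ) : Matrix n n ℝ := sel (gridPoint sel δ v ⌊t / δ⌋₊)

/-- The motion generated by `gridLaw`. -/
noncomputable def gridMotion (t : ℝ) : n → ℝ :=
  expFlow (gridLaw sel δ v t) (t - ⌊t / δ⌋₊ * δ) (gridPoint sel δ v ⌊t / δ⌋₊)

variable {δ}

lemma gridMotion_mul (hδ : 0 < δ) (k : ℕ) : gridMotion sel δ v (k * δ) = gridPoint sel δ v k := by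
  rw [gridMotion, gridLaw, floor_div_eq hδ ⟨le_rfl, by nlinarith⟩, sub_self, expFlow_zero_apply]

lemma gridMotion_eq (hδ : 0 < δ) {k : ℕ} {t : ℝ} (ht : t ∈ Icc (k * δ) ((k + 1) * δ)) :
    gridMotion sel δ v t =
      expFlow (sel (gridPoint sel δ v k)) (t - k * δ) (gridPoint sel δ v k) := by
  rcases ht.2.lt_or_eq with hlt | rfl
  · rw [gridMotion, gridLaw, floor_div_eq hδ ⟨ht.1, hlt⟩]
  · have hend := gridMotion_mul sel v hδ (k + 1)
    rw [Nat.cast_succ, gridPoint, Function.iterate_succ_apply'] at hend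
    rw [hend, show (k + 1) * δ - k * δ = δ by ring, gridPoint]

lemma continuousOn_gridMotion (hδ : 0 < δ) : ContinuousOn (gridMotion sel δ v) (Ici 0) := by
  have hcell : ∀ k : ℕ, ContinuousOn (gridMotion sel δ v) (Icc (k * δ) ((k + 1) * δ)) := fun k =>
    ((continuous_expFlow _ _).comp (continuous_sub_right _)).continuousOn.congr
      fun t ht => gridMotion_eq sel v hδ ht
  have hinit : ∀ k : ℕ, ContinuousOn (gridMotion sel δ v) (Icc 0 (k * δ)) := fun k => by
    induction k with
    | zero => simp
    | succ k ih =>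
      push_cast
      rw [← Icc_union_Icc_eq_Icc (b := k * δ) (by positivity) (by nlinarith)]
      exact ih.union_of_isClosed (hcell k) isClosed_Icc isClosed_Icc
  refine continuousOn_Ici_of_Icc fun T => ?_
  obtain ⟨k, hk⟩ := Archimedean.arch T hδ
  exact (hinit k).mono (Icc_subset_Icc_right (by rwa [nsmul_eq_mul] at hk))

lemma hasDerivAt_gridMotion (hδ : 0 < δ) {t : ℝ} (ht : 0 < t) (hgrid : ∀ k : ℕ, t ≠ k * δ) :
    HasDerivAt (gridMotion sel δ v) (gridLaw sel δ v t *ᵥ gridMotion sel δ v t) t := by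
  have hlow : ⌊t / δ⌋₊ * δ < t :=
    ((le_div_iff₀ hδ).1 (Nat.floor_le (by positivity))).lt_of_ne (hgrid _).symm
  have hup : t < (⌊t / δ⌋₊ + 1) * δ := (div_lt_iff₀ hδ).1 (Nat.lt_floor_add_one _)
  refine HasDerivAt.congr_of_eventuallyEq
    ((hasDerivAt_expFlow _ _ (t - ⌊t / δ⌋₊ * δ)).comp_sub_const t (⌊t / δ⌋₊ * δ)) ?_
  filter_upwards [Icc_mem_nhds hlow hup] with u hu using gridMotion_eq sel v hδ hu

end Grid

lemma isTrajectory_gridMotion {𝒜 : Set Mat} (hc : IsCompact 𝒜) {sel : Plane → Mat}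
    (hsel : ∀ x, sel x ∈ 𝒜) {δ : ℝ} (hδ : 0 < δ) (v : Plane) :
    IsTrajectory 𝒜 (gridMotion sel δ v) := by
  have hlaw : IsSwitchingLaw 𝒜 (gridLaw sel δ v) :=
    ⟨fun i j => (measurable_from_top (f := fun k : ℕ => sel (gridPoint sel δ v k) i j)).comp
      (Nat.measurable_floor.comp (measurable_id.div_const δ)), fun t _ => hsel _⟩
  have hbdd : IsBddLaw (gridLaw sel δ v) :=
    IsSwitchingLaw.isBddLaw hc ⟨hlaw.1, fun t ht => subset_convexHull ℝ 𝒜 (hlaw.2 t ht)⟩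
  have hcont := continuousOn_gridMotion sel v hδ
  refine ⟨_, hlaw, hcont, fun t ht => ?_⟩
  rw [integral_eq_of_hasDerivAt_off_countable_of_le (gridMotion sel δ v) _ ht
    (countable_range fun k : ℕ => k * δ) (hcont.mono Icc_subset_Ici_self)
    (fun u hu => hasDerivAt_gridMotion sel v hδ hu.1.1 fun k hk => hu.2 ⟨k, hk.symm⟩)
    (hbdd.intervalIntegrable hcont ht), add_sub_cancel]

/-! ### The norm adapted to the Lyapunov exponent -/

section Lower

variable {n : Type*} [Fintype n] {f : Seminorm ℝ (n → ℝ)} {M c : ℝ}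

lemma mul_le_apply_expFlow (hM : 0 ≤ M) (hc : 0 < c) (hcf : ∀ v, c * ‖v‖ ≤ f v)
    {A : Matrix n n ℝ} (hA : ‖toCLM A‖ ≤ M) {x p : n → ℝ} {ρ δ : ℝ} (hδ : 0 ≤ δ)
    (hp : p ∈ Subgrad f x) (hpA : p ⬝ᵥ (A *ᵥ x) = ρ * f x) :
    (1 + ρ * δ - basisSum f / c * (M ^ 2 * Real.exp (M * δ) * δ ^ 2)) * f x
      ≤ f (expFlow A δ x) := by
  set e := expFlow A δ x - x - δ • (A *ᵥ x)
  have hexpand : p ⬝ᵥ expFlow A δ x = (1 + ρ * δ) * f x - p ⬝ᵥ (-e) := by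
    rw [show expFlow A δ x = x + δ • (A *ᵥ x) - (-e) by simp only [e]; abel,
      dotProduct_sub, dotProduct_add, hp.1, dotProduct_smul, hpA, smul_eq_mul]
    ring
  have herr : p ⬝ᵥ (-e) ≤ basisSum f / c * (M ^ 2 * Real.exp (M * δ) * δ ^ 2) * f x := calc
    p ⬝ᵥ (-e) ≤ basisSum f * ‖e‖ := norm_neg e ▸ (hp.2 (-e)).trans (seminorm_le_norm f (-e))
    _ ≤ basisSum f * (M ^ 2 * Real.exp (M * δ) * δ ^ 2 * (f x / c)) := by
      have htaylor := (norm_expFlow_sub_sub_le hM hA hδ x).trans <| mul_le_mul_of_nonneg_left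
        ((le_div_iff₀' hc).2 (hcf x)) (by positivity)
      exact mul_le_mul_of_nonneg_left htaylor (basisSum_nonneg f)
    _ = _ := by ring
  linarith [hp.2 (expFlow A δ x)]

lemma pow_mul_le_apply_gridPoint {sel : (n → ℝ) → Matrix n n ℝ} {δ q : ℝ} (hq : 0 ≤ q)
    (hstep : ∀ x, q * f x ≤ f (expFlow (sel x) δ x)) (v : n → ℝ) (k : ℕ) :
    q ^ k * f v ≤ f (gridPoint sel δ v k) := by
  induction k with
  | zero => simp [gridPoint]
  | succ k ih =>
    rw [gridPoint, Function.iterate_succ_apply', pow_succ', mul_assoc]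
    exact (mul_le_mul_of_nonneg_left ih hq).trans (hstep _)

end Lower

lemma le_of_forall_pow_mul_le {q r a D : ℝ} (hr : 0 < r) (ha : 0 < a)
    (h : ∀ k : ℕ, q ^ k * a ≤ D * r ^ k) : q ≤ r := by
  by_contra! hlt
  obtain ⟨k, hk⟩ := pow_unbounded_of_one_lt (D / a) ((one_lt_div hr).2 hlt)
  rw [div_pow, div_lt_div_iff₀ ha (by positivity)] at hk
  exact hk.not_ge (h k)

section Exponent

variable {𝒜 : Set Mat} {ρ s : ℝ} {f : Seminorm ℝ Plane}

lemma le_exp_of_growth (hc : IsCompact 𝒜) (hdef : ∀ v, f v = 0 → v = 0)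
    (hs : ∀ x, IsTrajectory 𝒜 x → ∃ C : ℝ, ∀ t, 0 ≤ t → ‖x t‖ ≤ C * Real.exp (s * t))
    {sel : Plane → Mat} (hsel : ∀ x, sel x ∈ 𝒜) {δ q : ℝ} (hδ : 0 < δ)
    (hstep : ∀ x, q * f x ≤ f (expFlow (sel x) δ x)) : q ≤ Real.exp (s * δ) := by
  rcases le_or_gt q 0 with hq | hq
  · exact hq.trans (Real.exp_pos _).le
  obtain ⟨v, hv⟩ := exists_ne (0 : Plane)
  obtain ⟨C, hC⟩ := hs _ (isTrajectory_gridMotion hc hsel hδ v)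
  refine le_of_forall_pow_mul_le (D := basisSum f * C) (Real.exp_pos _)
    ((apply_nonneg f v).lt_of_ne' (mt (hdef v) hv)) fun k => ?_
  calc q ^ k * f v ≤ f (gridMotion sel δ v (k * δ)) :=
        (pow_mul_le_apply_gridPoint hq.le hstep v k).trans_eq (by rw [gridMotion_mul sel v hδ])
    _ ≤ basisSum f * (C * Real.exp (s * (k * δ))) := (seminorm_le_norm f _).trans
        (mul_le_mul_of_nonneg_left (hC _ (by positivity)) (basisSum_nonneg f))
    _ = basisSum f * C * Real.exp (s * δ) ^ k := by
        rw [← Real.exp_nat_mul, mul_assoc, mul_left_comm s]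

/-- The feedback that selects a tangent velocity, sampled at the multiples of a small `δ`, loses
only `O(δ²)` per step against growth at the rate `ρ`. -/
lemma le_of_tangent_velocity (hc : IsCompact 𝒜) (hdef : ∀ v, f v = 0 → v = 0)
    (hext : ∀ x, ∃ A ∈ 𝒜, ∃ p ∈ Subgrad f x, p ⬝ᵥ (A *ᵥ x) = ρ * f x)
    (hs : ∀ x, IsTrajectory 𝒜 x → ∃ C : ℝ, ∀ t, 0 ≤ t → ‖x t‖ ≤ C * Real.exp (s * t)) :
    ρ ≤ s := by
  obtain ⟨c, hc0, hcf⟩ := exists_mul_norm_le_seminorm hdef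
  obtain ⟨M, hM0, hM⟩ := exists_norm_toCLM_le_convexHull hc
  choose sel hsel p hp hpA using hext
  let g : ℝ → ℝ := fun δ =>
    1 + ρ * δ - basisSum f / c * (M ^ 2 * Real.exp (M * δ) * δ ^ 2) - Real.exp (s * δ)
  have hderiv : HasDerivAt g (ρ - s) 0 := by
    have hlin := ((hasDerivAt_id (0 : ℝ)).const_mul ρ).const_add 1
    have hquad := ((((hasDerivAt_exp_mul M 0).const_mul (M ^ 2)).mul
      ((hasDerivAt_id (0 : ℝ)).pow 2)).const_mul (basisSum f / c))
    exact ((hlin.sub hquad).sub (hasDerivAt_exp_mul s 0)).congr_deriv (by simp)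
  refine sub_nonpos.1 (deriv_nonpos_of_le_of_ge hderiv fun δ hδ => ?_)
  rcases hδ.eq_or_lt with rfl | hδ
  · exact le_rfl
  have hexp := le_exp_of_growth hc hdef hs hsel hδ fun x => mul_le_apply_expFlow hM0 hc0 hcf
    (hM _ (subset_convexHull ℝ 𝒜 (hsel x))) hδ.le (hp x) (hpA x)
  have hzero : g 0 = 0 := by simp [g]
  rw [hzero]
  exact sub_nonpos.2 hexp

lemma lyapunovExponent_eq (hc : IsCompact 𝒜) (hdef : ∀ v, f v = 0 → v = 0)
    (hinv : IsInvariantFor (shiftSet 𝒜 ρ) f)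
    (hext : ∀ x, ∃ B ∈ shiftSet 𝒜 ρ, ∃ p ∈ Subgrad f x, p ⬝ᵥ (B *ᵥ x) = 0) :
    lyapunovExponent 𝒜 = ρ := by
  refine IsLeast.csInf_eq ⟨fun x hx => ?_, fun s hs => le_of_tangent_velocity hc hdef
    (fun x => ?_) hs⟩
  · obtain ⟨c, hc0, hcf⟩ := exists_mul_norm_le_seminorm hdef
    refine ⟨f (x 0) / c, fun t ht => ?_⟩
    rw [div_mul_eq_mul_div, le_div_iff₀' hc0, mul_comm (f (x 0))]
    exact (hcf _).trans (hinv.apply_le_exp_mul hc hx.convexHull ht)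
  · obtain ⟨B, hB, p, hp, hpB⟩ := hext x
    refine ⟨_, mem_shiftSet.1 hB, p, hp, ?_⟩
    rw [Matrix.add_mulVec, dotProduct_add, hpB, Matrix.smul_mulVec, Matrix.one_mulVec,
      dotProduct_smul, hp.1, smul_eq_mul, zero_add]

theorem exists_adapted_norm (hc : IsCompact 𝒜) (hirr : IsIrreducible 𝒜) :
    ∃ f : Seminorm ℝ Plane, (∀ v, f v = 0 → v = 0) ∧
      IsInvariantFor (shiftSet 𝒜 (lyapunovExponent 𝒜)) f ∧
      ∀ x, ∃ B ∈ shiftSet 𝒜 (lyapunovExponent 𝒜), ∃ p ∈ Subgrad f x, p ⬝ᵥ (B *ᵥ x) = 0 := by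
  obtain ⟨ρ, N, hN0, hN, hmin⟩ := exists_minimal_rate hc hirr.nonempty
  obtain ⟨f, hf0, hf, hext⟩ := exists_norm_with_tangent_velocity (isCompact_shiftSet hc ρ)
    (hirr.nonempty.image _) (HasRate.shiftSet_iff.2 (by rwa [zero_add])) hN0
    (hN.eq_zero_of_apply_eq_zero hirr hN0)
    (fun s hs N' hN' => hmin (s + ρ) (by linarith) N' (HasRate.shiftSet_iff.1 hN'))
  have hdef := (HasRate.shiftSet_iff.1 hf).eq_zero_of_apply_eq_zero hirr hf0
  have hinv : IsInvariantFor (shiftSet 𝒜 ρ) f := fun x B hB p hp => by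
    simpa using hf.subgrad_le hB hp
  exact ⟨f, hdef, by rwa [lyapunovExponent_eq hc hdef hinv hext],
    by rwa [lyapunovExponent_eq hc hdef hinv hext]⟩

end Exponent

/-! ### Eigenvalues and dominance -/

lemma mem_eigenvalues {A : Mat} {z : ℂ} :
    z ∈ eigenvalues A ↔ z ^ 2 - (A.trace : ℂ) * z + (A.det : ℂ) = 0 := by
  rw [eigenvalues, spectrum.mem_iff, Matrix.isUnit_iff_isUnit_det, isUnit_iff_ne_zero, not_not,
    Matrix.det_fin_two, Matrix.det_fin_two, Matrix.trace_fin_two]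
  simp only [Matrix.algebraMap_matrix_apply, Matrix.sub_apply, Matrix.map_apply, if_true,
    Algebra.algebraMap_self, RingHom.id_apply, zero_ne_one, one_ne_zero, if_false]
  push_cast
  constructor <;> intro h <;> linear_combination h

lemma trace_add_smul_one (B : Mat) (s : ℝ) : (B + s • (1 : Mat)).trace = B.trace + 2 * s := by
  simp [mul_comm]

lemma det_add_smul_one (B : Mat) (s : ℝ) :
    (B + s • (1 : Mat)).det = B.det + s * B.trace + s ^ 2 := by
  simp [Matrix.trace_fin_two, Matrix.det_fin_two]; ring

lemma mem_eigenvalues_add {B : Mat} {s : ℝ} {z : ℂ} :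
    z ∈ eigenvalues (B + s • (1 : Mat)) ↔ z - s ∈ eigenvalues B := by
  rw [mem_eigenvalues, mem_eigenvalues, trace_add_smul_one, det_add_smul_one]
  push_cast
  constructor <;> intro h <;> linear_combination h

lemma mul_self_eq (B : Mat) : B * B = B.trace • B - B.det • (1 : Mat) := by
  ext i j
  fin_cases i <;> fin_cases j <;>
    simp [Matrix.mul_apply, Fin.sum_univ_two, Matrix.trace_fin_two, Matrix.det_fin_two] <;> ring

lemma exists_mulVec_eq_smul {B : Mat} {z : ℂ} (hz : z ∈ eigenvalues B) (him : z.im = 0) :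
    ∃ y ≠ 0, B *ᵥ y = z.re • y := by
  have hdet : (B + (-z.re) • (1 : Mat)).det = 0 := by
    have hre := congrArg Complex.re (mem_eigenvalues.1 hz)
    simp only [pow_two, Complex.add_re, Complex.sub_re, Complex.mul_re, Complex.ofReal_re,
      Complex.ofReal_im, him, mul_zero, sub_zero, Complex.zero_re] at hre
    rw [det_add_smul_one]
    linear_combination hre
  obtain ⟨y, hy, hBy⟩ := Matrix.exists_mulVec_eq_zero_iff.2 hdet
  rw [Matrix.add_mulVec, Matrix.smul_mulVec, Matrix.one_mulVec, neg_smul, add_neg_eq_zero] at hBy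
  exact ⟨y, hy, hBy⟩

lemma trace_eq_and_det_eq {B : Mat} {z : ℂ} (hz : z ∈ eigenvalues B) (him : z.im ≠ 0) :
    B.trace = 2 * z.re ∧ B.det = z.re ^ 2 + z.im ^ 2 := by
  have hre := congrArg Complex.re (mem_eigenvalues.1 hz)
  have him' := congrArg Complex.im (mem_eigenvalues.1 hz)
  simp only [pow_two, Complex.add_re, Complex.sub_re, Complex.mul_re, Complex.ofReal_re,
    Complex.ofReal_im, zero_mul, sub_zero, Complex.zero_re] at hre
  simp only [pow_two, Complex.add_im, Complex.sub_im, Complex.mul_im, Complex.ofReal_re,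
    Complex.ofReal_im, zero_mul, add_zero, Complex.zero_im] at him'
  have htr : B.trace = 2 * z.re := mul_right_cancel₀ him (by linear_combination -him')
  exact ⟨htr, by rw [htr] at hre; linear_combination hre⟩

lemma re_eq_re_of_mem_eigenvalues {B : Mat} {z z' : ℂ} (hz : z ∈ eigenvalues B) (him : z.im ≠ 0)
    (hz' : z' ∈ eigenvalues B) : z'.re = z.re := by
  by_cases him' : z'.im = 0
  · obtain ⟨htr, hdet⟩ := trace_eq_and_det_eq hz him
    have hre := congrArg Complex.re (mem_eigenvalues.1 hz')
    simp only [pow_two, Complex.add_re, Complex.sub_re, Complex.mul_re, Complex.ofReal_re,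
      Complex.ofReal_im, him', mul_zero, sub_zero, Complex.zero_re, htr, hdet] at hre
    nlinarith [sq_nonneg (z'.re - z.re), pow_pos (abs_pos.2 him) 2, sq_abs z.im]
  · linarith [(trace_eq_and_det_eq hz him).1, (trace_eq_and_det_eq hz' him').1]

lemma exists_complex_structure {B : Mat} {z : ℂ} (hz : z ∈ eigenvalues B) (him : z.im ≠ 0) :
    ∃ (J : Mat) (b : ℝ), 0 < b ∧ J * J = -1 ∧ B = z.re • (1 : Mat) + b • J := by
  obtain ⟨htr, hdet⟩ := trace_eq_and_det_eq hz him
  have hsq : (B - z.re • (1 : Mat)) * (B - z.re • (1 : Mat)) =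
      -((|z.im| * |z.im|) • (1 : Mat)) := by
    calc _ = B * B - (2 * z.re) • B + z.re ^ 2 • (1 : Mat) := by
          simp only [sub_mul, mul_sub, smul_mul_assoc, mul_smul_comm, one_mul, mul_one]
          module
      _ = _ := by rw [mul_self_eq, htr, hdet, abs_mul_abs_self]; module
  have hb : 0 < |z.im| := abs_pos.2 him
  refine ⟨|z.im|⁻¹ • (B - z.re • (1 : Mat)), |z.im|, hb, ?_, ?_⟩
  · rw [smul_mul_smul_comm, hsq, ← mul_inv, smul_neg, smul_smul, inv_mul_cancel₀ (by positivity),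
      one_smul]
  · rw [smul_smul, mul_inv_cancel₀ hb.ne', one_smul, add_sub_cancel]

lemma seminorm_pos {E : Type*} [AddCommGroup E] [Module ℝ E] {f : Seminorm ℝ E}
    (hdef : ∀ v, f v = 0 → v = 0) {v : E} (hv : v ≠ 0) : 0 < f v :=
  (apply_nonneg f v).lt_of_ne' (mt (hdef v) hv)

section Invariance

variable {n : Type*} [Fintype n] {𝓑 : Set (Matrix n n ℝ)} {f : Seminorm ℝ (n → ℝ)}

lemma IsInvariantFor.eigenvalue_nonpos (hinv : IsInvariantFor 𝓑 f) (hdef : ∀ v, f v = 0 → v = 0)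
    {B : Matrix n n ℝ} (hB : B ∈ _root_.convexHull ℝ 𝓑) {y : n → ℝ} (hy : y ≠ 0)
    {μ : ℝ} (hBy : B *ᵥ y = μ • y) : μ ≤ 0 := by
  obtain ⟨p, hp⟩ := subgrad_nonempty f y
  have hle := hinv.convexHull y B hB p hp
  rw [hBy, dotProduct_smul, hp.1, smul_eq_mul] at hle
  exact nonpos_of_mul_nonpos_left hle (seminorm_pos hdef hy)

variable [DecidableEq n] {J : Matrix n n ℝ} (hJ : J * J = -1)

include hJ

lemma mulVec_mulVec_of_mul_self_eq_neg_one (x : n → ℝ) : J *ᵥ (J *ᵥ x) = -x := by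
  rw [Matrix.mulVec_mulVec, hJ, Matrix.neg_mulVec, Matrix.one_mulVec]

lemma isFlow_spiral (a b : ℝ) (x : n → ℝ) :
    IsFlow (fun _ => a • (1 : Matrix n n ℝ) + b • J)
      (fun t => Real.exp (a * t) • (Real.cos (b * t) • x + Real.sin (b * t) • (J *ᵥ x))) := by
  refine isFlow_of_hasDerivAt (by fun_prop) fun t => ?_
  have hlin : HasDerivAt (fun t : ℝ => b * t) b t := by simpa using (hasDerivAt_id t).const_mul b
  refine ((hasDerivAt_exp_mul a t).smul
    ((hlin.cos.smul_const x).fun_add (hlin.sin.smul_const (J *ᵥ x)))).congr_deriv ?_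
  rw [Matrix.add_mulVec, Matrix.smul_mulVec, Matrix.smul_mulVec, Matrix.one_mulVec,
    Matrix.mulVec_smul, Matrix.mulVec_add, Matrix.mulVec_smul, Matrix.mulVec_smul,
    mulVec_mulVec_of_mul_self_eq_neg_one hJ]
  module

lemma IsInvariantFor.spiral_rate_nonpos [Nonempty n] (hinv : IsInvariantFor 𝓑 f)
    (hdef : ∀ v, f v = 0 → v = 0) {a b : ℝ} (hb : 0 < b)
    (hB : a • (1 : Matrix n n ℝ) + b • J ∈ _root_.convexHull ℝ 𝓑) : a ≤ 0 := by
  obtain ⟨v, hv⟩ := exists_ne (0 : n → ℝ)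
  have hT : 0 < 2 * Real.pi / b := by positivity
  have hle := hinv.antitoneOn (isFlow_spiral hJ a b v) (fun _ _ => hB) self_mem_Ici
    (mem_Ici.2 hT.le) hT.le
  simp only [mul_div_cancel₀ _ hb.ne', Real.cos_two_pi, Real.sin_two_pi, one_smul, zero_smul,
    add_zero, mul_zero, Real.cos_zero, Real.sin_zero, seminorm_exp_smul, Real.exp_zero] at hle
  have hexp : Real.exp (a * (2 * Real.pi / b)) ≤ 1 :=
    le_of_mul_le_mul_right (by rwa [one_mul]) (seminorm_pos hdef hv)
  exact nonpos_of_mul_nonpos_left (Real.exp_le_one_iff.1 hexp) hT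

end Invariance

lemma IsInvariantFor.re_eigenvalue_nonpos {𝓑 : Set Mat} {f : Seminorm ℝ Plane}
    (hinv : IsInvariantFor 𝓑 f) (hdef : ∀ v, f v = 0 → v = 0) {B : Mat}
    (hB : B ∈ _root_.convexHull ℝ 𝓑) {z : ℂ} (hz : z ∈ eigenvalues B) : z.re ≤ 0 := by
  by_cases him : z.im = 0
  · obtain ⟨y, hy, hBy⟩ := exists_mulVec_eq_smul hz him
    exact hinv.eigenvalue_nonpos hdef hB hy hBy
  · obtain ⟨J, b, hb, hJ, hBJ⟩ := exists_complex_structure hz him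
    exact hinv.spiral_rate_nonpos hJ hdef hb (hBJ ▸ hB)

section Dominance

variable {𝒜 : Set Mat} {f : Seminorm ℝ Plane} {B : Mat}

lemma isDominant_add_smul_one (hdef : ∀ v, f v = 0 → v = 0)
    (hinv : IsInvariantFor (shiftSet 𝒜 (lyapunovExponent 𝒜)) f)
    (hB : B ∈ convexHull ℝ (shiftSet 𝒜 (lyapunovExponent 𝒜))) (hB0 : B ≠ 0) {z : ℂ}
    (hz : z ∈ eigenvalues B) (hre : z.re = 0) :
    IsDominant 𝒜 (B + lyapunovExponent 𝒜 • (1 : Mat)) := by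
  refine ⟨mem_convexHull_shiftSet.1 hB, by simpa using hB0,
    ⟨z + lyapunovExponent 𝒜, by rwa [mem_eigenvalues_add, add_sub_cancel_right], by simp [hre]⟩,
    forall_mem_image.2 fun z' hz' => ?_⟩
  simpa using hinv.re_eigenvalue_nonpos hdef hB (mem_eigenvalues_add.1 hz')

lemma re_eigenvalue_neg_of_not_dominance (hreal : ¬ HasRealDominance 𝒜)
    (hcomplex : ¬ HasComplexDominance 𝒜) (hdef : ∀ v, f v = 0 → v = 0)
    (hinv : IsInvariantFor (shiftSet 𝒜 (lyapunovExponent 𝒜)) f)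
    (hB : B ∈ convexHull ℝ (shiftSet 𝒜 (lyapunovExponent 𝒜))) (hB0 : B ≠ 0) {z : ℂ}
    (hz : z ∈ eigenvalues B) : z.re < 0 := by
  refine (hinv.re_eigenvalue_nonpos hdef hB hz).lt_of_ne fun hre => ?_
  have hdom := isDominant_add_smul_one hdef hinv hB hB0 hz hre
  exact hreal ⟨_, hdom, fun z' hz' => by_contra fun him => hcomplex ⟨_, hdom, z', hz', him⟩⟩

lemma trace_neg_of_re_eigenvalue_neg (h : ∀ z ∈ eigenvalues B, z.re < 0) : B.trace < 0 := by
  obtain ⟨z, hz⟩ := spectrum.nonempty_of_isAlgClosed_of_finiteDimensional ℂ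
    (B.map (fun a : ℝ => (a : ℂ)))
  have hz' : (B.trace : ℂ) - z ∈ eigenvalues B :=
    mem_eigenvalues.2 (by linear_combination mem_eigenvalues.1 hz)
  have hle := h _ hz'
  rw [Complex.sub_re, Complex.ofReal_re] at hle
  linarith [h z hz]

lemma trace_neg_of_not_dominance (hscalar : lyapunovExponent 𝒜 • (1 : Mat) ∉ 𝒜)
    (hreal : ¬ HasRealDominance 𝒜) (hcomplex : ¬ HasComplexDominance 𝒜)
    (hdef : ∀ v, f v = 0 → v = 0) (hinv : IsInvariantFor (shiftSet 𝒜 (lyapunovExponent 𝒜)) f) :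
    ∀ B ∈ convexHull ℝ (shiftSet 𝒜 (lyapunovExponent 𝒜)), B.trace < 0 := by
  refine convexHull_min (fun B hB => ?_)
    (convex_halfSpace_lt (Matrix.traceLinearMap (Fin 2) ℝ ℝ).isLinear 0)
  refine trace_neg_of_re_eigenvalue_neg fun z hz => re_eigenvalue_neg_of_not_dominance hreal
    hcomplex hdef hinv (subset_convexHull ℝ _ hB) ?_ hz
  rintro rfl
  rw [mem_shiftSet, zero_add] at hB
  exact hscalar hB

lemma mulVec_ne_zero_of_not_dominance (hscalar : lyapunovExponent 𝒜 • (1 : Mat) ∉ 𝒜)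
    (hreal : ¬ HasRealDominance 𝒜) (hcomplex : ¬ HasComplexDominance 𝒜)
    (hdef : ∀ v, f v = 0 → v = 0) (hinv : IsInvariantFor (shiftSet 𝒜 (lyapunovExponent 𝒜)) f) :
    ∀ B ∈ convexHull ℝ (shiftSet 𝒜 (lyapunovExponent 𝒜)), ∀ x, x ≠ 0 → B *ᵥ x ≠ 0 := by
  intro B hB x hx hBx
  have htr := trace_neg_of_not_dominance hscalar hreal hcomplex hdef hinv B hB
  have hB0 : B ≠ 0 := by rintro rfl; simp at htr
  have hzero : (0 : ℂ) ∈ eigenvalues B :=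
    mem_eigenvalues.2 (by simp [Matrix.exists_mulVec_eq_zero_iff.1 ⟨x, hx, hBx⟩])
  simpa using re_eigenvalue_neg_of_not_dominance hreal hcomplex hdef hinv hB hB0 hzero

lemma HasComplexDominance.exists_rotation (h : HasComplexDominance 𝒜) :
    ∃ (J : Mat) (b : ℝ), 0 < b ∧ J * J = -1 ∧
      b • J ∈ convexHull ℝ (shiftSet 𝒜 (lyapunovExponent 𝒜)) := by
  obtain ⟨A, ⟨hA, -, ⟨z₀, hz₀, hre⟩, -⟩, z, hz, him⟩ := h
  rw [← sub_add_cancel A (lyapunovExponent 𝒜 • 1)] at hA hz₀ hz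
  rw [mem_eigenvalues_add] at hz₀ hz
  have hrot : (z - lyapunovExponent 𝒜).re = 0 := by
    rw [← re_eq_re_of_mem_eigenvalues hz (by simpa using him) hz₀]
    simp [hre]
  obtain ⟨J, b, hb, hJ, hBJ⟩ := exists_complex_structure hz (by simpa using him)
  rw [hrot, zero_smul, zero_add] at hBJ
  exact ⟨J, b, hb, hJ, hBJ ▸ mem_convexHull_shiftSet.2 hA⟩

end Dominance

/-! ### Polar coordinates in a linear frame -/

/-- The standard area form of the plane, used to express that two vectors form a frame. -/
def area (u w : Plane) : ℝ := u 0 * w 1 - u 1 * w 0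

lemma area_self (x : Plane) : area x x = 0 := by
  simp only [area]; ring

lemma area_add_left (x x' y : Plane) : area (x + x') y = area x y + area x' y := by
  simp only [area, Pi.add_apply]; ring

lemma area_add_right (x y y' : Plane) : area x (y + y') = area x y + area x y' := by
  simp only [area, Pi.add_apply]; ring

lemma area_smul_left (a : ℝ) (x y : Plane) : area (a • x) y = a * area x y := by
  simp only [area, Pi.smul_apply, smul_eq_mul]; ring

lemma area_smul_right (a : ℝ) (x y : Plane) : area x (a • y) = a * area x y := by
  simp only [area, Pi.smul_apply, smul_eq_mul]; ring

lemma area_neg_neg (x y : Plane) : area (-x) (-y) = area x y := by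
  simp only [area, Pi.neg_apply, neg_mul_neg]

lemma area_smul_add_area_smul (u w v : Plane) :
    area v w • u + area u v • w = area u w • v := by
  ext i
  simp only [area, Pi.add_apply, Pi.smul_apply, smul_eq_mul]
  fin_cases i <;> simp only [Fin.zero_eta, Fin.mk_one] <;> ring

lemma abs_area_le (x y : Plane) : |area x y| ≤ 2 * (‖x‖ * ‖y‖) := by
  have hmul : ∀ i j, |x i * y j| ≤ ‖x‖ * ‖y‖ := fun i j => by
    rw [abs_mul]
    exact mul_le_mul (norm_le_pi_norm x i) (norm_le_pi_norm y j) (abs_nonneg _) (norm_nonneg _)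
  calc |area x y| ≤ |x 0 * y 1| + |x 1 * y 0| := abs_sub _ _
    _ ≤ 2 * (‖x‖ * ‖y‖) := by linarith [hmul 0 1, hmul 1 0]

lemma hasDerivAt_area {x y : ℝ → Plane} {x' y' : Plane} {t : ℝ} (hx : HasDerivAt x x' t)
    (hy : HasDerivAt y y' t) :
    HasDerivAt (fun t => area (x t) (y t)) (area x' (y t) + area (x t) y') t := by
  have hx' := hasDerivAt_pi.1 hx
  have hy' := hasDerivAt_pi.1 hy
  refine (((hx' 0).mul (hy' 1)).sub ((hx' 1).mul (hy' 0))).congr_deriv ?_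
  simp only [area]
  ring

/-- The ellipse with conjugate semi-axes `u`, `w`; the polar angle in the frame `(u, w)` is the
parameter `θ` of the ray through `ellipse u w θ`. -/
noncomputable def ellipse (u w : Plane) (θ : ℝ) : Plane := Real.cos θ • u + Real.sin θ • w

section Ellipse

variable (u w : Plane)

lemma contDiff_ellipse : ContDiff ℝ 1 (ellipse u w) := by
  unfold ellipse; fun_prop

lemma continuous_ellipse : Continuous (ellipse u w) := (contDiff_ellipse u w).continuous

lemma ellipse_zero : ellipse u w 0 = u := by simp [ellipse]

lemma periodic_ellipse : Function.Periodic (ellipse u w) (2 * Real.pi) := by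
  intro θ; simp [ellipse]

lemma ellipse_add_pi (θ : ℝ) : ellipse u w (θ + Real.pi) = -ellipse u w θ := by
  simp only [ellipse, Real.cos_add_pi, Real.sin_add_pi]; module

lemma ellipse_add_pi_div_two (θ : ℝ) :
    ellipse u w (θ + Real.pi / 2) = -Real.sin θ • u + Real.cos θ • w := by
  rw [ellipse, Real.cos_add_pi_div_two, Real.sin_add_pi_div_two]

lemma hasDerivAt_ellipse (θ : ℝ) :
    HasDerivAt (ellipse u w) (ellipse u w (θ + Real.pi / 2)) θ := by
  rw [ellipse_add_pi_div_two]
  exact ((Real.hasDerivAt_cos θ).smul_const u).add ((Real.hasDerivAt_sin θ).smul_const w)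

lemma norm_ellipse_le (θ : ℝ) : ‖ellipse u w θ‖ ≤ ‖u‖ + ‖w‖ := by
  refine (norm_add_le _ _).trans (add_le_add ?_ ?_) <;> rw [norm_smul]
  · exact mul_le_of_le_one_left (norm_nonneg _) (Real.abs_cos_le_one θ)
  · exact mul_le_of_le_one_left (norm_nonneg _) (Real.abs_sin_le_one θ)

lemma area_ellipse_ellipse (φ ψ : ℝ) :
    area (ellipse u w φ) (ellipse u w ψ) = area u w * Real.sin (ψ - φ) := by
  rw [Real.sin_sub]
  simp only [area, ellipse, Pi.add_apply, Pi.smul_apply, smul_eq_mul]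
  ring

lemma area_ellipse_add_pi_div_two (θ : ℝ) :
    area (ellipse u w θ) (ellipse u w (θ + Real.pi / 2)) = area u w := by
  rw [area_ellipse_ellipse, add_sub_cancel_left, Real.sin_pi_div_two, mul_one]

variable {u w}

lemma ellipse_ne_zero (h : area u w ≠ 0) (θ : ℝ) : ellipse u w θ ≠ 0 := by
  intro hzero
  refine h ?_
  rw [← area_ellipse_add_pi_div_two u w θ, hzero]
  simp [area]

lemma exists_ellipse_polar (h : area u w ≠ 0) {v : Plane} (hv : v ≠ 0) :
    ∃ r > (0 : ℝ), ∃ θ ∈ Ico 0 (2 * Real.pi), v = r • ellipse u w θ := by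
  set z : ℂ := ⟨area v w / area u w, area u v / area u w⟩
  have hvz : v = z.re • u + z.im • w := by
    rw [← smul_right_injective Plane h |>.eq_iff]
    simp only [z, smul_add, smul_smul, mul_div_cancel₀ _ h, area_smul_add_area_smul]
  have hz : z ≠ 0 := by
    intro hz
    simp only [hz, Complex.zero_re, Complex.zero_im, zero_smul, add_zero] at hvz
    exact hv hvz
  obtain ⟨θ, hθ, hθz⟩ := (periodic_ellipse u w).exists_mem_Ico₀ Real.two_pi_pos z.arg
  refine ⟨‖z‖, norm_pos_iff.2 hz, θ, hθ, ?_⟩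
  rw [← hθz, ellipse, smul_add, smul_smul, smul_smul, Complex.norm_mul_cos_arg,
    Complex.norm_mul_sin_arg, ← hvz]

lemma smul_ellipse_angle_injective (h : area u w ≠ 0) {a a' θ θ' : ℝ} (ha : 0 < a) (ha' : 0 < a')
    (hθ : θ ∈ Ico 0 (2 * Real.pi)) (hθ' : θ' ∈ Ico 0 (2 * Real.pi))
    (heq : a • ellipse u w θ = a' • ellipse u w θ') : θ = θ' := by
  have hcos : a * Real.cos θ = a' * Real.cos θ' := by
    have harea := congrArg (area · w) heq
    simp only [ellipse, area_smul_left, area_add_left, area_self, mul_zero, add_zero] at harea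
    exact mul_right_cancel₀ h (by linear_combination harea)
  have hsin : a * Real.sin θ = a' * Real.sin θ' := by
    have harea := congrArg (area u) heq
    simp only [ellipse, area_smul_right, area_add_right, area_self, mul_zero, zero_add] at harea
    exact mul_right_cancel₀ h (by linear_combination harea)
  obtain rfl : a = a' := (sq_eq_sq₀ ha.le ha'.le).1 <| calc
    a ^ 2 = (a * Real.cos θ) ^ 2 + (a * Real.sin θ) ^ 2 := by
      linear_combination (-(a ^ 2)) * Real.cos_sq_add_sin_sq θ
    _ = (a' * Real.cos θ') ^ 2 + (a' * Real.sin θ') ^ 2 := by rw [hcos, hsin]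
    _ = a' ^ 2 := by linear_combination (a' ^ 2) * Real.cos_sq_add_sin_sq θ'
  have hangle : (θ : Real.Angle) = θ' :=
    Real.Angle.cos_sin_inj (mul_left_cancel₀ ha.ne' hcos) (mul_left_cancel₀ ha.ne' hsin)
  have : Fact (0 < 2 * Real.pi) := ⟨Real.two_pi_pos⟩
  rw [← zero_add (2 * Real.pi)] at hθ hθ'
  exact (AddCircle.coe_eq_coe_iff_of_mem_Ico hθ hθ').1 hangle

end Ellipse

/-- The radial parametrization of the unit sphere of `f` by the polar angle in the frame
`(u, w)`. -/
noncomputable def sphereCurve (f : Seminorm ℝ Plane) (u w : Plane) (θ : ℝ) : Plane :=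
  (f (ellipse u w θ))⁻¹ • ellipse u w θ

section Curve

variable {f : Seminorm ℝ Plane} {u w : Plane}

lemma periodic_sphereCurve : Function.Periodic (sphereCurve f u w) (2 * Real.pi) := by
  intro θ; simp only [sphereCurve, periodic_ellipse u w θ]

lemma sphereCurve_add_pi (θ : ℝ) : sphereCurve f u w (θ + Real.pi) = -sphereCurve f u w θ := by
  simp only [sphereCurve, ellipse_add_pi, map_neg_eq_map, smul_neg]

variable (hdef : ∀ v, f v = 0 → v = 0) (h : area u w ≠ 0)

include hdef h

lemma seminorm_ellipse_pos (θ : ℝ) : 0 < f (ellipse u w θ) :=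
  seminorm_pos hdef (ellipse_ne_zero h θ)

lemma seminorm_sphereCurve (θ : ℝ) : f (sphereCurve f u w θ) = 1 := by
  have hpos := seminorm_ellipse_pos hdef h θ
  rw [sphereCurve, map_smul_eq_mul, Real.norm_of_nonneg (inv_nonneg.2 hpos.le),
    inv_mul_cancel₀ hpos.ne']

lemma exists_eq_smul_sphereCurve {v : Plane} (hv : v ≠ 0) :
    ∃ θ ∈ Ico 0 (2 * Real.pi), v = f v • sphereCurve f u w θ := by
  obtain ⟨r, hr, θ, hθ, rfl⟩ := exists_ellipse_polar h hv
  refine ⟨θ, hθ, ?_⟩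
  rw [sphereCurve, map_smul_eq_mul, Real.norm_of_nonneg hr.le, smul_smul, mul_assoc,
    mul_inv_cancel₀ (seminorm_ellipse_pos hdef h θ).ne', mul_one]

lemma bijOn_sphereCurve : BijOn (sphereCurve f u w) (Ico 0 (2 * Real.pi)) (unitSphere f) := by
  refine ⟨fun θ _ => seminorm_sphereCurve hdef h θ, fun θ hθ θ' hθ' heq => ?_,
    fun v (hv : f v = 1) => ?_⟩
  · exact smul_ellipse_angle_injective h (inv_pos.2 (seminorm_ellipse_pos hdef h θ))
      (inv_pos.2 (seminorm_ellipse_pos hdef h θ')) hθ hθ' heq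
  · have hv0 : v ≠ 0 := by rintro rfl; simp at hv
    obtain ⟨θ, hθ, hvθ⟩ := exists_eq_smul_sphereCurve hdef h hv0
    rw [hv, one_smul] at hvθ
    exact ⟨θ, hθ, hvθ.symm⟩

lemma contDiff_sphereCurve (hf : ContDiff ℝ 1 fun θ => f (ellipse u w θ)) :
    ContDiff ℝ 1 (sphereCurve f u w) :=
  (hf.inv fun θ => (seminorm_ellipse_pos hdef h θ).ne').smul (contDiff_ellipse u w)

lemma deriv_sphereCurve_ne_zero (hf : ContDiff ℝ 1 fun θ => f (ellipse u w θ)) (θ : ℝ) :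
    deriv (sphereCurve f u w) θ ≠ 0 := by
  have hpos := seminorm_ellipse_pos hdef h θ
  have hinv : ContDiff ℝ 1 fun θ => (f (ellipse u w θ))⁻¹ :=
    hf.inv fun θ => (seminorm_ellipse_pos hdef h θ).ne'
  have hderiv : HasDerivAt (sphereCurve f u w) _ θ :=
    (hinv.differentiable one_ne_zero θ).hasDerivAt.smul (hasDerivAt_ellipse u w θ)
  have harea : area (ellipse u w θ) (deriv (sphereCurve f u w) θ) =
      (f (ellipse u w θ))⁻¹ * area u w := by
    rw [hderiv.deriv, area_add_right, area_smul_right, area_smul_right, area_self,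
      area_ellipse_add_pi_div_two, mul_zero, add_zero]
  intro hzero
  refine mul_ne_zero (inv_pos.2 hpos).ne' h ?_
  rw [← harea, hzero]
  simp [area]

lemma isC1ClosedCurve_unitSphere (hf : ContDiff ℝ 1 fun θ => f (ellipse u w θ)) :
    IsC1ClosedCurve (unitSphere f) :=
  ⟨2 * Real.pi, sphereCurve f u w, Real.two_pi_pos, contDiff_sphereCurve hdef h hf,
    periodic_sphereCurve, deriv_sphereCurve_ne_zero hdef h hf, bijOn_sphereCurve hdef h⟩

end Curve

/-! ### Barabanov norms and invariant norms -/

section Periodic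

variable {n : Type*} [Fintype n] {𝓑 : Set (Matrix n n ℝ)} {B : ℝ → Matrix n n ℝ} {z : ℝ → n → ℝ}
  {L : ℝ}

lemma IsInvariantFor.const_of_periodic {g : Seminorm ℝ (n → ℝ)} (hg : IsInvariantFor 𝓑 g)
    (hz : IsFlow B z) (hB : ∀ t, 0 ≤ t → B t ∈ _root_.convexHull ℝ 𝓑) (hL : 0 < L)
    (hper : ∀ t, 0 ≤ t → z (t + L) = z t) {t : ℝ} (ht : 0 ≤ t) : g (z t) = g (z 0) := by
  have hanti := hg.antitoneOn hz hB
  refine le_antisymm (hanti self_mem_Ici ht ht) ?_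
  have hmul : ∀ k : ℕ, z (k * L) = z 0 := fun k => by
    induction k with
    | zero => simp
    | succ k ih => rw [Nat.cast_succ, add_one_mul, hper _ (by positivity), ih]
  obtain ⟨k, hk⟩ := exists_nat_ge (t / L)
  rw [div_le_iff₀ hL] at hk
  simpa only [hmul] using hanti ht (mem_Ici.2 (ht.trans hk)) hk

lemma IsInvariantFor.exists_eq_mul_of_periodic [Nonempty n] {f g : Seminorm ℝ (n → ℝ)}
    (hf : IsInvariantFor 𝓑 f) (hfdef : ∀ v, f v = 0 → v = 0)
    (hg : IsInvariantFor 𝓑 g) (hgdef : ∀ v, g v = 0 → v = 0)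
    (hz : IsFlow B z) (hB : ∀ t, 0 ≤ t → B t ∈ _root_.convexHull ℝ 𝓑) (hL : 0 < L)
    (hper : ∀ t, 0 ≤ t → z (t + L) = z t)
    (hcover : ∀ v, v ≠ 0 → ∃ t, 0 ≤ t ∧ ∃ r : ℝ, v = r • z t) :
    ∃ c : ℝ, 0 < c ∧ ∀ v, g v = c * f v := by
  obtain ⟨v₀, hv₀⟩ := exists_ne (0 : n → ℝ)
  obtain ⟨t₀, ht₀, r₀, hr₀⟩ := hcover v₀ hv₀
  have hzt₀ : z t₀ ≠ 0 := fun h => hv₀ (by rw [hr₀, h, smul_zero])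
  have hf₀ : 0 < f (z 0) := hf.const_of_periodic hz hB hL hper ht₀ ▸ seminorm_pos hfdef hzt₀
  have hg₀ : 0 < g (z 0) := hg.const_of_periodic hz hB hL hper ht₀ ▸ seminorm_pos hgdef hzt₀
  refine ⟨g (z 0) / f (z 0), by positivity, fun v => ?_⟩
  rcases eq_or_ne v 0 with rfl | hv
  · simp
  obtain ⟨t, ht, r, rfl⟩ := hcover v hv
  rw [map_smul_eq_mul, map_smul_eq_mul, hg.const_of_periodic hz hB hL hper ht,
    hf.const_of_periodic hz hB hL hper ht]
  field_simp

end Periodic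

section Barabanov

variable {𝒜 : Set Mat} {f : Seminorm ℝ Plane}

lemma isBddLaw_const {n : Type*} [Fintype n] (A : Matrix n n ℝ) : IsBddLaw fun _ => A :=
  ⟨fun _ _ => measurable_const, ‖toCLM A‖, fun _ _ => le_rfl⟩

lemma isTrajectory_expFlow {A : Mat} (hA : A ∈ 𝒜) (x : Plane) :
    IsTrajectory 𝒜 (fun t => expFlow A t x) :=
  ⟨fun _ => A, ⟨fun _ _ => measurable_const, fun _ _ => hA⟩,
    (isFlow_expFlow A x).isSolution (isBddLaw_const A)⟩

lemma IsBarabanovNorm.isInvariantFor (h : IsBarabanovNorm 𝒜 f) :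
    IsInvariantFor (shiftSet 𝒜 (lyapunovExponent 𝒜)) f := by
  have hrate : HasRate (shiftSet 𝒜 (lyapunovExponent 𝒜)) 0 f :=
    HasRate.shiftSet_iff.2 fun A hA t ht x => by
      simpa using h.growth_le _ (isTrajectory_expFlow hA x) t ht
  intro x B hB p hp
  simpa using hrate.subgrad_le hB hp

lemma IsFlow.isSwitchingLaw_and_isSolution {B : ℝ → Mat} {z : ℝ → Plane} (hz : IsFlow B z)
    (hc : IsCompact 𝒜) (hm : ∀ i j, Measurable fun t => B t i j) {s : ℝ}
    (hB : ∀ t, 0 ≤ t → B t ∈ convexHull ℝ (shiftSet 𝒜 s)) :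
    IsSwitchingLaw (convexHull ℝ 𝒜) (fun t => B t + s • (1 : Mat)) ∧
      IsSolution (fun t => B t + s • (1 : Mat)) (fun t => Real.exp (s * t) • z t) := by
  have hlaw : IsSwitchingLaw (convexHull ℝ 𝒜) (fun t => B t + s • (1 : Mat)) :=
    ⟨fun i j => (hm i j).add_const _, fun t ht => mem_convexHull_shiftSet.1 (hB t ht)⟩
  have hflow := hz.exp_smul (-s)
  simp only [neg_neg, neg_smul, sub_neg_eq_add] at hflow
  exact ⟨hlaw, hflow.isSolution (hlaw.isBddLaw hc)⟩

lemma IsFlow.isExtremalTrajectory {B : ℝ → Mat} {z : ℝ → Plane} (hz : IsFlow B z)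
    (hc : IsCompact 𝒜) (hm : ∀ i j, Measurable fun t => B t i j)
    (hB : ∀ t, 0 ≤ t → B t ∈ convexHull ℝ (shiftSet 𝒜 (lyapunovExponent 𝒜)))
    (hf : ∀ t, 0 ≤ t → f (z t) = f (z 0)) :
    IsExtremalTrajectory 𝒜 f (fun t => Real.exp (lyapunovExponent 𝒜 * t) • z t) := by
  refine ⟨⟨_, hz.isSwitchingLaw_and_isSolution hc hm hB⟩, fun t ht => ?_⟩
  simp only [seminorm_exp_smul, mul_zero, Real.exp_zero, hf t ht, one_smul]

end Barabanov

/-! ### Complex dominance -/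

lemma exists_eq_smul_of_area_eq_zero {x v : Plane} (hx : x ≠ 0) (h : area x v = 0) :
    ∃ c : ℝ, v = c • x := by
  have hnormal : area x ![-x 1, x 0] ≠ 0 := by
    intro hzero
    simp only [area, Matrix.cons_val_zero, Matrix.cons_val_one] at hzero
    refine hx (funext (Fin.forall_fin_two.2 ⟨?_, ?_⟩)) <;>
      simp only [Pi.zero_apply] <;> nlinarith [sq_nonneg (x 0), sq_nonneg (x 1)]
  refine ⟨area v ![-x 1, x 0] / area x ![-x 1, x 0], ?_⟩
  have hdecomp := area_smul_add_area_smul x ![-x 1, x 0] v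
  rw [h, zero_smul, add_zero] at hdecomp
  rw [div_eq_inv_mul, mul_smul, hdecomp, inv_smul_smul₀ hnormal]

section Rotation

variable {J : Mat} (hJ : J * J = -1)

include hJ

lemma area_mulVec_ne_zero {x : Plane} (hx : x ≠ 0) : area x (J *ᵥ x) ≠ 0 := by
  intro hzero
  obtain ⟨c, hcx⟩ := exists_eq_smul_of_area_eq_zero hx hzero
  have hsq : (c * c + 1) • x = 0 := by
    have hJJ := mulVec_mulVec_of_mul_self_eq_neg_one hJ x
    rw [hcx, Matrix.mulVec_smul, hcx, smul_smul] at hJJ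
    rw [add_smul, hJJ, one_smul, neg_add_cancel]
  exact hx ((smul_eq_zero.1 hsq).resolve_left
    (add_pos_of_nonneg_of_pos (mul_self_nonneg c) one_pos).ne')

lemma isFlow_rotation (b : ℝ) (x : Plane) :
    IsFlow (fun _ => b • J) (fun t => ellipse x (J *ᵥ x) (b * t)) := by
  simpa [ellipse] using isFlow_spiral hJ 0 b x

variable {𝓑 : Set Mat} {b : ℝ} (hb : 0 < b)

omit hJ in
include hb in
lemma ellipse_mul_add_period (u w : Plane) (t : ℝ) :
    ellipse u w (b * (t + 2 * Real.pi / b)) = ellipse u w (b * t) := by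
  rw [mul_add, mul_div_cancel₀ _ hb.ne', periodic_ellipse]

include hb

lemma IsInvariantFor.apply_rotation (hB : b • J ∈ _root_.convexHull ℝ 𝓑) {g : Seminorm ℝ Plane}
    (hg : IsInvariantFor 𝓑 g) (x : Plane) (θ : ℝ) : g (ellipse x (J *ᵥ x) θ) = g x := by
  obtain ⟨φ, hφ, hθφ⟩ := (periodic_ellipse x (J *ᵥ x)).exists_mem_Ico₀ Real.two_pi_pos θ
  have hconst := hg.const_of_periodic (isFlow_rotation hJ b x) (fun _ _ => hB)
    (div_pos Real.two_pi_pos hb) (fun t _ => ellipse_mul_add_period hb x _ t)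
    (div_nonneg hφ.1 hb.le)
  rwa [mul_div_cancel₀ _ hb.ne', mul_zero, ellipse_zero, ← hθφ] at hconst

lemma IsInvariantFor.exists_eq_mul_of_rotation (hB : b • J ∈ _root_.convexHull ℝ 𝓑)
    {f g : Seminorm ℝ Plane} (hf : IsInvariantFor 𝓑 f) (hfdef : ∀ v, f v = 0 → v = 0)
    (hg : IsInvariantFor 𝓑 g) (hgdef : ∀ v, g v = 0 → v = 0) :
    ∃ c : ℝ, 0 < c ∧ ∀ v, g v = c * f v := by
  obtain ⟨x, hx⟩ := exists_ne (0 : Plane)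
  refine hf.exists_eq_mul_of_periodic hfdef hg hgdef (isFlow_rotation hJ b x) (fun _ _ => hB)
    (div_pos Real.two_pi_pos hb) (fun t _ => ellipse_mul_add_period hb x _ t) fun v hv => ?_
  obtain ⟨r, -, θ, hθ, hvθ⟩ := exists_ellipse_polar (area_mulVec_ne_zero hJ hx) hv
  exact ⟨θ / b, div_nonneg hθ.1 hb.le, r, by rwa [mul_div_cancel₀ _ hb.ne']⟩

lemma IsInvariantFor.isC1ClosedCurve_of_rotation (hB : b • J ∈ _root_.convexHull ℝ 𝓑)
    {f : Seminorm ℝ Plane} (hf : IsInvariantFor 𝓑 f) (hdef : ∀ v, f v = 0 → v = 0) :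
    IsC1ClosedCurve (unitSphere f) := by
  obtain ⟨x, hx⟩ := exists_ne (0 : Plane)
  refine isC1ClosedCurve_unitSphere hdef (area_mulVec_ne_zero hJ hx) ?_
  simp only [hf.apply_rotation hJ hb hB]
  exact contDiff_const

lemma IsInvariantFor.isBarabanovNorm_of_rotation {𝒜 : Set Mat} (hc : IsCompact 𝒜)
    (hB : b • J ∈ _root_.convexHull ℝ (shiftSet 𝒜 (lyapunovExponent 𝒜))) {f : Seminorm ℝ Plane}
    (hf : IsInvariantFor (shiftSet 𝒜 (lyapunovExponent 𝒜)) f) (hdef : ∀ v, f v = 0 → v = 0) :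
    IsBarabanovNorm 𝒜 f := by
  have hgrowth : ∀ x, IsTrajectory 𝒜 x → ∀ t, 0 ≤ t →
      f (x t) ≤ Real.exp (lyapunovExponent 𝒜 * t) * f (x 0) :=
    fun x hx t ht => hf.apply_le_exp_mul hc hx.convexHull ht
  refine ⟨hdef, hgrowth, fun v => ⟨_, (isFlow_rotation hJ b v).isExtremalTrajectory hc
    (fun _ _ => measurable_const) (fun _ _ => hB) fun t _ => ?_, ?_⟩⟩
  · rw [hf.apply_rotation hJ hb hB, hf.apply_rotation hJ hb hB]
  · simp only [mul_zero, Real.exp_zero, ellipse_zero, one_smul]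

end Rotation

theorem HasComplexDominance.isBarabanovNorm {𝒜 : Set Mat} (hcomplex : HasComplexDominance 𝒜)
    (hc : IsCompact 𝒜) {f : Seminorm ℝ Plane} (hdef : ∀ v, f v = 0 → v = 0)
    (hinv : IsInvariantFor (shiftSet 𝒜 (lyapunovExponent 𝒜)) f) :
    IsBarabanovNorm 𝒜 f ∧
      (∀ g : Seminorm ℝ Plane, IsBarabanovNorm 𝒜 g → ∃ c : ℝ, 0 < c ∧ ∀ v, g v = c * f v) ∧
      IsC1ClosedCurve (unitSphere f) := by
  obtain ⟨J, b, hb, hJ, hB⟩ := hcomplex.exists_rotation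
  exact ⟨hinv.isBarabanovNorm_of_rotation hJ hb hc hB hdef,
    fun g hg => hinv.exists_eq_mul_of_rotation hJ hb hB hdef hg.isInvariantFor hg.definite,
    hinv.isC1ClosedCurve_of_rotation hJ hb hB hdef⟩

/-! ### Orientation of the tangential velocities -/

lemma isClosed_exists_mem_of_isCompact {X Y : Type*} [TopologicalSpace X] [TopologicalSpace Y]
    {K : Set X} (hK : IsCompact K) {C : Set (Y × X)} (hC : IsClosed C) :
    IsClosed {y | ∃ x ∈ K, (y, x) ∈ C} := by
  have : CompactSpace K := isCompact_iff_compactSpace.1 hK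
  have hclosed := isClosedMap_fst_of_compactSpace (Y := K) _ (hC.preimage
    (continuous_fst.prodMk (continuous_subtype_val.comp continuous_snd)))
  convert hclosed using 1
  ext y
  simp

section Ellipse

variable (u w : Plane)

lemma ellipse_add (θ φ : ℝ) : ellipse u w (θ + φ) =
    Real.cos φ • ellipse u w θ + Real.sin φ • ellipse u w (θ + Real.pi / 2) := by
  rw [ellipse_add_pi_div_two, ellipse, ellipse, Real.cos_add, Real.sin_add]
  module

lemma ellipse_neg_right (θ : ℝ) : ellipse u (-w) θ = ellipse u w (-θ) := by
  simp [ellipse]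

/-- The angular velocity of the vector field `x ↦ B x` at `x`, in the frame `(u, w)`: if
`x = r • ellipse u w θ` moves along the field, this is the derivative of `θ`. -/
noncomputable def angRate (B : Mat) (x : Plane) : ℝ := area x (B *ᵥ x) / area u w

lemma angRate_neg_right (B : Mat) (x : Plane) : angRate u (-w) B x = -angRate u w B x := by
  have harea : area u (-w) = -area u w := by simpa using area_smul_right (-1) u w
  rw [angRate, angRate, harea, div_neg]

lemma isLinearMap_angRate (x : Plane) : IsLinearMap ℝ fun B => angRate u w B x where
  map_add A B := by rw [angRate, angRate, angRate, Matrix.add_mulVec, area_add_right, add_div]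
  map_smul a B := by rw [angRate, angRate, Matrix.smul_mulVec, area_smul_right, mul_div_assoc,
    smul_eq_mul]

lemma continuous_angRate_ellipse :
    Continuous fun q : ℝ × Mat => angRate u w q.2 (ellipse u w q.1) := by
  have hcoord : ∀ i, Continuous fun θ => ellipse u w θ i := fun i =>
    (continuous_apply i).comp (continuous_ellipse u w)
  simp only [angRate, area, Matrix.mulVec, dotProduct]
  fun_prop

variable {u w}

lemma mulVec_ellipse (h : area u w ≠ 0) (B : Mat) (θ : ℝ) : ∃ r : ℝ, B *ᵥ ellipse u w θ =
    r • ellipse u w θ + angRate u w B (ellipse u w θ) • ellipse u w (θ + Real.pi / 2) := by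
  have hframe := area_smul_add_area_smul (ellipse u w θ) (ellipse u w (θ + Real.pi / 2))
    (B *ᵥ ellipse u w θ)
  rw [area_ellipse_add_pi_div_two, ← inv_smul_eq_iff₀ h, smul_add, smul_smul, smul_smul,
    ← div_eq_inv_mul, ← div_eq_inv_mul] at hframe
  exact ⟨_, hframe.symm⟩

end Ellipse

lemma isLinearMap_pairing {n : Type*} [Fintype n] (p x : n → ℝ) :
    IsLinearMap ℝ fun B : Matrix n n ℝ => p ⬝ᵥ (B *ᵥ x) where
  map_add A B := by rw [Matrix.add_mulVec, dotProduct_add]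
  map_smul a B := by rw [Matrix.smul_mulVec, dotProduct_smul]

/-- Some matrix of `𝓑` gives at `ellipse u w θ` a velocity which is tangent to the sphere of `f`
and does not point towards decreasing `θ`. -/
def IsForward (𝓑 : Set Mat) (f : Seminorm ℝ Plane) (u w : Plane) (θ : ℝ) : Prop :=
  ∃ p ∈ Subgrad f (ellipse u w θ), ∃ B ∈ 𝓑, p ⬝ᵥ (B *ᵥ ellipse u w θ) = 0 ∧
    0 ≤ angRate u w B (ellipse u w θ)

/-- Some matrix of `𝓑` gives at `ellipse u w θ` a velocity which is tangent to the sphere of `f`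
and does not point towards increasing `θ`. -/
def IsBackward (𝓑 : Set Mat) (f : Seminorm ℝ Plane) (u w : Plane) (θ : ℝ) : Prop :=
  ∃ p ∈ Subgrad f (ellipse u w θ), ∃ B ∈ 𝓑, p ⬝ᵥ (B *ᵥ ellipse u w θ) = 0 ∧
    angRate u w B (ellipse u w θ) ≤ 0

section Tangent

variable {𝓑 : Set Mat} {f : Seminorm ℝ Plane} {u w : Plane} {θ : ℝ} {p p' : Plane} {B : Mat}

lemma isForward_neg_right_iff : IsForward 𝓑 f u (-w) θ ↔ IsBackward 𝓑 f u w (-θ) := by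
  simp only [IsForward, IsBackward, ellipse_neg_right, angRate_neg_right, Left.nonneg_neg_iff]

lemma isBackward_neg_right_iff : IsBackward 𝓑 f u (-w) θ ↔ IsForward 𝓑 f u w (-θ) := by
  rw [← neg_neg w, isForward_neg_right_iff, neg_neg, neg_neg]

lemma isBackward_add_two_pi : IsBackward 𝓑 f u w (θ + 2 * Real.pi) ↔ IsBackward 𝓑 f u w θ := by
  rw [IsBackward, IsBackward, periodic_ellipse]

/-- Subgradients of a convex function are monotone along the ellipse. -/
lemma sin_mul_pairing_sub_nonneg {θ' : ℝ} (hp : p ∈ Subgrad f (ellipse u w θ))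
    (hp' : p' ∈ Subgrad f (ellipse u w θ')) (hcos : 0 ≤ Real.cos (θ' - θ)) :
    0 ≤ Real.sin (θ' - θ) *
      (p' ⬝ᵥ ellipse u w (θ + Real.pi / 2) - p ⬝ᵥ ellipse u w (θ + Real.pi / 2)) := by
  have hdecomp : ∀ q : Plane, q ⬝ᵥ ellipse u w θ' = Real.cos (θ' - θ) * (q ⬝ᵥ ellipse u w θ) +
      Real.sin (θ' - θ) * (q ⬝ᵥ ellipse u w (θ + Real.pi / 2)) := fun q => by
    rw [← add_sub_cancel θ θ', ellipse_add, dotProduct_add, dotProduct_smul, dotProduct_smul,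
      add_sub_cancel, smul_eq_mul, smul_eq_mul]
  have hp_le := hp.2 (ellipse u w θ')
  have hp'_le := mul_le_mul_of_nonneg_left (hp'.2 (ellipse u w θ)) hcos
  rw [hdecomp, hp.1] at hp_le
  rw [← hp'.1, hdecomp] at hp_le
  linarith

lemma angRate_mul_pairing_sub_nonneg (hinv : IsInvariantFor 𝓑 f) (h : area u w ≠ 0)
    (hp : p ∈ Subgrad f (ellipse u w θ)) (hp' : p' ∈ Subgrad f (ellipse u w θ)) (hB : B ∈ 𝓑)
    (htan : p' ⬝ᵥ (B *ᵥ ellipse u w θ) = 0) :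
    0 ≤ angRate u w B (ellipse u w θ) *
      (p' ⬝ᵥ ellipse u w (θ + Real.pi / 2) - p ⬝ᵥ ellipse u w (θ + Real.pi / 2)) := by
  obtain ⟨r, hr⟩ := mulVec_ellipse h B θ
  have hle := hinv _ B hB p hp
  rw [hr, dotProduct_add, dotProduct_smul, dotProduct_smul, smul_eq_mul, smul_eq_mul] at htan hle
  rw [hp.1] at hle
  rw [hp'.1] at htan
  linarith

lemma isClosed_exists_subgrad (hc : IsCompact 𝓑) {C : Set (ℝ × Plane × Mat)} (hC : IsClosed C) :
    IsClosed {θ | ∃ p ∈ Subgrad f (ellipse u w θ), ∃ B ∈ 𝓑, (θ, p, B) ∈ C} := by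
  have hgraph : IsClosed {q : ℝ × Plane × Mat | q.2.1 ∈ Subgrad f (ellipse u w q.1)} :=
    (isClosed_subgrad f).preimage (((continuous_ellipse u w).comp continuous_fst).prodMk
      (continuous_fst.comp continuous_snd))
  convert isClosed_exists_mem_of_isCompact
    ((isCompact_closedBall (0 : Plane) (basisSum f)).prod hc) (hgraph.inter hC) using 1
  ext θ
  constructor
  · rintro ⟨p, hp, B, hB, hmem⟩
    exact ⟨(p, B), ⟨subgrad_subset_closedBall f _ hp, hB⟩, hp, hmem⟩
  · rintro ⟨⟨p, B⟩, ⟨-, hB⟩, hp, hmem⟩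
    exact ⟨p, hp, B, hB, hmem⟩

variable (u w) in
lemma continuous_pairing_ellipse :
    Continuous fun q : ℝ × Plane × Mat => q.2.1 ⬝ᵥ (q.2.2 *ᵥ ellipse u w q.1) :=
  continuous_pairing.comp (((continuous_ellipse u w).comp continuous_fst).prodMk continuous_snd)

variable (u w) in
lemma isClosed_tangent :
    IsClosed {q : ℝ × Plane × Mat | q.2.1 ⬝ᵥ (q.2.2 *ᵥ ellipse u w q.1) = 0} :=
  isClosed_eq (continuous_pairing_ellipse u w) continuous_const

variable (u w) in
lemma isClosed_tangent_and_angRate_nonpos :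
    IsClosed {q : ℝ × Plane × Mat | q.2.1 ⬝ᵥ (q.2.2 *ᵥ ellipse u w q.1) = 0 ∧
      angRate u w q.2.2 (ellipse u w q.1) ≤ 0} :=
  (isClosed_tangent u w).inter (isClosed_le ((continuous_angRate_ellipse u w).comp
    (continuous_fst.prodMk (continuous_snd.comp continuous_snd))) continuous_const)

lemma continuous_snd_fst_dotProduct (v : Plane) :
    Continuous fun q : ℝ × Plane × Mat => q.2.1 ⬝ᵥ v := by
  simp only [dotProduct]; fun_prop

lemma isClosed_isBackward (hc : IsCompact 𝓑) : IsClosed {θ | IsBackward 𝓑 f u w θ} :=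
  isClosed_exists_subgrad hc (isClosed_tangent_and_angRate_nonpos u w)

lemma isClosed_isForward (hc : IsCompact 𝓑) : IsClosed {θ | IsForward 𝓑 f u w θ} := by
  convert (isClosed_isBackward (f := f) (u := u) (w := -w) hc).preimage continuous_neg using 1
  ext θ
  simp only [mem_preimage, mem_ofPred_eq, isBackward_neg_right_iff, neg_neg]

section Corner

variable (hdef : ∀ v, f v = 0 → v = 0) (h : area u w ≠ 0)
  (hne : ∀ B ∈ convexHull ℝ 𝓑, ∀ x, x ≠ 0 → B *ᵥ x ≠ 0)

include hdef h hne

lemma angRate_ne_zero (hp : p ∈ Subgrad f (ellipse u w θ)) (hB : B ∈ convexHull ℝ 𝓑)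
    (htan : p ⬝ᵥ (B *ᵥ ellipse u w θ) = 0) : angRate u w B (ellipse u w θ) ≠ 0 := by
  intro hrate
  obtain ⟨r, hr⟩ := mulVec_ellipse h B θ
  rw [hrate, zero_smul, add_zero] at hr
  rw [hr, dotProduct_smul, hp.1, smul_eq_mul] at htan
  rw [(mul_eq_zero.1 htan).resolve_right (seminorm_ellipse_pos hdef h θ).ne', zero_smul] at hr
  exact hne B hB _ (ellipse_ne_zero h θ) hr

/-- If one subgradient had tangent velocities of both orientations, then so would a convex
combination with vanishing angular velocity. -/
lemma not_angRate_pos_and_neg (hp : p ∈ Subgrad f (ellipse u w θ)) {B₁ B₂ : Mat} (hB₁ : B₁ ∈ 𝓑)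
    (hB₂ : B₂ ∈ 𝓑) (htan₁ : p ⬝ᵥ (B₁ *ᵥ ellipse u w θ) = 0)
    (htan₂ : p ⬝ᵥ (B₂ *ᵥ ellipse u w θ) = 0) (hpos : 0 < angRate u w B₁ (ellipse u w θ)) :
    ¬ angRate u w B₂ (ellipse u w θ) < 0 := by
  intro hneg
  set a₁ := angRate u w B₁ (ellipse u w θ) with ha₁
  set a₂ := angRate u w B₂ (ellipse u w θ) with ha₂
  have hsub : 0 < a₁ - a₂ := by linarith
  have hmem : (-a₂ / (a₁ - a₂)) • B₁ + (a₁ / (a₁ - a₂)) • B₂ ∈ convexHull ℝ 𝓑 := by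
    refine convex_convexHull ℝ 𝓑 (subset_convexHull ℝ 𝓑 hB₁) (subset_convexHull ℝ 𝓑 hB₂)
      (div_nonneg (by linarith) hsub.le) (div_nonneg hpos.le hsub.le) ?_
    rw [← add_div, neg_add_eq_sub, div_self hsub.ne']
  have hpairing := isLinearMap_pairing p (ellipse u w θ)
  have hangRate := isLinearMap_angRate u w (ellipse u w θ)
  refine angRate_ne_zero hdef h hne hp hmem ?_ ?_
  · rw [hpairing.map_add, hpairing.map_smul, hpairing.map_smul, htan₁, htan₂, smul_zero,
      smul_zero, add_zero]
  · rw [hangRate.map_add, hangRate.map_smul, hangRate.map_smul, ← ha₁, ← ha₂, smul_eq_mul,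
      smul_eq_mul]
    ring

variable (hinv : IsInvariantFor 𝓑 f)

include hinv

lemma pairing_lt_of_forward_of_backward {B' : Mat} (hp : p ∈ Subgrad f (ellipse u w θ))
    (hB : B ∈ 𝓑) (htan : p ⬝ᵥ (B *ᵥ ellipse u w θ) = 0)
    (hforward : 0 ≤ angRate u w B (ellipse u w θ)) (hp' : p' ∈ Subgrad f (ellipse u w θ))
    (hB' : B' ∈ 𝓑) (htan' : p' ⬝ᵥ (B' *ᵥ ellipse u w θ) = 0)
    (hbackward : angRate u w B' (ellipse u w θ) ≤ 0) :
    p' ⬝ᵥ ellipse u w (θ + Real.pi / 2) < p ⬝ᵥ ellipse u w (θ + Real.pi / 2) := by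
  have hpos := hforward.lt_of_ne'
    (angRate_ne_zero hdef h hne hp (subset_convexHull ℝ 𝓑 hB) htan)
  have hneg := hbackward.lt_of_ne
    (angRate_ne_zero hdef h hne hp' (subset_convexHull ℝ 𝓑 hB') htan')
  have hle := nonneg_of_mul_nonneg_right (angRate_mul_pairing_sub_nonneg hinv h hp' hp hB htan) hpos
  refine lt_of_le_of_ne (sub_nonneg.1 hle) fun heq => ?_
  refine not_angRate_pos_and_neg hdef h hne hp hB hB' htan ?_ hpos hneg
  obtain ⟨r, hr⟩ := mulVec_ellipse h B' θ
  rw [← htan', hr, dotProduct_add, dotProduct_add, dotProduct_smul, dotProduct_smul,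
    dotProduct_smul, dotProduct_smul, heq, hp.1, hp'.1]

variable (hc : IsCompact 𝓑)

include hc

lemma IsForward.eventually_not_isBackward (hforward : IsForward 𝓑 f u w θ) :
    ∀ᶠ θ' in 𝓝[>] θ, ¬ IsBackward 𝓑 f u w θ' := by
  obtain ⟨p, hp, B, hB, htan, hrate⟩ := hforward
  have hclosed := isClosed_exists_subgrad (f := f) (u := u) (w := w) hc
    ((isClosed_tangent_and_angRate_nonpos u w).inter
      (isClosed_le (continuous_const (y := p ⬝ᵥ ellipse u w (θ + Real.pi / 2)))
        (continuous_snd_fst_dotProduct (ellipse u w (θ + Real.pi / 2)))))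
  have hnhds := hclosed.isOpen_compl.mem_nhds (x := θ) (by
    rintro ⟨q, hq, B', hB', ⟨htan', hrate'⟩, hle⟩
    exact not_lt_of_ge hle (pairing_lt_of_forward_of_backward hdef h hne hinv hp hB htan hrate
      hq hB' htan' hrate'))
  filter_upwards [mem_nhdsWithin_of_mem_nhds hnhds, Ioc_mem_nhdsGT (lt_add_one θ)]
    with θ' hθ' hIoc hbackward
  obtain ⟨q, hq, B', hB', htan', hrate'⟩ := hbackward
  refine hθ' ⟨q, hq, B', hB', ⟨htan', hrate'⟩, ?_⟩
  have hcos : 0 ≤ Real.cos (θ' - θ) :=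
    Real.cos_nonneg_of_mem_Icc ⟨by linarith [hIoc.1, Real.pi_pos],
      by linarith [hIoc.2, Real.pi_gt_three]⟩
  have hsin : 0 < Real.sin (θ' - θ) := Real.sin_pos_of_pos_of_lt_pi (by linarith [hIoc.1])
    (by linarith [hIoc.2, Real.pi_gt_three])
  exact sub_nonneg.1 (nonneg_of_mul_nonneg_right (sin_mul_pairing_sub_nonneg hp hq hcos) hsin)

lemma IsBackward.eventually_not_isForward (hbackward : IsBackward 𝓑 f u w θ) :
    ∀ᶠ θ' in 𝓝[<] θ, ¬ IsForward 𝓑 f u w θ' := by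
  have hreflect : IsForward 𝓑 f u (-w) (-θ) := by rwa [isForward_neg_right_iff, neg_neg]
  have harea : area u (-w) ≠ 0 := by
    rw [← neg_one_smul ℝ w, area_smul_right]
    exact mul_ne_zero (neg_ne_zero.2 one_ne_zero) h
  have htendsto : Tendsto Neg.neg (𝓝[<] θ) (𝓝[>] (-θ)) := tendsto_neg_nhdsLT
  filter_upwards [htendsto.eventually
    (hreflect.eventually_not_isBackward hdef harea hne hinv hc)] with θ' hθ'
  rwa [isBackward_neg_right_iff, neg_neg] at hθ'

variable (hext : ∀ θ, IsForward 𝓑 f u w θ ∨ IsBackward 𝓑 f u w θ)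

include hext

/-- A forward direction would push forwardness all the way around, up to the left of the same
direction one turn later. -/
lemma not_isForward_and_isBackward (θ : ℝ) :
    ¬ (IsForward 𝓑 f u w θ ∧ IsBackward 𝓑 f u w θ) := by
  rintro ⟨hforward, hbackward⟩
  have hlt : θ < θ + 2 * Real.pi := by linarith [Real.pi_pos]
  have hall : Icc θ (θ + 2 * Real.pi) ⊆ {θ | IsForward 𝓑 f u w θ} := by
    refine ((isClosed_isForward hc).inter isClosed_Icc).Icc_subset_of_forall_mem_nhdsWithin
      hforward fun θ' hθ' => ?_
    filter_upwards [IsForward.eventually_not_isBackward hdef h hne hinv hc hθ'.1] with θ'' hθ''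
    exact (hext θ'').resolve_right hθ''
  have hleft := (isBackward_add_two_pi.2 hbackward).eventually_not_isForward hdef h hne hinv hc
  obtain ⟨θ', hnot, hIco⟩ := (hleft.and (Ico_mem_nhdsLT hlt)).exists
  exact hnot (hall ⟨hIco.1, hIco.2.le⟩)

lemma forall_not_isBackward_or_forall_not_isForward :
    (∀ θ, ¬ IsBackward 𝓑 f u w θ) ∨ (∀ θ, ¬ IsForward 𝓑 f u w θ) := by
  by_contra! hcon
  obtain ⟨⟨θ₁, hθ₁⟩, θ₂, hθ₂⟩ := hcon
  obtain ⟨θ, -, hboth⟩ := isPreconnected_closed_iff.1 isPreconnected_univ _ _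
    (isClosed_isForward hc) (isClosed_isBackward hc) (fun θ _ => hext θ)
    ⟨θ₂, mem_univ _, hθ₂⟩ ⟨θ₁, mem_univ _, hθ₁⟩
  exact not_isForward_and_isBackward hdef h hne hinv hc hext θ hboth

end Corner

end Tangent

/-- `f` is a norm that does not increase along the velocities from the compact set `𝓑`, at every
point some of these velocities are tangent to the sphere of `f`, and in the frame `(u, w)` all
tangent velocities point towards increasing angles. -/
structure IsOriented (𝓑 : Set Mat) (f : Seminorm ℝ Plane) (u w : Plane) : Prop where
  isCompact : IsCompact 𝓑
  definite : ∀ v, f v = 0 → v = 0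
  isInvariantFor : IsInvariantFor 𝓑 f
  exists_tangent : ∀ x, ∃ B ∈ 𝓑, ∃ p ∈ Subgrad f x, p ⬝ᵥ (B *ᵥ x) = 0
  area_ne_zero : area u w ≠ 0
  not_isBackward : ∀ θ, ¬ IsBackward 𝓑 f u w θ

theorem exists_isOriented {𝓑 : Set Mat} {f : Seminorm ℝ Plane} (hc : IsCompact 𝓑)
    (hdef : ∀ v, f v = 0 → v = 0) (hinv : IsInvariantFor 𝓑 f)
    (hext : ∀ x, ∃ B ∈ 𝓑, ∃ p ∈ Subgrad f x, p ⬝ᵥ (B *ᵥ x) = 0)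
    (hne : ∀ B ∈ convexHull ℝ 𝓑, ∀ x, x ≠ 0 → B *ᵥ x ≠ 0) : ∃ u w, IsOriented 𝓑 f u w := by
  have hframe : area ![1, 0] ![0, 1] ≠ 0 := by simp [area]
  have hcases : ∀ θ, IsForward 𝓑 f ![1, 0] ![0, 1] θ ∨ IsBackward 𝓑 f ![1, 0] ![0, 1] θ := by
    intro θ
    obtain ⟨B, hB, p, hp, htan⟩ := hext (ellipse ![1, 0] ![0, 1] θ)
    exact (le_total 0 (angRate _ _ B (ellipse _ _ θ))).imp (fun h => ⟨p, hp, B, hB, htan, h⟩)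
      fun h => ⟨p, hp, B, hB, htan, h⟩
  rcases forall_not_isBackward_or_forall_not_isForward hdef hframe hne hinv hc hcases with h | h
  · exact ⟨_, _, hc, hdef, hinv, hext, hframe, h⟩
  · exact ⟨![1, 0], -![0, 1], hc, hdef, hinv, hext, by simp [area], fun θ hθ =>
      h (-θ) (isBackward_neg_right_iff.1 hθ)⟩

/-! ### Smoothness of the unit sphere -/

section Gradient

variable {n : Type*} [Fintype n] {f : Seminorm ℝ (n → ℝ)} {z p : ℝ → n → ℝ}

lemma continuous_of_subgrad_unique (hz : Continuous z) (hp : ∀ t, p t ∈ Subgrad f (z t))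
    (hunique : ∀ t, ∀ q ∈ Subgrad f (z t), q = p t) : Continuous p := by
  refine continuous_iff_isClosed.2 fun V hV => ?_
  convert isClosed_exists_mem_of_isCompact (isCompact_closedBall (0 : n → ℝ) (basisSum f))
    (((isClosed_subgrad f).preimage (hz.prodMap continuous_id)).inter
      (hV.preimage continuous_snd)) using 1
  ext t
  constructor
  · exact fun ht => ⟨p t, subgrad_subset_closedBall f _ (hp t), hp t, ht⟩
  · rintro ⟨q, -, hq, hqV⟩
    exact mem_preimage.2 (hunique t q hq ▸ hqV)

lemma hasDerivAt_seminorm_of_continuousAt_subgrad {z' : n → ℝ} {t : ℝ} (hz : HasDerivAt z z' t)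
    (hp : ∀ s, p s ∈ Subgrad f (z s)) (hcont : ContinuousAt p t) :
    HasDerivAt (fun s => f (z s)) (p t ⬝ᵥ z') t := by
  have hsmall : (fun s => (p s - p t) ⬝ᵥ (z s - z t)) =o[𝓝 t] fun s => s - t := by
    have hcoord : ∀ i, (fun s => (p s - p t) i * (z s - z t) i) =o[𝓝 t] fun s => s - t := by
      intro i
      have hpi : (fun s => (p s - p t) i) =o[𝓝 t] fun _ => (1 : ℝ) :=
        (Asymptotics.isLittleO_one_iff ℝ).2
          (tendsto_sub_nhds_zero_iff.2 (tendsto_pi_nhds.1 hcont i))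
      simpa using hpi.mul_isBigO (hasDerivAt_pi.1 hz i).isBigO_sub
    exact Asymptotics.IsLittleO.fun_sum fun i _ => hcoord i
  have hremainder : HasDerivAt (fun s => f (z s) - p t ⬝ᵥ z s) 0 t := by
    refine hasDerivAt_iff_isLittleO.2 ((Asymptotics.isBigO_of_le _ fun s => ?_).trans_isLittleO
      hsmall)
    have hlow := (hp t).2 (z s)
    have hupp := (hp s).2 (z t)
    have hs := (hp s).1
    have ht := (hp t).1
    simp only [sub_dotProduct, dotProduct_sub, smul_zero, Real.norm_eq_abs]
    refine abs_le_abs_of_nonneg ?_ ?_ <;> linarith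
  exact ((hremainder.fun_add (hasDerivAt_dotProduct hz (p t))).congr_deriv
    (zero_add _)).congr_of_eventuallyEq (.of_forall fun s => (sub_add_cancel _ _).symm)

end Gradient

lemma exists_pos_add_mul_le_of_isCompact {X : Type*} [TopologicalSpace X] {K : Set X}
    (hK : IsCompact K) {φ g : X → ℝ} (hφ : Continuous φ) (hg : Continuous g)
    (hnonpos : ∀ x ∈ K, g x ≤ 0) (hpos : ∀ x ∈ K, g x = 0 → 0 < φ x) :
    ∃ c > 0, ∃ M ≥ 0, ∀ x ∈ K, c + M * g x ≤ φ x := by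
  have hmono : Monotone fun k : ℕ => {x | 0 < φ x + k * |g x|} := fun k l hkl x hx =>
    lt_of_lt_of_le hx (add_le_add_right
      (mul_le_mul_of_nonneg_right (Nat.cast_le.2 hkl) (abs_nonneg (g x))) (φ x))
  have hcover : K ⊆ ⋃ k : ℕ, {x | 0 < φ x + k * |g x|} := by
    intro x hx
    rw [mem_iUnion]
    rcases eq_or_ne (g x) 0 with hzero | hne
    · exact ⟨0, by simpa using hpos x hx hzero⟩
    · obtain ⟨k, hk⟩ := exists_nat_gt (-φ x / |g x|)
      rw [div_lt_iff₀ (abs_pos.2 hne)] at hk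
      exact ⟨k, by rw [mem_ofPred_eq]; linarith⟩
  obtain ⟨k, hk⟩ := hK.elim_directed_cover _
    (fun k => isOpen_lt continuous_const (hφ.add (continuous_const.mul hg.abs))) hcover
    hmono.directed_le
  rcases K.eq_empty_or_nonempty with rfl | hne
  · exact ⟨1, one_pos, 0, le_rfl, by simp⟩
  obtain ⟨x₀, hx₀, hmin⟩ := hK.exists_isMinOn hne
    (hφ.add (continuous_const.mul hg.abs) : Continuous fun x => φ x + k * |g x|).continuousOn
  refine ⟨φ x₀ + k * |g x₀|, hk hx₀, k, k.cast_nonneg, fun x hx => ?_⟩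
  have hle : φ x₀ + k * |g x₀| ≤ φ x + k * |g x| := isMinOn_iff.1 hmin x hx
  rw [abs_of_nonpos (hnonpos x hx)] at hle
  linarith

lemma exists_abs_angRate_le {𝓑 : Set Mat} (hc : IsCompact 𝓑) (u w : Plane) :
    ∃ C > 0, ∀ θ, ∀ B ∈ convexHull ℝ 𝓑, |angRate u w B (ellipse u w θ)| ≤ C := by
  obtain ⟨M, hM, hbound⟩ := exists_norm_toCLM_le_convexHull hc
  refine ⟨2 * ((‖u‖ + ‖w‖) * (M * (‖u‖ + ‖w‖))) / |area u w| + 1, by positivity,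
    fun θ B hB => ?_⟩
  rw [angRate, abs_div]
  refine le_add_of_le_of_nonneg (div_le_div_of_nonneg_right ?_ (abs_nonneg _)) zero_le_one
  refine (abs_area_le _ _).trans ?_
  have hnorm := norm_ellipse_le u w θ
  gcongr
  exact (norm_mulVec_le (hbound B hB) _).trans (by gcongr)

lemma eq_of_dotProduct_eq_dotProduct {x y p q : Plane} (h : area x y ≠ 0)
    (hx : p ⬝ᵥ x = q ⬝ᵥ x) (hy : p ⬝ᵥ y = q ⬝ᵥ y) : p = q := by
  refine dotProduct_eq _ _ fun v => ?_
  have hframe := area_smul_add_area_smul x y v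
  refine mul_left_cancel₀ h ?_
  rw [← smul_eq_mul, ← smul_eq_mul, ← dotProduct_smul, ← dotProduct_smul, ← hframe]
  simp only [dotProduct_add, dotProduct_smul, hx, hy]

/-- A choice of a subgradient of `f` at the point of the ellipse with parameter `θ`. -/
noncomputable def supportCovector (f : Seminorm ℝ Plane) (u w : Plane) (θ : ℝ) : Plane :=
  (subgrad_nonempty f (ellipse u w θ)).some

lemma supportCovector_mem (f : Seminorm ℝ Plane) (u w : Plane) (θ : ℝ) :
    supportCovector f u w θ ∈ Subgrad f (ellipse u w θ) :=
  (subgrad_nonempty f (ellipse u w θ)).some_mem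

namespace IsOriented

variable {𝓑 : Set Mat} {f : Seminorm ℝ Plane} {u w : Plane} {θ : ℝ} {p p' : Plane} {B : Mat}
  (h : IsOriented 𝓑 f u w)

include h

lemma angRate_pos (hp : p ∈ Subgrad f (ellipse u w θ)) (hB : B ∈ 𝓑)
    (htan : p ⬝ᵥ (B *ᵥ ellipse u w θ) = 0) : 0 < angRate u w B (ellipse u w θ) := by
  by_contra! hle
  exact h.not_isBackward θ ⟨p, hp, B, hB, htan, hle⟩

/-- Limits from the left of subgradients with a tangent velocity are the greatest subgradients,
because this velocity is forward, and the least ones, by monotonicity. -/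
lemma pairing_le (hp : p ∈ Subgrad f (ellipse u w θ)) (hp' : p' ∈ Subgrad f (ellipse u w θ)) :
    p ⬝ᵥ ellipse u w (θ + Real.pi / 2) ≤ p' ⬝ᵥ ellipse u w (θ + Real.pi / 2) := by
  by_contra! hlt
  have hclosed := isClosed_exists_subgrad (f := f) (u := u) (w := w) h.isCompact
    ((isClosed_tangent u w).inter
      (isClosed_le (continuous_snd_fst_dotProduct (ellipse u w (θ + Real.pi / 2)))
        (continuous_const (y := p' ⬝ᵥ ellipse u w (θ + Real.pi / 2)))))
  have hnhds := hclosed.isOpen_compl.mem_nhds (x := θ) (by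
    rintro ⟨q, hq, B, hB, htan, hle⟩
    have hmax := nonneg_of_mul_nonneg_right
      (angRate_mul_pairing_sub_nonneg h.isInvariantFor h.area_ne_zero hp hq hB htan)
      (h.angRate_pos hq hB htan)
    exact hlt.not_ge ((sub_nonneg.1 hmax).trans hle))
  obtain ⟨θ', hθ', hIco⟩ := (𝓝[<] θ).nonempty_of_mem
    (inter_mem (mem_nhdsWithin_of_mem_nhds hnhds) (Ico_mem_nhdsLT (sub_one_lt θ)))
  obtain ⟨B, hB, q, hq, htan⟩ := h.exists_tangent (ellipse u w θ')
  refine hθ' ⟨q, hq, B, hB, htan, ?_⟩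
  have hcos : 0 ≤ Real.cos (θ' - θ) := Real.cos_nonneg_of_mem_Icc
    ⟨by linarith [hIco.1, Real.pi_gt_three], by linarith [hIco.2, Real.pi_pos]⟩
  have hsin : Real.sin (θ' - θ) < 0 := Real.sin_neg_of_neg_of_neg_pi_lt (by linarith [hIco.2])
    (by linarith [hIco.1, Real.pi_gt_three])
  exact sub_nonpos.1 (nonpos_of_mul_nonneg_right (sin_mul_pairing_sub_nonneg hp' hq hcos) hsin)

lemma subgrad_unique (hp : p ∈ Subgrad f (ellipse u w θ)) (hp' : p' ∈ Subgrad f (ellipse u w θ)) :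
    p = p' := by
  have hframe : area (ellipse u w θ) (ellipse u w (θ + Real.pi / 2)) ≠ 0 := by
    rw [area_ellipse_add_pi_div_two]
    exact h.area_ne_zero
  exact eq_of_dotProduct_eq_dotProduct hframe (hp.1.trans hp'.1.symm)
    ((h.pairing_le hp hp').antisymm (h.pairing_le hp' hp))

lemma exists_supportCovector_tangent (θ : ℝ) :
    ∃ B ∈ 𝓑, supportCovector f u w θ ⬝ᵥ (B *ᵥ ellipse u w θ) = 0 := by
  obtain ⟨B, hB, p, hp, htan⟩ := h.exists_tangent (ellipse u w θ)
  exact ⟨B, hB, by rwa [h.subgrad_unique (supportCovector_mem f u w θ) hp]⟩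

lemma continuous_supportCovector : Continuous (supportCovector f u w) :=
  continuous_of_subgrad_unique (continuous_ellipse u w) (supportCovector_mem f u w)
    fun θ _ hq => h.subgrad_unique hq (supportCovector_mem f u w θ)

lemma hasDerivAt_seminorm_ellipse (θ : ℝ) : HasDerivAt (fun θ => f (ellipse u w θ))
    (supportCovector f u w θ ⬝ᵥ ellipse u w (θ + Real.pi / 2)) θ :=
  hasDerivAt_seminorm_of_continuousAt_subgrad (hasDerivAt_ellipse u w θ)
    (supportCovector_mem f u w) h.continuous_supportCovector.continuousAt

lemma contDiff_seminorm_ellipse : ContDiff ℝ 1 fun θ => f (ellipse u w θ) := by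
  rw [contDiff_one_iff_deriv]
  refine ⟨fun θ => (h.hasDerivAt_seminorm_ellipse θ).differentiableAt, ?_⟩
  rw [funext fun θ => (h.hasDerivAt_seminorm_ellipse θ).deriv]
  exact h.continuous_supportCovector.dotProduct
    ((continuous_ellipse u w).comp (continuous_add_const _))

lemma hasDerivAt_sphereCurve (htan : supportCovector f u w θ ⬝ᵥ (B *ᵥ ellipse u w θ) = 0)
    (hrate : angRate u w B (ellipse u w θ) ≠ 0) :
    HasDerivAt (sphereCurve f u w)
      ((angRate u w B (ellipse u w θ))⁻¹ • (B *ᵥ sphereCurve f u w θ)) θ := by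
  have hpos := seminorm_ellipse_pos h.definite h.area_ne_zero θ
  obtain ⟨r, hr⟩ := mulVec_ellipse h.area_ne_zero B θ
  rw [hr, dotProduct_add, dotProduct_smul, dotProduct_smul, (supportCovector_mem f u w θ).1,
    smul_eq_mul, smul_eq_mul] at htan
  refine (((h.hasDerivAt_seminorm_ellipse θ).inv hpos.ne').smul
    (hasDerivAt_ellipse u w θ)).congr_deriv ?_
  rw [sphereCurve, Matrix.mulVec_smul, hr]
  generalize angRate u w B (ellipse u w θ) = ω at *
  have hslope : supportCovector f u w θ ⬝ᵥ ellipse u w (θ + Real.pi / 2) =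
      -(r * f (ellipse u w θ)) / ω := by
    rw [eq_div_iff hrate]; linarith
  rw [hslope, Pi.inv_apply]
  match_scalars <;> field_simp

lemma continuous_supportCovector_pairing :
    Continuous fun q : ℝ × Mat => supportCovector f u w q.1 ⬝ᵥ (q.2 *ᵥ ellipse u w q.1) :=
  continuous_pairing.comp (((continuous_ellipse u w).comp continuous_fst).prodMk
    ((h.continuous_supportCovector.comp continuous_fst).prodMk continuous_snd))

lemma exists_le_angRate_of_mem_Icc : ∃ c > (0 : ℝ), ∃ M ≥ (0 : ℝ), ∀ θ ∈ Icc 0 (2 * Real.pi),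
    ∀ B ∈ 𝓑, c + M * (supportCovector f u w θ ⬝ᵥ (B *ᵥ ellipse u w θ)) ≤
      angRate u w B (ellipse u w θ) := by
  obtain ⟨c, hc, M, hM, hle⟩ := exists_pos_add_mul_le_of_isCompact
    ((isCompact_Icc (a := (0 : ℝ)) (b := 2 * Real.pi)).prod h.isCompact)
    (continuous_angRate_ellipse u w) h.continuous_supportCovector_pairing
    (fun q hq => h.isInvariantFor _ q.2 hq.2 _ (supportCovector_mem f u w q.1))
    (fun q hq => h.angRate_pos (supportCovector_mem f u w q.1) hq.2)
  exact ⟨c, hc, M, hM, fun θ hθ B hB => hle (θ, B) ⟨hθ, hB⟩⟩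

lemma exists_le_angRate : ∃ c > (0 : ℝ), ∃ M ≥ (0 : ℝ), ∀ θ, ∀ p ∈ Subgrad f (ellipse u w θ),
    ∀ B ∈ convexHull ℝ 𝓑, c + M * (p ⬝ᵥ (B *ᵥ ellipse u w θ)) ≤ angRate u w B (ellipse u w θ) := by
  obtain ⟨c, hc, M, hM, hle⟩ := h.exists_le_angRate_of_mem_Icc
  refine ⟨c, hc, M, hM, fun θ p hp B hB => ?_⟩
  obtain ⟨θ', hθ', heq⟩ := (periodic_ellipse u w).exists_mem_Ico₀ Real.two_pi_pos θ
  rw [heq] at hp ⊢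
  rw [h.subgrad_unique hp (supportCovector_mem f u w θ')]
  have hlinear : IsLinearMap ℝ fun B : Mat => angRate u w B (ellipse u w θ') -
      M * (supportCovector f u w θ' ⬝ᵥ (B *ᵥ ellipse u w θ')) :=
    ((isLinearMap_angRate u w _).mk' _ - M • (isLinearMap_pairing _ _).mk' _).isLinear
  have hmem := convexHull_min
    (fun B hB => le_sub_iff_add_le.2 (hle θ' (Ico_subset_Icc_self hθ') B hB))
    (convex_halfSpace_ge hlinear c) hB
  exact le_sub_iff_add_le.1 hmem

end IsOriented

/-! ### Measurable selections -/

section Selection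

variable {Ω X Y : Type*} [MeasurableSpace Ω] [TopologicalSpace X] [CompactSpace X]
  [TopologicalSpace Y] [MeasurableSpace Y] [OpensMeasurableSpace Y]

lemma exists_measurable_min {φ : Ω → Y} (hφ : Measurable φ) {C : Set (Y × X)} (hC : IsClosed C)
    (hne : ∀ ω, ∃ x, (φ ω, x) ∈ C) {g : X → ℝ} (hg : Continuous g) :
    ∃ m : Ω → ℝ, Measurable m ∧ ∀ ω, ∃ x, (φ ω, x) ∈ C ∧ g x = m ω := by
  have hexists_min : ∀ ω, ∃ x, (φ ω, x) ∈ C ∧ ∀ x', (φ ω, x') ∈ C → g x ≤ g x' := fun ω =>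
    (hC.preimage (Continuous.prodMk_right (φ ω))).isCompact.exists_isMinOn (hne ω) hg.continuousOn
  choose ξ hξ hmin using hexists_min
  refine ⟨fun ω => g (ξ ω), measurable_of_Iic fun a => ?_, fun ω => ⟨ξ ω, hξ ω, rfl⟩⟩
  have hclosed : IsClosed (Prod.fst '' (C ∩ {q : Y × X | g q.2 ≤ a})) :=
    isClosedMap_fst_of_compactSpace _
      (hC.inter (isClosed_le (hg.comp continuous_snd) continuous_const))
  convert hφ hclosed.measurableSet using 1
  ext ω
  constructor
  · exact fun hle => ⟨(φ ω, ξ ω), ⟨hξ ω, hle⟩, rfl⟩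
  · rintro ⟨⟨-, x⟩, ⟨hx, hle⟩, rfl⟩
    exact (hmin ω x hx).trans hle

/-- The functions of the list are minimized one after the other: the value of the minimum is
measurable and becomes an additional parameter of the relation. -/
lemma exists_measurable_selection (l : List (X → ℝ)) (hl : ∀ g ∈ l, Continuous g) {φ : Ω → Y}
    (hφ : Measurable φ) {C : Set (Y × X)} (hC : IsClosed C) (hne : ∀ ω, ∃ x, (φ ω, x) ∈ C) :
    ∃ ξ : Ω → X, (∀ ω, (φ ω, ξ ω) ∈ C) ∧ ∀ g ∈ l, Measurable (g ∘ ξ) := by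
  induction l generalizing Y with
  | nil =>
    choose ξ hξ using hne
    exact ⟨ξ, hξ, by simp⟩
  | cons g l ih =>
    have hg := hl g List.mem_cons_self
    obtain ⟨m, hm, hmin⟩ := exists_measurable_min hφ hC hne hg
    have hclosed : IsClosed {q : (Y × ℝ) × X | (q.1.1, q.2) ∈ C ∧ g q.2 = q.1.2} :=
      (hC.preimage (by fun_prop)).inter (isClosed_eq (by fun_prop) (by fun_prop))
    obtain ⟨ξ, hξ, hmeas⟩ :=
      ih (fun g' hg' => hl g' (List.mem_cons_of_mem _ hg')) (hφ.prodMk hm) hclosed hmin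
    have hgm : g ∘ ξ = m := funext fun ω => (hξ ω).2
    exact ⟨ξ, fun ω => (hξ ω).1, List.forall_mem_cons.2 ⟨hgm ▸ hm, hmeas⟩⟩

lemma exists_measurable_matrix {n : Type*} [Finite n] {𝓑 : Set (Matrix n n ℝ)}
    (hc : IsCompact 𝓑) {C : Set (Y × Matrix n n ℝ)} (hC : IsClosed C)
    (hne : ∀ y, ∃ B ∈ 𝓑, (y, B) ∈ C) :
    ∃ D : Y → Matrix n n ℝ, (∀ i j, Measurable fun y => D y i j) ∧
      ∀ y, D y ∈ 𝓑 ∧ (y, D y) ∈ C := by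
  have : Fintype n := Fintype.ofFinite n
  have : CompactSpace 𝓑 := isCompact_iff_compactSpace.1 hc
  let entries : List (𝓑 → ℝ) :=
    (Finset.univ : Finset (n × n)).toList.map fun ij B => (B : Matrix n n ℝ) ij.1 ij.2
  have hentries : ∀ g ∈ entries, Continuous g := by
    intro g hg
    obtain ⟨ij, -, rfl⟩ := List.mem_map.1 hg
    exact (continuous_apply_apply ij.1 ij.2).comp continuous_subtype_val
  have hclosed : IsClosed {q : Y × 𝓑 | (q.1, (q.2 : Matrix n n ℝ)) ∈ C} :=
    hC.preimage (continuous_id.prodMap continuous_subtype_val)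
  obtain ⟨ξ, hξ, hmeas⟩ := exists_measurable_selection entries hentries measurable_id hclosed
    fun y => let ⟨B, hB, hmem⟩ := hne y; ⟨⟨B, hB⟩, hmem⟩
  exact ⟨fun y => ξ y, fun i j => hmeas _ (List.mem_map.2 ⟨(i, j), by simp, rfl⟩),
    fun y => ⟨(ξ y).2, hξ y⟩⟩

end Selection

/-! ### Primitives of bounded positive rates -/

section Primitive

variable {ρ : ℝ → ℝ} {a b : ℝ}

lemma locallyIntegrable_of_abs_le (hm : Measurable ρ) (hb : ∀ t, |ρ t| ≤ b) :
    LocallyIntegrable ρ volume :=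
  (locallyIntegrable_const b).mono hm.aestronglyMeasurable
    (.of_forall fun t => (hb t).trans (le_abs_self b))

lemma mul_sub_le_integral {x y : ℝ} (hxy : x ≤ y) (hρ : IntervalIntegrable ρ volume x y)
    (hlow : ∀ t, a ≤ ρ t) : a * (y - x) ≤ ∫ t in x..y, ρ t := by
  have hle := intervalIntegral.integral_mono_on hxy (intervalIntegrable_const (c := a)) hρ
    fun t _ => hlow t
  rwa [intervalIntegral.integral_const, smul_eq_mul, mul_comm] at hle

lemma exists_orderIso_of_mul_sub_le {φ : ℝ → ℝ} (ha : 0 < a) (hφ : Continuous φ)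
    (hlow : ∀ x y, x ≤ y → a * (y - x) ≤ φ y - φ x) : ∃ e : ℝ ≃o ℝ, ⇑e = φ := by
  have hmono : StrictMono φ := fun x y hxy =>
    sub_pos.1 ((mul_pos ha (sub_pos.2 hxy)).trans_le (hlow x y hxy.le))
  have htop : Tendsto φ atTop atTop := by
    refine tendsto_atTop_mono' _ ?_
      (tendsto_atTop_add_const_right _ (φ 0) (tendsto_id.const_mul_atTop ha))
    filter_upwards [eventually_ge_atTop 0] with x hx
    simpa only [sub_zero, id, le_sub_iff_add_le] using hlow 0 x hx
  have hbot : Tendsto φ atBot atBot := by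
    refine tendsto_atBot_mono' _ ?_
      (tendsto_atBot_add_const_right _ (φ 0) (tendsto_id.const_mul_atBot ha))
    filter_upwards [eventually_le_atBot 0] with x hx
    have hle := hlow x 0 hx
    simp only [id]
    linarith
  exact ⟨hmono.orderIsoOfSurjective φ (hφ.surjective htop hbot), rfl⟩

lemma exists_orderIso_primitive (hm : Measurable ρ) (ha : 0 < a) (hlow : ∀ t, a ≤ ρ t)
    (hupp : ∀ t, ρ t ≤ b) : ∃ e : ℝ ≃o ℝ, (∀ x y, e y - e x = ∫ t in x..y, ρ t) ∧ e 0 = 0 ∧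
      (∃ K : ℝ≥0, LipschitzWith K e) ∧ (∃ K : ℝ≥0, LipschitzWith K e.symm) ∧
      ∀ᵐ t, HasDerivAt e (ρ t) t := by
  have habs : ∀ t, |ρ t| ≤ b := fun t => by
    rw [abs_of_pos (ha.trans_le (hlow t))]
    exact hupp t
  have hloc := locallyIntegrable_of_abs_le hm habs
  have hint : ∀ x y, IntervalIntegrable ρ volume x y := fun x y =>
    (hloc.integrableOn_isCompact isCompact_uIcc).intervalIntegrable
  have hsub : ∀ x y, (∫ t in 0..y, ρ t) - ∫ t in 0..x, ρ t = ∫ t in x..y, ρ t := fun x y =>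
    intervalIntegral.integral_interval_sub_left (hint _ _) (hint _ _)
  have hlip : LipschitzWith b.toNNReal fun y => ∫ t in 0..y, ρ t := by
    refine LipschitzWith.of_dist_le_mul fun x y => ?_
    rw [Real.coe_toNNReal _ ((abs_nonneg _).trans (habs 0)), Real.dist_eq, Real.dist_eq, hsub]
    exact intervalIntegral.norm_integral_le_of_norm_le_const (f := ρ) fun t _ => habs t
  have hgrowth : ∀ x y, x ≤ y → a * (y - x) ≤ (∫ t in 0..y, ρ t) - ∫ t in 0..x, ρ t :=
    fun x y hxy => (mul_sub_le_integral hxy (hint x y) hlow).trans_eq (hsub x y).symm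
  obtain ⟨e, he⟩ := exists_orderIso_of_mul_sub_le ha hlip.continuous hgrowth
  have hsymm : LipschitzWith a⁻¹.toNNReal e.symm := by
    refine LipschitzWith.of_le_add_mul _ fun s t => ?_
    rw [Real.coe_toNNReal _ (inv_nonneg.2 ha.le), Real.dist_eq, ← sub_le_iff_le_add',
      inv_mul_eq_div, le_div_iff₀' ha]
    rcases le_total (e.symm t) (e.symm s) with hle | hle
    · refine le_trans ?_ (le_abs_self _)
      have hle' := hgrowth _ _ hle
      rw [← congrFun he, ← congrFun he, e.apply_symm_apply, e.apply_symm_apply] at hle'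
      exact hle'
    · exact (mul_nonpos_of_nonneg_of_nonpos ha.le (sub_nonpos.2 hle)).trans (abs_nonneg _)
  refine ⟨e, ?_, ?_, ⟨_, he ▸ hlip⟩, ⟨_, hsymm⟩, ?_⟩
  · simpa only [he] using hsub
  · rw [he]
    exact intervalIntegral.integral_same
  · filter_upwards [_root_.LocallyIntegrable.ae_hasDerivAt_integral hloc] with t ht
    rw [he]
    exact ht 0

lemma ae_hasDerivAt_orderIso_symm {e : ℝ ≃o ℝ} {K : ℝ≥0} (hlip : LipschitzWith K e)
    (hder : ∀ᵐ t, HasDerivAt e (ρ t) t) (hρ : ∀ t, ρ t ≠ 0) :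
    ∀ᵐ s, HasDerivAt e.symm (ρ (e.symm s))⁻¹ s := by
  have hnull : volume (e '' {t | ¬ HasDerivAt e (ρ t) t}) = 0 := by
    rw [ae_iff, ← hausdorffMeasure_real] at hder
    rw [← hausdorffMeasure_real]
    refine le_antisymm ((hlip.hausdorffMeasure_image_le zero_le_one _).trans_eq ?_) bot_le
    rw [hder, mul_zero]
  refine ae_iff.2 (measure_mono_null (fun s hs => ?_) hnull)
  refine ⟨e.symm s, fun hd => hs ?_, e.apply_symm_apply s⟩
  exact HasDerivAt.of_local_left_inverse e.symm.continuous.continuousAt hd (hρ _)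
    (.of_forall e.apply_symm_apply)

lemma exists_orderIso_hasDerivAt_comp (hm : Measurable ρ) (ha : 0 < a) (hlow : ∀ t, a ≤ ρ t)
    (hupp : ∀ t, ρ t ≤ b) {L : ℝ} (hL : 0 < L) (hper : Function.Periodic ρ L) :
    ∃ (e : ℝ ≃o ℝ) (T : ℝ), 0 < T ∧ e 0 = 0 ∧ (∀ t, e (t + T) = e t + L) ∧
      (∃ K : ℝ≥0, LipschitzWith K e) ∧ ∀ᵐ t, HasDerivAt e (ρ (e t)) t := by
  have hpos : ∀ t, 0 < ρ t := fun t => ha.trans_le (hlow t)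
  obtain ⟨e, hsub, he₀, ⟨K, hK⟩, hsymm, hder⟩ := exists_orderIso_primitive hm.inv
    (inv_pos.2 ((hpos 0).trans_le (hupp 0))) (fun t => inv_anti₀ (hpos t) (hupp t))
    (fun t => inv_anti₀ ha (hlow t))
  have hadd : ∀ t, e (t + L) = e t + e L := by
    intro t
    have hinv : Function.Periodic ρ⁻¹ L := hper.comp Inv.inv
    have hperiod := hinv.intervalIntegral_add_eq t 0
    rw [← hsub, ← hsub, zero_add, he₀, sub_zero] at hperiod
    exact sub_eq_iff_eq_add'.1 hperiod
  refine ⟨e.symm, e L, he₀ ▸ e.strictMono hL, ?_, fun t => ?_, hsymm, ?_⟩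
  · rw [e.symm_apply_eq, he₀]
  · rw [e.symm_apply_eq, hadd, e.apply_symm_apply]
  · simpa only [Pi.inv_apply, inv_inv] using
      ae_hasDerivAt_orderIso_symm hK hder fun t => (inv_pos.2 (hpos t)).ne'

end Primitive

/-! ### Absolutely continuous solutions of linear differential inequalities -/

lemma apply_le_apply_of_ae_deriv_nonpos {g : ℝ → ℝ} {a b : ℝ} (hab : a ≤ b)
    (hac : AbsolutelyContinuousOnInterval g a b) (hd : ∀ᵐ t, t ∈ Ioc a b → deriv g t ≤ 0) :
    g b ≤ g a := by
  have hle : ∫ t in a..b, deriv g t ≤ 0 :=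
    (intervalIntegral.integral_of_le hab).trans_le
      (integral_nonpos_of_ae ((ae_restrict_iff' measurableSet_Ioc).2 hd))
  rwa [hac.integral_deriv_eq_sub, sub_nonpos] at hle

lemma sq_le_sq_mul_exp {g : ℝ → ℝ} {κ T : ℝ} (hT : 0 ≤ T)
    (hac : AbsolutelyContinuousOnInterval g 0 T)
    (hd : ∀ᵐ t, t ∈ Ioc 0 T → ∃ k ≤ κ, HasDerivAt g (k * g t) t) :
    g T ^ 2 ≤ g 0 ^ 2 * Real.exp (2 * κ * T) := by
  have hexp : ContDiff ℝ 1 fun t : ℝ => Real.exp (-(2 * κ) * t) := by fun_prop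
  have hle := apply_le_apply_of_ae_deriv_nonpos hT
    ((hac.mul hac).mul hexp.contDiffOn.absolutelyContinuousOnInterval) (by
      filter_upwards [hd] with t ht htT
      obtain ⟨k, hk, hg⟩ := ht htT
      have he : HasDerivAt (fun t : ℝ => Real.exp (-(2 * κ) * t))
          (Real.exp (-(2 * κ) * t) * (-(2 * κ))) t := by
        simpa using ((hasDerivAt_id t).const_mul (-(2 * κ))).exp
      rw [((hg.mul hg).mul he).deriv]
      have hnonneg : 0 ≤ (κ - k) * (g t * g t * Real.exp (-(2 * κ) * t)) :=
        mul_nonneg (sub_nonneg.2 hk) (mul_nonneg (mul_self_nonneg _) (Real.exp_pos _).le)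
      simp only [Pi.mul_apply]
      linarith)
  simp only [Pi.mul_apply, mul_zero, Real.exp_zero, mul_one] at hle
  rwa [neg_mul, Real.exp_neg, ← div_eq_mul_inv, div_le_iff₀ (Real.exp_pos _), ← sq, ← sq] at hle

/-! ### The motion along the unit sphere -/

lemma measurable_toIcoMod {p : ℝ} (hp : 0 < p) : Measurable (toIcoMod hp 0) := by
  rw [funext fun t => toIcoMod_eq_fract_mul hp t]
  exact (measurable_fract.comp (measurable_id.div_const p)).mul_const p

lemma measurable_angRate_ellipse {D : ℝ → Mat} (hm : ∀ i j, Measurable fun θ => D θ i j)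
    (u w : Plane) : Measurable fun θ => angRate u w (D θ) (ellipse u w θ) := by
  have hellipse : ∀ i, Measurable fun θ => ellipse u w θ i := fun i =>
    ((continuous_apply i).comp (continuous_ellipse u w)).measurable
  have hmulVec : ∀ i, Measurable fun θ => (D θ *ᵥ ellipse u w θ) i := fun i =>
    Finset.measurable_fun_sum Finset.univ fun j _ => (hm i j).mul (hellipse j)
  exact (((hellipse 0).mul (hmulVec 1)).sub ((hellipse 1).mul (hmulVec 0))).div_const _

lemma angRate_neg_point (u w : Plane) (B : Mat) (x : Plane) :
    angRate u w B (-x) = angRate u w B x := by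
  simp only [angRate, area, Matrix.mulVec_neg, Pi.neg_apply, neg_mul_neg]

/-- `sphereCurve f u w ∘ Θ` is a flow of the law `D` along the unit sphere of `f`, starting at
angle `0` and making half a turn in every time span of length `T`. -/
structure IsSphereMotion (𝓑 : Set Mat) (f : Seminorm ℝ Plane) (u w : Plane) (D : ℝ → Mat)
    (Θ : ℝ ≃o ℝ) (T : ℝ) : Prop where
  pos : 0 < T
  measurable : ∀ i j, Measurable fun t => D t i j
  mem : ∀ t, D t ∈ 𝓑
  periodic : Function.Periodic D T
  angle_zero : Θ 0 = 0
  angle_add : ∀ t, Θ (t + T) = Θ t + Real.pi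
  isFlow : ∀ t₀, IsFlow (fun t => D (t₀ + t)) fun t => sphereCurve f u w (Θ (t₀ + t))

namespace IsOriented

variable {𝓑 : Set Mat} {f : Seminorm ℝ Plane} {u w : Plane} (h : IsOriented 𝓑 f u w)

include h

lemma supportCovector_add_pi (θ : ℝ) :
    supportCovector f u w (θ + Real.pi) = -supportCovector f u w θ := by
  have hmem := supportCovector_mem f u w (θ + Real.pi)
  rw [ellipse_add_pi] at hmem
  rw [← neg_eq_iff_eq_neg]
  have hneg := neg_mem_subgrad hmem
  rw [neg_neg] at hneg
  exact h.subgrad_unique hneg (supportCovector_mem f u w θ)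

lemma exists_periodic_tangent_law : ∃ D : ℝ → Mat, (∀ i j, Measurable fun θ => D θ i j) ∧
    (∀ θ, D θ ∈ 𝓑) ∧ Function.Periodic D Real.pi ∧
    ∀ θ, supportCovector f u w θ ⬝ᵥ (D θ *ᵥ ellipse u w θ) = 0 := by
  obtain ⟨D, hm, hD⟩ := exists_measurable_matrix h.isCompact
    (isClosed_eq h.continuous_supportCovector_pairing continuous_const)
    h.exists_supportCovector_tangent
  have hper : ∀ B : Mat, Function.Periodic
      (fun θ => supportCovector f u w θ ⬝ᵥ (B *ᵥ ellipse u w θ)) Real.pi := fun B θ => by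
    simp only [h.supportCovector_add_pi, ellipse_add_pi, Matrix.mulVec_neg, neg_dotProduct_neg]
  refine ⟨fun θ => D (toIcoMod Real.pi_pos 0 θ),
    fun i j => (hm i j).comp (measurable_toIcoMod Real.pi_pos), fun θ => (hD _).1,
    fun θ => congrArg D (toIcoMod_add_right Real.pi_pos 0 θ), fun θ => ?_⟩
  rw [← (hper _).sub_zsmul_eq (toIcoDiv Real.pi_pos 0 θ)]
  exact (hD (toIcoMod Real.pi_pos 0 θ)).2

lemma le_angRate_of_tangent : ∃ c > (0 : ℝ), ∀ θ, ∀ p ∈ Subgrad f (ellipse u w θ),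
    ∀ B ∈ convexHull ℝ 𝓑, p ⬝ᵥ (B *ᵥ ellipse u w θ) = 0 →
      c ≤ angRate u w B (ellipse u w θ) := by
  obtain ⟨c, hc, M, -, hle⟩ := h.exists_le_angRate
  refine ⟨c, hc, fun θ p hp B hB htan => ?_⟩
  simpa only [htan, mul_zero, add_zero] using hle θ p hp B hB

lemma isFlow_sphereCurve_comp {D : ℝ → Mat} {Θ : ℝ ≃o ℝ} {K : ℝ≥0}
    (htan : ∀ θ, supportCovector f u w θ ⬝ᵥ (D θ *ᵥ ellipse u w θ) = 0)
    (hrate : ∀ θ, angRate u w (D θ) (ellipse u w θ) ≠ 0) (hΘ : LipschitzWith K Θ)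
    (hder : ∀ᵐ t, HasDerivAt Θ (angRate u w (D (Θ t)) (ellipse u w (Θ t))) t) (t₀ : ℝ) :
    IsFlow (fun t => D (Θ (t₀ + t))) fun t => sphereCurve f u w (Θ (t₀ + t)) := by
  refine ⟨fun T => ?_, ?_⟩
  · obtain ⟨K', hK'⟩ := (contDiff_sphereCurve h.definite h.area_ne_zero
      h.contDiff_seminorm_ellipse).contDiffOn.exists_lipschitzOnWith one_ne_zero
      (convex_Icc (Θ (t₀ + 0)) (Θ (t₀ + T))) isCompact_Icc
    exact ⟨K' * (K * 1),
      hK'.comp (hΘ.comp (isometry_add_left t₀).lipschitz).lipschitzOnWith fun t ht =>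
        ⟨Θ.monotone (add_le_add_right ht.1 t₀), Θ.monotone (add_le_add_right ht.2 t₀)⟩⟩
  · filter_upwards [(measurePreserving_add_left volume t₀).quasiMeasurePreserving.ae hder]
      with t ht _
    refine ((h.hasDerivAt_sphereCurve (htan _) (hrate _)).scomp t
      (ht.comp_const_add t₀ t)).congr_deriv ?_
    rw [smul_smul, mul_inv_cancel₀ (hrate _), one_smul]

lemma exists_isSphereMotion :
    ∃ (D : ℝ → Mat) (Θ : ℝ ≃o ℝ) (T : ℝ), IsSphereMotion 𝓑 f u w D Θ T := by
  obtain ⟨D, hm, hD, hper, htan⟩ := h.exists_periodic_tangent_law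
  obtain ⟨c, hc, hlow⟩ := h.le_angRate_of_tangent
  obtain ⟨C, -, hupp⟩ := exists_abs_angRate_le h.isCompact u w
  have hhull : ∀ θ, D θ ∈ convexHull ℝ 𝓑 := fun θ => subset_convexHull ℝ 𝓑 (hD θ)
  have hge : ∀ θ, c ≤ angRate u w (D θ) (ellipse u w θ) := fun θ =>
    hlow θ _ (supportCovector_mem f u w θ) (D θ) (hhull θ) (htan θ)
  obtain ⟨Θ, T, hT, hΘ₀, hΘT, ⟨K, hK⟩, hder⟩ := exists_orderIso_hasDerivAt_comp
    (measurable_angRate_ellipse hm u w) hc hge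
    (fun θ => (le_abs_self _).trans (hupp θ (D θ) (hhull θ))) Real.pi_pos
    (fun θ => by simp only [hper θ, ellipse_add_pi, angRate_neg_point])
  exact ⟨D ∘ Θ, Θ, T, hT, fun i j => (hm i j).comp hK.continuous.measurable, fun t => hD _,
    fun t => by rw [Function.comp_apply, hΘT, hper, Function.comp_apply], hΘ₀, hΘT,
    h.isFlow_sphereCurve_comp htan (fun θ => (hc.trans_le (hge θ)).ne') hK hder⟩

end IsOriented

/-! ### Areas spanned by flows -/

lemma absolutelyContinuousOnInterval_area {x y : ℝ → Plane} {K L : ℝ≥0} {T : ℝ} (hT : 0 ≤ T)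
    (hx : LipschitzOnWith K x (Icc 0 T)) (hy : LipschitzOnWith L y (Icc 0 T)) :
    AbsolutelyContinuousOnInterval (fun t => area (x t) (y t)) 0 T := by
  rw [← uIcc_of_le hT] at hx hy
  have hx' := fun i => (lipschitzOnWith_coord hx i).absolutelyContinuousOnInterval
  have hy' := fun i => (lipschitzOnWith_coord hy i).absolutelyContinuousOnInterval
  exact ((hx' 0).mul (hy' 1)).sub ((hx' 1).mul (hy' 0))

lemma area_mulVec_add_area_mulVec (B : Mat) (x y : Plane) :
    area (B *ᵥ x) y + area x (B *ᵥ y) = B.trace * area x y := by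
  simp only [area, Matrix.mulVec, dotProduct, Fin.sum_univ_two, Matrix.trace_fin_two]
  ring

lemma IsFlow.area_sq_le {B : ℝ → Mat} {x y : ℝ → Plane} (hx : IsFlow B x) (hy : IsFlow B y)
    {κ : ℝ} (hB : ∀ t, 0 ≤ t → (B t).trace ≤ κ) {T : ℝ} (hT : 0 ≤ T) :
    area (x T) (y T) ^ 2 ≤ area (x 0) (y 0) ^ 2 * Real.exp (2 * κ * T) := by
  obtain ⟨K, hK⟩ := hx.1 T
  obtain ⟨L, hL⟩ := hy.1 T
  refine sq_le_sq_mul_exp hT (absolutelyContinuousOnInterval_area hT hK hL) ?_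
  filter_upwards [hx.2, hy.2] with t hxt hyt ht
  exact ⟨(B t).trace, hB t ht.1.le, (hasDerivAt_area (hxt ht.1) (hyt ht.1)).congr_deriv
    (area_mulVec_add_area_mulVec _ _ _)⟩

/-! ### The polar angle of an extremal flow -/

lemma lipschitzWith_ellipse (u w : Plane) : LipschitzWith (‖u‖₊ + ‖w‖₊) (ellipse u w) :=
  lipschitzWith_of_nnnorm_deriv_le (fun θ => (hasDerivAt_ellipse u w θ).differentiableAt)
    fun θ => by
    rw [(hasDerivAt_ellipse u w θ).deriv]
    exact norm_ellipse_le u w _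

/-- The angular velocity, with respect to the parametrization `ellipse u w` of the directions, of
a point at the position `x` moving with velocity `v`. -/
noncomputable def angularVelocity (u w x v : Plane) : ℝ :=
  area u w * area x v / (area x w ^ 2 + area u x ^ 2)

lemma angularVelocity_smul_ellipse {u w : Plane} (h : area u w ≠ 0) {R : ℝ} (hR : R ≠ 0)
    (B : Mat) (θ : ℝ) :
    angularVelocity u w (R • ellipse u w θ) (B *ᵥ (R • ellipse u w θ)) =
      angRate u w B (ellipse u w θ) := by
  have hradius : area (R • ellipse u w θ) w ^ 2 + area u (R • ellipse u w θ) ^ 2 =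
      (R * area u w) ^ 2 := by
    rw [ellipse, smul_add, area_add_left, area_add_right]
    simp only [area_smul_left, area_smul_right, area_self]
    linear_combination (R * area u w) ^ 2 * Real.cos_sq_add_sin_sq θ
  rw [angularVelocity, hradius, Matrix.mulVec_smul, area_smul_left, area_smul_right, angRate]
  field_simp

lemma measurable_area {x y : ℝ → Plane} (hx : Measurable x) (hy : Measurable y) :
    Measurable fun t => area (x t) (y t) := by
  rw [measurable_pi_iff] at hx hy
  exact ((hx 0).mul (hy 1)).sub ((hx 1).mul (hy 0))

lemma measurable_angularVelocity (u w : Plane) {x v : ℝ → Plane} (hx : Measurable x)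
    (hv : Measurable v) : Measurable fun t => angularVelocity u w (x t) (v t) :=
  ((measurable_area hx hv).const_mul _).div
    (((measurable_area hx measurable_const).pow_const 2).add
      ((measurable_area measurable_const hx).pow_const 2))

lemma exists_radial_bound {𝓑 : Set Mat} (hc : IsCompact 𝓑) {u w : Plane} (h : area u w ≠ 0) :
    ∃ κ : ℝ, ∀ θ, ∀ B ∈ convexHull ℝ 𝓑, ∃ s ≤ κ, B *ᵥ ellipse u w θ =
      s • ellipse u w θ + angRate u w B (ellipse u w θ) • ellipse u w (θ + Real.pi / 2) := by
  obtain ⟨M, hM, hbound⟩ := exists_norm_toCLM_le_convexHull hc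
  refine ⟨2 * (M * (‖u‖ + ‖w‖) * (‖u‖ + ‖w‖)) / |area u w|, fun θ B hB => ?_⟩
  obtain ⟨s, hs⟩ := mulVec_ellipse h B θ
  refine ⟨s, ?_, hs⟩
  have harea : area (B *ᵥ ellipse u w θ) (ellipse u w (θ + Real.pi / 2)) = s * area u w := by
    rw [hs, area_add_left, area_smul_left, area_smul_left, area_self,
      area_ellipse_add_pi_div_two, mul_zero, add_zero]
  rw [le_div_iff₀ (abs_pos.2 h)]
  calc s * |area u w| ≤ |s * area u w| := by
        rw [abs_mul]
        exact mul_le_mul_of_nonneg_right (le_abs_self s) (abs_nonneg _)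
    _ ≤ 2 * (‖B *ᵥ ellipse u w θ‖ * ‖ellipse u w (θ + Real.pi / 2)‖) := harea ▸ abs_area_le _ _
    _ ≤ 2 * (M * (‖u‖ + ‖w‖) * (‖u‖ + ‖w‖)) := by
        gcongr
        · exact (norm_mulVec_le (hbound B hB) _).trans
            (mul_le_mul_of_nonneg_left (norm_ellipse_le u w θ) hM)
        · exact norm_ellipse_le u w _

lemma area_smul_ellipse_add_area_ellipse (u w : Plane) (s ω φ θ : ℝ) :
    area (ω • ellipse u w (φ + Real.pi / 2)) (ellipse u w θ) +
      area (ellipse u w φ) (s • ellipse u w θ + ω • ellipse u w (θ + Real.pi / 2)) =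
        s * area (ellipse u w φ) (ellipse u w θ) := by
  simp only [area_smul_left, area_smul_right, area_add_right, area_ellipse_ellipse]
  rw [← sub_sub, add_sub_right_comm, Real.sin_sub_pi_div_two, Real.sin_add_pi_div_two]
  ring

/-- A direction that rotates with the angular velocity of a flow and is parallel to it initially
remains parallel to it. -/
lemma IsFlow.area_ellipse_eq_zero {𝓑 : Set Mat} {B : ℝ → Mat} {z : ℝ → Plane} (hz : IsFlow B z)
    (hc : IsCompact 𝓑) (hB : ∀ t, 0 ≤ t → B t ∈ convexHull ℝ 𝓑) {u w : Plane}
    (h : area u w ≠ 0) {φ : ℝ → ℝ} {K : ℝ≥0} (hφ : LipschitzWith K φ)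
    (hrate : ∀ᵐ t, 0 < t → ∃ R θ : ℝ, z t = R • ellipse u w θ ∧
      HasDerivAt φ (angRate u w (B t) (ellipse u w θ)) t)
    (hzero : area (ellipse u w (φ 0)) (z 0) = 0) {T : ℝ} (hT : 0 ≤ T) :
    area (ellipse u w (φ T)) (z T) = 0 := by
  obtain ⟨κ, hκ⟩ := exists_radial_bound hc h
  obtain ⟨L, hL⟩ := hz.1 T
  have hle := sq_le_sq_mul_exp (κ := κ) hT (absolutelyContinuousOnInterval_area hT
    ((lipschitzWith_ellipse u w).comp hφ).lipschitzOnWith hL) (by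
      filter_upwards [hz.2, hrate] with t hzt hrt ht
      obtain ⟨R, θ, hzθ, hφt⟩ := hrt ht.1
      obtain ⟨s, hs, hvelocity⟩ := hκ θ (B t) (hB t ht.1.le)
      refine ⟨s, hs, (hasDerivAt_area ((hasDerivAt_ellipse u w (φ t)).scomp t hφt)
        (hzt ht.1)).congr_deriv ?_⟩
      rw [Function.comp_apply, hzθ, Matrix.mulVec_smul, hvelocity,
        area_smul_right _ _ (ellipse u w θ), area_smul_right _ _ (ellipse u w θ),
        area_smul_right R, ← mul_add, area_smul_ellipse_add_area_ellipse]
      ring)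
  rw [Function.comp_apply, Function.comp_apply, hzero, zero_pow two_ne_zero, zero_mul] at hle
  exact pow_eq_zero_iff two_ne_zero |>.1 (hle.antisymm (sq_nonneg _))

lemma supportCovector_dotProduct_sphereCurve {f : Seminorm ℝ Plane}
    (hdef : ∀ v, f v = 0 → v = 0) {u w : Plane} (h : area u w ≠ 0) (θ : ℝ) :
    supportCovector f u w θ ⬝ᵥ sphereCurve f u w θ = 1 := by
  rw [sphereCurve, dotProduct_smul, (supportCovector_mem f u w θ).1, smul_eq_mul,
    inv_mul_cancel₀ (seminorm_ellipse_pos hdef h θ).ne']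

namespace IsOriented

variable {𝓑 : Set Mat} {f : Seminorm ℝ Plane} {u w : Plane} (h : IsOriented 𝓑 f u w)
  {B : ℝ → Mat} {z : ℝ → Plane}

include h

lemma eq_smul_sphereCurve_of_area_eq_zero (hz : ContinuousOn z (Ici 0))
    (hf : ∀ t, 0 ≤ t → f (z t) = f (z 0)) (hz₀ : z 0 ≠ 0) {φ : ℝ → ℝ} (hφ : Continuous φ)
    (hφ₀ : z 0 = f (z 0) • sphereCurve f u w (φ 0))
    (hzero : ∀ t, 0 ≤ t → area (ellipse u w (φ t)) (z t) = 0) {t : ℝ} (ht : 0 ≤ t) :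
    z t = f (z 0) • sphereCurve f u w (φ t) := by
  have hpairing := supportCovector_dotProduct_sphereCurve h.definite h.area_ne_zero
  have hsphere := seminorm_sphereCurve h.definite h.area_ne_zero
  have hparallel : ∀ t, 0 ≤ t → ∃ a : ℝ, z t = a • sphereCurve f u w (φ t) := fun t ht => by
    obtain ⟨a, ha⟩ := exists_eq_smul_of_area_eq_zero (ellipse_ne_zero h.area_ne_zero (φ t))
      (hzero t ht)
    refine ⟨a * f (ellipse u w (φ t)), ?_⟩
    rw [sphereCurve, smul_smul, mul_assoc,
      mul_inv_cancel₀ (seminorm_ellipse_pos h.definite h.area_ne_zero _).ne', mul_one, ha]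
  have hcont : ContinuousOn (fun t => supportCovector f u w (φ t) ⬝ᵥ z t) (Ici 0) :=
    (continuous_fst.dotProduct continuous_snd).comp_continuousOn
      ((h.continuous_supportCovector.comp hφ).continuousOn.prodMk hz)
  have hsq : EqOn ((fun t => supportCovector f u w (φ t) ⬝ᵥ z t) ^ 2) ((fun _ => f (z 0)) ^ 2)
      (Ici 0) := fun s hs => by
    obtain ⟨a, ha⟩ := hparallel s hs
    rw [Pi.pow_apply, Pi.pow_apply, ← hf s hs, ha, dotProduct_smul, hpairing, map_smul_eq_mul,
      hsphere, smul_eq_mul, mul_one, mul_one, Real.norm_eq_abs, sq_abs]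
  have heq : supportCovector f u w (φ t) ⬝ᵥ z t = f (z 0) :=
    isPreconnected_Ici.eq_of_sq_eq hcont continuousOn_const hsq
      (fun _ => (seminorm_pos h.definite hz₀).ne') self_mem_Ici (by
        conv_lhs => rw [hφ₀]
        rw [dotProduct_smul, hpairing, smul_eq_mul, mul_one]) ht
  obtain ⟨a, ha⟩ := hparallel t ht
  rw [ha, dotProduct_smul, hpairing, smul_eq_mul, mul_one] at heq
  rw [ha, heq]

lemma exists_measurable_angRate (hz : IsFlow B z) (hB : ∀ t, 0 ≤ t → B t ∈ convexHull ℝ 𝓑)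
    (hf : ∀ t, 0 ≤ t → f (z t) = f (z 0)) (hz₀ : z 0 ≠ 0) :
    ∃ r : ℝ → ℝ, Measurable r ∧ (∃ c > 0, ∀ t, c ≤ r t) ∧ (∃ C, ∀ t, r t ≤ C) ∧
      ∀ᵐ t, 0 < t → ∃ R θ : ℝ, z t = R • ellipse u w θ ∧
        r t = angRate u w (B t) (ellipse u w θ) := by
  obtain ⟨c, hc, hlow⟩ := h.le_angRate_of_tangent
  obtain ⟨C, -, hupp⟩ := exists_abs_angRate_le h.isCompact u w
  have hcont : Continuous fun t => z (max t 0) :=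
    hz.continuousOn.comp_continuous (by fun_prop) fun t => le_max_right t 0
  refine ⟨fun t => max c (min C
    (angularVelocity u w (z (max t 0)) (deriv (fun t => z (max t 0)) t))),
    measurable_const.max (measurable_const.min
      (measurable_angularVelocity u w hcont.measurable (measurable_deriv _))),
    ⟨c, hc, fun t => le_max_left _ _⟩,
    ⟨max c C, fun t => max_le_max_left c (min_le_left _ _)⟩, ?_⟩
  filter_upwards [hz.2] with t hder ht
  have hne : z t ≠ 0 := fun hzero => (seminorm_pos h.definite hz₀).ne' (by
    rw [← hf t ht.le, hzero, map_zero])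
  obtain ⟨R, hR, θ, -, hzθ⟩ := exists_ellipse_polar h.area_ne_zero hne
  obtain ⟨p, hp⟩ := subgrad_nonempty f (ellipse u w θ)
  have hconst : ∀ᶠ s in 𝓝 t, f (z s) = f (z t) := by
    filter_upwards [Ioi_mem_nhds ht] with s hs
    rw [hf s (le_of_lt hs), hf t ht.le]
  have htan := dotProduct_eq_zero_of_const (hder ht) hconst (hzθ ▸ smul_mem_subgrad hR.le hp)
  rw [hzθ, Matrix.mulVec_smul, dotProduct_smul, smul_eq_zero_iff_right hR.ne'] at htan
  have heq : (fun t => z (max t 0)) =ᶠ[𝓝 t] z := by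
    filter_upwards [Ioi_mem_nhds ht] with s hs
    rw [max_eq_left (le_of_lt hs)]
  refine ⟨R, θ, hzθ, ?_⟩
  rw [heq.deriv_eq, (hder ht).deriv, max_eq_left ht.le, hzθ,
    angularVelocity_smul_ellipse h.area_ne_zero hR.ne',
    min_eq_right ((le_abs_self _).trans (hupp θ (B t) (hB t ht.le))),
    max_eq_right (hlow θ p hp (B t) (hB t ht.le) htan)]

lemma exists_polar_angle (hz : IsFlow B z) (hB : ∀ t, 0 ≤ t → B t ∈ convexHull ℝ 𝓑)
    (hf : ∀ t, 0 ≤ t → f (z t) = f (z 0)) (hz₀ : z 0 ≠ 0) :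
    ∃ φ : ℝ ≃o ℝ, 0 ≤ φ 0 ∧ ∀ t, 0 ≤ t → z t = f (z 0) • sphereCurve f u w (φ t) := by
  obtain ⟨r, hr, ⟨c, hc, hlow⟩, ⟨C, hupp⟩, hrate⟩ := h.exists_measurable_angRate hz hB hf hz₀
  obtain ⟨e, -, he₀, ⟨K, hK⟩, -, hder⟩ := exists_orderIso_primitive hr hc hlow hupp
  obtain ⟨φ₀, hφ₀, hzφ₀⟩ := exists_eq_smul_sphereCurve h.definite h.area_ne_zero hz₀
  have hlip : LipschitzWith (1 * K) fun t => φ₀ + e t :=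
    (isometry_add_left φ₀).lipschitz.comp hK
  have hinit : z 0 = f (z 0) • sphereCurve f u w (φ₀ + e 0) := by rwa [he₀, add_zero]
  refine ⟨e.trans (OrderIso.addLeft φ₀), ?_, fun t ht =>
    h.eq_smul_sphereCurve_of_area_eq_zero hz.continuousOn hf hz₀ hlip.continuous hinit
      (fun s hs => hz.area_ellipse_eq_zero h.isCompact hB h.area_ne_zero hlip ?_ ?_ hs) ht⟩
  · simpa only [OrderIso.trans_apply, OrderIso.addLeft_apply, he₀, add_zero] using hφ₀.1
  · filter_upwards [hrate, hder] with t hrt het ht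
    obtain ⟨R, θ, hzθ, heq⟩ := hrt ht
    exact ⟨R, θ, hzθ, heq ▸ het.const_add φ₀⟩
  · rw [hinit, sphereCurve, area_smul_right, area_smul_right, area_self, mul_zero, mul_zero]

end IsOriented

/-! ### The Barabanov norm and its extremal trajectory -/

section Flow

variable {n : Type*} [Fintype n] {B B' : ℝ → Matrix n n ℝ} {z : ℝ → n → ℝ}

lemma IsFlow.const_smul (h : IsFlow B z) (a : ℝ) : IsFlow B (fun t => a • z t) := by
  refine ⟨fun T => ?_, ?_⟩
  · obtain ⟨K, hK⟩ := h.1 T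
    exact ⟨_, (lipschitzWith_smul a).comp_lipschitzOnWith hK⟩
  · filter_upwards [h.2] with t ht hpos
    rw [Matrix.mulVec_smul]
    exact (ht hpos).const_smul a

lemma IsFlow.congr_law (h : IsFlow B z) (hB : ∀ t, 0 ≤ t → B t = B' t) : IsFlow B' z := by
  refine ⟨h.1, ?_⟩
  filter_upwards [h.2] with t ht hpos
  rw [← hB t hpos.le]
  exact ht hpos

lemma smul_subgrad {f g : Seminorm ℝ (n → ℝ)} {c : ℝ} (hc : 0 ≤ c) (hg : ∀ v, g v = c * f v)
    {x p : n → ℝ} (hp : p ∈ Subgrad f x) : c • p ∈ Subgrad g x := by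
  refine ⟨by rw [smul_dotProduct, hp.1, hg, smul_eq_mul], fun v => ?_⟩
  rw [smul_dotProduct, hg, smul_eq_mul]
  exact mul_le_mul_of_nonneg_left (hp.2 v) hc

end Flow

variable {𝒜 𝓑 : Set Mat} {f g : Seminorm ℝ Plane} {u w : Plane} {D : ℝ → Mat} {Θ : ℝ ≃o ℝ} {T : ℝ}

namespace IsOriented

lemma of_eq_mul (h : IsOriented 𝓑 f u w) {c : ℝ} (hc : 0 < c) (hg : ∀ v, g v = c * f v) :
    IsOriented 𝓑 g u w := by
  have hc' : 0 < c⁻¹ := inv_pos.2 hc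
  have hf : ∀ v, f v = c⁻¹ * g v := fun v => by rw [hg, inv_mul_cancel_left₀ hc.ne']
  refine ⟨h.isCompact, fun v hv => h.definite v (by rw [hf, hv, mul_zero]), ?_, ?_,
    h.area_ne_zero, ?_⟩
  · intro x B hB p hp
    have hle := h.isInvariantFor x B hB _ (smul_subgrad hc'.le hf hp)
    rw [smul_dotProduct, smul_eq_mul] at hle
    exact nonpos_of_mul_nonpos_right hle hc'
  · intro x
    obtain ⟨B, hB, p, hp, htan⟩ := h.exists_tangent x
    exact ⟨B, hB, _, smul_subgrad hc.le hg hp, by rw [smul_dotProduct, htan, smul_zero]⟩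
  · rintro θ ⟨p, hp, B, hB, htan, hneg⟩
    exact h.not_isBackward θ ⟨_, smul_subgrad hc'.le hf hp, B, hB,
      by rw [smul_dotProduct, htan, smul_zero], hneg⟩

lemma exists_eq_smul_sphereCurve (h : IsOriented 𝓑 f u w) (v : Plane) :
    ∃ θ, 0 ≤ θ ∧ v = f v • sphereCurve f u w θ := by
  rcases eq_or_ne v 0 with rfl | hv
  · exact ⟨0, le_rfl, by rw [map_zero, zero_smul]⟩
  · obtain ⟨θ, hθ, hvθ⟩ :=
      PlanarSwitching.exists_eq_smul_sphereCurve h.definite h.area_ne_zero hv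
    exact ⟨θ, hθ.1, hvθ⟩

end IsOriented

namespace IsSphereMotion

variable (hM : IsSphereMotion 𝓑 f u w D Θ T)

include hM

lemma mem_convexHull (t : ℝ) : D t ∈ convexHull ℝ 𝓑 :=
  subset_convexHull ℝ 𝓑 (hM.mem t)

lemma isFlow_zero : IsFlow D fun t => sphereCurve f u w (Θ t) := by
  simpa only [zero_add] using hM.isFlow 0

lemma angle_two_mul : Θ (2 * T) = 2 * Real.pi := by
  rw [two_mul, hM.angle_add, two_mul, ← zero_add T, hM.angle_add, hM.angle_zero, zero_add]

lemma bijOn (hdef : ∀ v, f v = 0 → v = 0) (harea : area u w ≠ 0) :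
    BijOn (fun t => sphereCurve f u w (Θ t)) (Ico 0 (2 * T)) (unitSphere f) := by
  have hΘ : BijOn Θ (Ico 0 (2 * T)) (Ico 0 (2 * Real.pi)) := by
    simpa only [Θ.image_Ico, hM.angle_zero, hM.angle_two_mul] using
      (Θ.injective.injOn (s := Ico 0 (2 * T))).bijOn_image
  exact (bijOn_sphereCurve hdef harea).comp hΘ

/-- A period shorter than half a turn would make two independent solutions of the same equation
recur up to sign, although negative traces contract the area between them. -/
lemma le_of_law_period (hc : IsCompact 𝓑) (hdef : ∀ v, f v = 0 → v = 0) (harea : area u w ≠ 0)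
    (htr : ∀ B ∈ 𝓑, B.trace < 0) {P : ℝ} (hP : 0 < P) (hper : ∀ t, 0 ≤ t → D (t + P) = D t) :
    T ≤ P := by
  by_contra! hPT
  obtain ⟨B₀, hB₀, hmax⟩ := hc.exists_isMaxOn (f := Matrix.trace) ⟨D 0, hM.mem 0⟩
    continuous_id.matrix_trace.continuousOn
  have hshifted : IsFlow D fun t => sphereCurve f u w (Θ (P + t)) :=
    (hM.isFlow P).congr_law fun t ht => by rw [add_comm P, hper t ht]
  have hcontract := hM.isFlow_zero.area_sq_le hshifted (fun t _ => hmax (hM.mem t)) hM.pos.le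
  have hexp : Real.exp (2 * B₀.trace * T) < 1 := Real.exp_lt_one_iff.2
    (mul_neg_of_neg_of_pos (mul_neg_of_pos_of_neg two_pos (htr B₀ hB₀)) hM.pos)
  have hΘT : Θ T = Θ 0 + Real.pi := by simpa only [zero_add] using hM.angle_add 0
  have hsin : 0 < Real.sin (Θ P - Θ 0) := Real.sin_pos_of_pos_of_lt_pi
    (sub_pos.2 (Θ.strictMono hP)) (sub_lt_iff_lt_add'.2 (hΘT ▸ Θ.strictMono hPT))
  have hne : area (sphereCurve f u w (Θ 0)) (sphereCurve f u w (Θ P)) ≠ 0 := by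
    rw [sphereCurve, sphereCurve, area_smul_left, area_smul_right, area_ellipse_ellipse]
    exact mul_ne_zero (inv_ne_zero (seminorm_ellipse_pos hdef harea _).ne') (mul_ne_zero
      (inv_ne_zero (seminorm_ellipse_pos hdef harea _).ne') (mul_ne_zero harea hsin.ne'))
  rw [hM.angle_add, hΘT, sphereCurve_add_pi, sphereCurve_add_pi, area_neg_neg, add_zero]
    at hcontract
  exact hcontract.not_gt (mul_lt_of_lt_one_right (pow_two_pos_of_ne_zero hne) hexp)

end IsSphereMotion

lemma IsSphereMotion.sameTrajectory
    (hM : IsSphereMotion (shiftSet 𝒜 (lyapunovExponent 𝒜)) f u w D Θ T)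
    (hc : IsCompact 𝒜) (h : IsOriented (shiftSet 𝒜 (lyapunovExponent 𝒜)) f u w) {y : ℝ → Plane}
    (hy : IsExtremalTrajectory 𝒜 f y) (hy₀ : y 0 ≠ 0) :
    SameTrajectory (lyapunovExponent 𝒜) y
      fun t => Real.exp (lyapunovExponent 𝒜 * t) • sphereCurve f u w (Θ t) := by
  obtain ⟨B, hB, hz⟩ := hy.1.exists_isFlow_shiftSet hc (lyapunovExponent 𝒜)
  have hz₀ : Real.exp (-lyapunovExponent 𝒜 * 0) • y 0 = y 0 := by
    rw [mul_zero, Real.exp_zero, one_smul]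
  obtain ⟨φ, hφ₀, hφ⟩ := h.exists_polar_angle hz hB (fun t ht => by
    rw [hz₀, seminorm_exp_smul, hy.2 t ht, neg_mul, ← mul_assoc, exp_neg_mul_exp, one_mul])
    (hz₀.symm ▸ hy₀)
  refine ⟨f (y 0), φ.trans Θ.symm, seminorm_pos h.definite hy₀, ?_,
    (φ.trans Θ.symm).continuous.continuousOn, (φ.trans Θ.symm).strictMono.strictMonoOn _,
    (φ.trans Θ.symm).tendsto_atTop, fun t ht => ?_⟩
  · rwa [OrderIso.trans_apply, Θ.le_symm_apply, hM.angle_zero]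
  · rw [hφ t ht, hz₀, neg_mul, exp_neg_smul_exp_smul, OrderIso.trans_apply, Θ.apply_symm_apply]

lemma IsOriented.isBarabanovNorm (h : IsOriented (shiftSet 𝒜 (lyapunovExponent 𝒜)) f u w)
    (hc : IsCompact 𝒜) : IsBarabanovNorm 𝒜 f := by
  obtain ⟨D, Θ, T, hM⟩ := h.exists_isSphereMotion
  refine ⟨h.definite, fun x hx t ht => h.isInvariantFor.apply_le_exp_mul hc hx.convexHull ht,
    fun v => ?_⟩
  obtain ⟨θ, -, hvθ⟩ := h.exists_eq_smul_sphereCurve v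
  have hnorm : ∀ t, f (f v • sphereCurve f u w (Θ t)) = f v := fun t => by
    rw [map_smul_eq_mul, seminorm_sphereCurve h.definite h.area_ne_zero, mul_one,
      Real.norm_of_nonneg (apply_nonneg f v)]
  refine ⟨_, ((hM.isFlow (Θ.symm θ)).const_smul (f v)).isExtremalTrajectory hc
    (fun i j => (hM.measurable i j).comp (measurable_const_add _))
    (fun t _ => hM.mem_convexHull _) fun t _ => by simp only [hnorm], ?_⟩
  rw [mul_zero, Real.exp_zero, one_smul, add_zero, Θ.apply_symm_apply]
  exact hvθ.symm

lemma IsOriented.exists_eq_mul (h : IsOriented 𝓑 f u w) (hg : IsInvariantFor 𝓑 g)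
    (hgdef : ∀ v, g v = 0 → v = 0) : ∃ c : ℝ, 0 < c ∧ ∀ v, g v = c * f v := by
  obtain ⟨D, Θ, T, hM⟩ := h.exists_isSphereMotion
  refine h.isInvariantFor.exists_eq_mul_of_periodic h.definite hg hgdef hM.isFlow_zero
    (fun t _ => hM.mem_convexHull t) (mul_pos two_pos hM.pos) (fun t _ => ?_) fun v _ => ?_
  · rw [two_mul, ← add_assoc, hM.angle_add, hM.angle_add, sphereCurve_add_pi, sphereCurve_add_pi,
      neg_neg]
  · obtain ⟨θ, hθ, hvθ⟩ := h.exists_eq_smul_sphereCurve v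
    refine ⟨Θ.symm θ, ?_, f v, ?_⟩
    · rwa [Θ.le_symm_apply, hM.angle_zero]
    · rwa [Θ.apply_symm_apply]

theorem IsOriented.exists_periodic_extremal
    (h : IsOriented (shiftSet 𝒜 (lyapunovExponent 𝒜)) f u w) (hc : IsCompact 𝒜)
    (htr : ∀ B ∈ shiftSet 𝒜 (lyapunovExponent 𝒜), B.trace < 0) :
    ∃ (A : ℝ → Mat) (x : ℝ → Plane) (T : ℝ), IsExtremalTrajectory 𝒜 f x ∧
      (∀ y : ℝ → Plane, IsExtremalTrajectory 𝒜 f y → y 0 ≠ 0 →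
        SameTrajectory (lyapunovExponent 𝒜) y x) ∧
      IsSwitchingLaw 𝒜 A ∧ IsSolution A x ∧ IsMinimalPeriod A T ∧
      BijOn (fun t => Real.exp (-lyapunovExponent 𝒜 * t) • x t) (Ico 0 (2 * T)) (unitSphere f) := by
  obtain ⟨D, Θ, T, hM⟩ := h.exists_isSphereMotion
  have hhull : ∀ t, 0 ≤ t → D t ∈ convexHull ℝ _ := fun t _ => hM.mem_convexHull t
  have hsphere := seminorm_sphereCurve h.definite h.area_ne_zero
  refine ⟨fun t => D t + lyapunovExponent 𝒜 • (1 : Mat),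
    fun t => Real.exp (lyapunovExponent 𝒜 * t) • sphereCurve f u w (Θ t), T,
    hM.isFlow_zero.isExtremalTrajectory hc hM.measurable hhull fun t _ => by rw [hsphere, hsphere],
    fun y hy hy₀ => hM.sameTrajectory hc h hy hy₀,
    ⟨fun i j => (hM.measurable i j).add_const _, fun t _ => mem_shiftSet.1 (hM.mem t)⟩,
    (hM.isFlow_zero.isSwitchingLaw_and_isSolution hc hM.measurable hhull).2,
    ⟨⟨hM.pos, fun t _ => by simp only [hM.periodic t]⟩, fun P hP => ?_⟩, ?_⟩
  · exact hM.le_of_law_period h.isCompact h.definite h.area_ne_zero htr hP.1 fun t ht =>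
      add_right_cancel (hP.2 t ht)
  · simpa only [neg_mul, exp_neg_smul_exp_smul] using hM.bijOn h.definite h.area_ne_zero

end PlanarSwitching

theorem corollaryc10 (𝒜 : Set PlanarSwitching.Mat) (hcompact : IsCompact 𝒜)
    (hirr : PlanarSwitching.IsIrreducible 𝒜)
    (hscalar : PlanarSwitching.lyapunovExponent 𝒜 • (1 : PlanarSwitching.Mat) ∉ 𝒜)
    (hreal : ¬ PlanarSwitching.HasRealDominance 𝒜) :
    (∃ f : Seminorm ℝ PlanarSwitching.Plane,
      PlanarSwitching.IsBarabanovNorm 𝒜 f ∧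
      (∀ g : Seminorm ℝ PlanarSwitching.Plane, PlanarSwitching.IsBarabanovNorm 𝒜 g →
        ∃ c : ℝ, 0 < c ∧ ∀ v, g v = c * f v) ∧
      PlanarSwitching.IsC1ClosedCurve (PlanarSwitching.unitSphere f)) ∧
    (¬ PlanarSwitching.HasComplexDominance 𝒜 →
      ∀ f : Seminorm ℝ PlanarSwitching.Plane, PlanarSwitching.IsBarabanovNorm 𝒜 f →
        ∃ (A : ℝ → PlanarSwitching.Mat) (x : ℝ → PlanarSwitching.Plane) (T : ℝ),
          PlanarSwitching.IsExtremalTrajectory 𝒜 f x ∧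
          (∀ y : ℝ → PlanarSwitching.Plane, PlanarSwitching.IsExtremalTrajectory 𝒜 f y →
            y 0 ≠ 0 →
              PlanarSwitching.SameTrajectory (PlanarSwitching.lyapunovExponent 𝒜) y x) ∧
          PlanarSwitching.IsSwitchingLaw 𝒜 A ∧
          PlanarSwitching.IsSolution A x ∧
          PlanarSwitching.IsMinimalPeriod A T ∧
          Set.BijOn (fun t => Real.exp (-PlanarSwitching.lyapunovExponent 𝒜 * t) • x t)
            (Set.Ico 0 (2 * T)) (PlanarSwitching.unitSphere f)) := by
  obtain ⟨f, hdef, hinv, hext⟩ := PlanarSwitching.exists_adapted_norm hcompact hirr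
  by_cases hcomplex : PlanarSwitching.HasComplexDominance 𝒜
  · exact ⟨⟨f, hcomplex.isBarabanovNorm hcompact hdef hinv⟩, fun h => absurd hcomplex h⟩
  have htrace := PlanarSwitching.trace_neg_of_not_dominance hscalar hreal hcomplex hdef hinv
  have hne := PlanarSwitching.mulVec_ne_zero_of_not_dominance hscalar hreal hcomplex hdef hinv
  obtain ⟨u, w, h⟩ := PlanarSwitching.exists_isOriented
    (PlanarSwitching.isCompact_shiftSet hcompact _) hdef hinv hext hne
  have hunique : ∀ g, PlanarSwitching.IsBarabanovNorm 𝒜 g →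
      ∃ c : ℝ, 0 < c ∧ ∀ v, g v = c * f v := fun g hg =>
    h.exists_eq_mul hg.isInvariantFor hg.definite
  refine ⟨⟨f, h.isBarabanovNorm hcompact, hunique, PlanarSwitching.isC1ClosedCurve_unitSphere hdef
    h.area_ne_zero h.contDiff_seminorm_ellipse⟩, fun _ g hg => ?_⟩
  obtain ⟨c, hc, hgf⟩ := hunique g hg
  exact (h.of_eq_mul hc hgf).exists_periodic_extremal hcompact fun B hB =>
    htrace B (subset_convexHull ℝ _ hB)
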